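/- Let $N\ge 1$ and let $\mu,\nu$ be Borel probability measures on $\mathbb R^N$, with generic points $x=(x_1,\dots,x_N)$ and $y=(y_1,\dots,y_N)$. For measures $\eta,\rho$ let $\Pi(\eta,\rho)$ be the set of probability measures with marginals $\eta$ and $\rho$. A plan $\gamma\in\Pi(\mu,\nu)$ is *causal*, $\gamma\in\Pi_c(\mu,\nu)$, if for all $t\le N$ and every event $B$ depending on $(y_1,\dots,y_t)$ only, $x\mapsto\gamma^x(B)$ is $\mu$-a.s. equal to a measurable function of $(x_1,\dots,x_t)$; superscripts denote regular conditional distributions (disintegrations). Assume that $\mu$ is Markov, i.e. $\mu^{x_1,\dots,x_t}(dx_{t+1})=\mu^{x_t}(dx_{t+1})$ $\mu$-a.s. for $1\le t<N$, and let $$c(x,y)=\sum_{t=1}^N c_t(x_t,y_1,\dots,y_t),\qquad c_t:\mathbb R\times\mathbb R^t\to[0,\infty]\ \text{lower semicontinuous}.$$ Fix any Borel versions of the probability kernels $x_t\mapsto\mu^{x_t}(dx_{t+1})$ and $(y_1,\dots,y_t)\mapsto\nu^{y_1,\dots,y_t}(dy_{t+1})$, $1\le t<N$. Let $\mu_t$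 be the law of $x_t$ under $\mu$ and $\nu_1$ the law of $y_1$ under $\nu$. For probability measures $m$ on $\mathbb R$ write $m\mu^{(t)}:=\int m(dx_t)\,\mu^{x_t}(dx_{t+1})$. Put $V_N:=0$ and, for $t=N,\dots,2$, $$V_{t-1}(y_1,\dots,y_{t-1};m):=\inf_{\gamma_t\in\Pi(m\mu^{(t-1)},\,\nu^{y_1,\dots,y_{t-1}})}\int\gamma_t(dx_t,dy_t)\Big\{c_t(x_t,y_1,\dots,y_t)+V_t(y_1,\dots,y_t;\gamma_t^{y_t}(dx_t))\Big\},$$ $$V_0:=\inf_{\gamma_1\in\Pi(\mu_1,\nu_1)}\int\gamma_1(dx_1,dy_1)\big\{c_1(x_1,y_1)+V_1(y_1;\gamma_1^{y_1}(dx_1))\big\}.$$ Then: 1. All integrals above are well defined: for every admissible $\gamma_t$ (all $y_1,\dots,y_{t-1}$ and $m$) the integrand is measurable with respect to the $\gamma_t$-completion. 2. $V_0=\inf_{\gamma\in\Pi_c(\mu,\nu)}\int c\,d\gamma$. 3. Suppose that $\mu$ is successively weakly continuous: for each $1\le t<N$ there is a version of $(x_1,\dots,x_t)\mapsto\mu^{x_1,\dots,x_t}(dx_{t+1},\dots,dx_N)$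 whose restriction to the projection of $\operatorname{supp}\mu$ to the first $t$ coordinates is continuous for weak convergence. Then the infimum in 2 is attained by some $\tilde\gamma\in\Pi_c(\mu,\nu)$ which is quasi-Markov: for all $1\le t<N$, $\tilde\gamma$-a.s., $$\tilde\gamma^{x_1,\dots,x_t,y_1,\dots,y_t}(dx_{t+1},dy_{t+1})=\tilde\gamma^{x_t,y_1,\dots,y_t}(dx_{t+1},dy_{t+1}).$$ 4. For $1\le t\le N$ and fixed $y_1,\dots,y_{t-1}$ put $$C_t(y_t,p):=\int p(dx_t)\,c_t(x_t,y_1,\dots,y_t)+V_t(y_1,\dots,y_t;p),\qquad p\ \text{a probability measure on }\mathbb R.$$ Each one-step problem is the general (nonlinear) transport problem with this cost: for $2\le t\le N$ $$V_{t-1}(y_1,\dots,y_{t-1};m)=\inf_{q}\int\nu^{y_1,\dots,y_{t-1}}(dy_t)\,C_t(y_t,q^{y_t}),$$ over the probability kernels $y_t\mapsto q^{y_t}(dx_t)$ with $\int\nu^{y_1,\dots,y_{t-1}}(dy_t)\,q^{y_t}=m\mu^{(t-1)}$, the integrands being measurable with respect to the completion of $\nu^{y_1,\dots,y_{t-1}}$;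 the same holds for $V_0$ with $t=1$, $\nu_1$ and $\mu_1$ in place of $\nu^{y_1,\dots,y_{t-1}}$ and $m\mu^{(t-1)}$. For all $y_1,\dots,y_t$ the function $p\mapsto C_t(y_t,p)$ is convex. 5. If, moreover, for every $1\le t<N$ the chosen transition kernel $x_t\mapsto\mu^{x_t}(dx_{t+1})$ is continuous for weak convergence on $\operatorname{supp}\mu_t$, then for all $1\le t\le N$ and all $y_1,\dots,y_t$ the function $p\mapsto C_t(y_t,p)$ is lower semicontinuous for weak convergence on the set of probability measures $p$ with $p(\operatorname{supp}\mu_t)=1$. -/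

import Mathlib

open MeasureTheory ProbabilityTheory Set
open scoped ENNReal NNReal

noncomputable section

namespace CausalDPP

/-- Trajectories of a real-valued process in `N` steps. The `t`-th variable `x_t` (`1 ≤ t ≤ N`) is
the coordinate with index `t - 1`. -/
abbrev Path (N : ℕ) : Type := Fin N → ℝ

/-- The first `t` variables `(x_1, …, x_t)` of a path. -/
def hist {N : ℕ} (t : ℕ) (h : t ≤ N) (x : Path N) : Path t := fun i => x (Fin.castLE h i)

/-- The remaining variables `(x_{t+1}, …, x_N)` of a path. -/
def future {N : ℕ} (t : ℕ) (x : Path N) : Path (N - t) :=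
  fun j => x ⟨t + j.1, by have := j.2; omega⟩

/-- `K` is a version of the regular conditional distribution of `Y` given `X` under `P`. -/
def IsRegCond {Ω α β : Type*} [MeasurableSpace Ω] [MeasurableSpace α] [MeasurableSpace β]
    (P : Measure Ω) (X : Ω → α) (Y : Ω → β) (K : Kernel α β) : Prop :=
  (P.map X).compProd K = P.map (fun ω => (X ω, Y ω))

/-- `Π(μ, ν)`: the transport plans with marginals `μ` and `ν`. -/
def Couplings {α β : Type*} [MeasurableSpace α] [MeasurableSpace β]
    (μ : Measure α) (ν : Measure β) : Set (ProbabilityMeasure (α × β)) :=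
  {γ | (γ : Measure (α × β)).fst = μ ∧ (γ : Measure (α × β)).snd = ν}

/-- `Π_c(μ, ν)`: the causal transport plans. For every `t` and every event `B` of the first `t`
variables of `y`, the map `x ↦ γ^x(B)` is `μ`-almost surely equal to a measurable function of
`(x_1, …, x_t)`. -/
def CausalPlans {N : ℕ} (μ ν : Measure (Path N)) : Set (ProbabilityMeasure (Path N × Path N)) :=
  {γ | γ ∈ Couplings μ ν ∧
    ∀ (t : ℕ) (h : t ≤ N) (B : Set (Path t)), MeasurableSet B →
      ∃ g : Path t → ℝ≥0∞, Measurable g ∧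
        ∀ᵐ x ∂μ, (γ : Measure (Path N × Path N)).condKernel x (hist t h ⁻¹' B) = g (hist t h x)}

/-- `μ` is Markov: `μ^{x_1,…,x_t}(dx_{t+1}) = μ^{x_t}(dx_{t+1})` for `1 ≤ t < N`
(here `t = s + 1`). -/
def IsMarkovMeasure {N : ℕ} (μ : Measure (Path N)) [IsFiniteMeasure μ] : Prop :=
  ∀ (s : ℕ) (h : s + 1 < N), ∀ᵐ x ∂μ,
    condDistrib (fun x : Path N => x ⟨s + 1, h⟩) (hist (s + 1) h.le) μ (hist (s + 1) h.le x) =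
    condDistrib (fun x : Path N => x ⟨s + 1, h⟩) (fun x : Path N => x ⟨s, by omega⟩) μ
      (x ⟨s, by omega⟩)

/-- The quasi-Markov property
`γ^{x_1,…,x_t,y_1,…,y_t}(dx_{t+1},dy_{t+1}) = γ^{x_t,y_1,…,y_t}(dx_{t+1},dy_{t+1})` for
`1 ≤ t < N` (here `t = s + 1`). -/
def IsQuasiMarkov {N : ℕ} (γ : ProbabilityMeasure (Path N × Path N)) : Prop :=
  ∀ (s : ℕ) (h : s + 1 < N), ∀ᵐ p ∂(γ : Measure (Path N × Path N)),
    condDistrib (fun p : Path N × Path N => (p.1 ⟨s + 1, h⟩, p.2 ⟨s + 1, h⟩))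
      (fun p : Path N × Path N => (hist (s + 1) h.le p.1, hist (s + 1) h.le p.2))
      (γ : Measure (Path N × Path N)) (hist (s + 1) h.le p.1, hist (s + 1) h.le p.2) =
    condDistrib (fun p : Path N × Path N => (p.1 ⟨s + 1, h⟩, p.2 ⟨s + 1, h⟩))
      (fun p : Path N × Path N => (p.1 ⟨s, by omega⟩, hist (s + 1) h.le p.2))
      (γ : Measure (Path N × Path N)) (p.1 ⟨s, by omega⟩, hist (s + 1) h.le p.2)

/-- The map `x ↦ K x` is continuous on `S` for the topology of weak convergence. -/
def WeaklyContinuousOn {α β : Type*} [TopologicalSpace α] [MeasurableSpace α]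
    [TopologicalSpace β] [MeasurableSpace β] [OpensMeasurableSpace β]
    (K : Kernel α β) [IsMarkovKernel K] (S : Set α) : Prop :=
  ContinuousOn (Y := ProbabilityMeasure β) (fun x => ⟨K x, inferInstance⟩) S

/-- Successive weak continuity: for `1 ≤ t < N` some version of
`(x_1, …, x_t) ↦ μ^{x_1,…,x_t}(dx_{t+1}, …, dx_N)` is weakly continuous on the projection of the
support of `μ` to the first `t` variables. -/
def SuccessivelyWeaklyContinuous {N : ℕ} (μ : Measure (Path N)) : Prop :=
  ∀ (t : ℕ) (_ : 1 ≤ t) (h : t < N),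
    ∃ (K : Kernel (Path t) (Path (N - t))) (_ : IsMarkovKernel K),
      IsRegCond μ (hist t h.le) (future t) K ∧ WeaklyContinuousOn K (hist t h.le '' μ.support)

/-- The semiseparable cost `∑_t c_t(x_t, y_1, …, y_t)`, with `t = i + 1`. -/
def totalCost {N : ℕ} (c : (t : ℕ) → ℝ → Path t → ℝ≥0∞) (p : Path N × Path N) : ℝ≥0∞ :=
  ∑ i : Fin N, c (i.1 + 1) (p.1 i) (hist (i.1 + 1) i.2 p.2)

/-- The value of the causal transport problem. -/
def causalValue {N : ℕ} (μ ν : Measure (Path N)) (c : (t : ℕ) → ℝ → Path t → ℝ≥0∞) : ℝ≥0∞ :=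
  ⨅ γ ∈ CausalPlans μ ν, ∫⁻ p, totalCost c p ∂(γ : Measure (Path N × Path N))

/-- The regular kernel `y ↦ γ^y(dx)` of a plan `γ(dx, dy)` with respect to its second variable. -/
def kernelGivenSnd (γ : ProbabilityMeasure (ℝ × ℝ)) : Kernel ℝ ℝ :=
  ((γ : Measure (ℝ × ℝ)).map Prod.swap).condKernel

/-- The integrand `c_{t+1}(x, y_1, …, y_t, y) + W(y_1, …, y_t, y; γ^y)` of a one-step problem, as a
function of `(x, y)`. -/
def stepIntegrand {t : ℕ} (ct : ℝ → Path (t + 1) → ℝ≥0∞)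
    (W : Path (t + 1) → Measure ℝ → ℝ≥0∞) (y : Path t)
    (γ : ProbabilityMeasure (ℝ × ℝ)) (p : ℝ × ℝ) : ℝ≥0∞ :=
  ct p.1 (Fin.snoc (α := fun _ => ℝ) y p.2) +
    W (Fin.snoc (α := fun _ => ℝ) y p.2) (kernelGivenSnd γ p.2)

/-- The value functions `V_t(y_1, …, y_t; m)`: `V_N = 0`, and for `t < N`,
`V_t(y; m)` is the infimum over `γ ∈ Π(∫ m(dx) μ^x, ν^{y})` of
`∫ γ(dx, dy') (c_{t+1}(x, y, y') + V_{t+1}(y, y'; γ^{y'}))`. Here `κ t` stands for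
`x_t ↦ μ^{x_t}(dx_{t+1})` and `θ t` for `(y_1, …, y_t) ↦ ν^{y_1,…,y_t}(dy_{t+1})`. -/
def valueFn (N : ℕ) (c : (t : ℕ) → ℝ → Path t → ℝ≥0∞) (κ : ℕ → Kernel ℝ ℝ)
    (θ : (t : ℕ) → Kernel (Path t) ℝ) (t : ℕ) (y : Path t) (m : Measure ℝ) : ℝ≥0∞ :=
  if _h : t < N then
    ⨅ γ ∈ Couplings (m.bind (κ t)) (θ t y),
      ∫⁻ p, stepIntegrand (c (t + 1)) (fun y' m' => valueFn N c κ θ (t + 1) y' m') y γ p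
        ∂(γ : Measure (ℝ × ℝ))
  else 0
termination_by N - t

/-- The initial value `V_0`, with `μ₁` and `ν₁` the laws of the first variables. -/
def valueZero (N : ℕ) (c : (t : ℕ) → ℝ → Path t → ℝ≥0∞) (κ : ℕ → Kernel ℝ ℝ)
    (θ : (t : ℕ) → Kernel (Path t) ℝ) (μ₁ ν₁ : Measure ℝ) : ℝ≥0∞ :=
  ⨅ γ ∈ Couplings μ₁ ν₁,
    ∫⁻ p, stepIntegrand (c 1) (valueFn N c κ θ 1) Fin.elim0 γ p ∂(γ : Measure (ℝ × ℝ))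

/-- General (nonlinear) transport problem with cost `C(y, q^y)`: the infimum of
`∫ ρ(dy) C(y, q^y)` over the probability kernels `y ↦ q^y` such that `∫ ρ(dy) q^y = η`. -/
def generalTransport (η ρ : Measure ℝ) (C : ℝ → Measure ℝ → ℝ≥0∞) : ℝ≥0∞ :=
  ⨅ (q : Kernel ℝ ℝ) (_ : IsMarkovKernel q) (_ : ρ.bind q = η), ∫⁻ y, C y (q y) ∂ρ

/-- The cost of the one-step general transport problem after `(y_1, …, y_t)`:
`(y', p) ↦ ∫ p(dx) c_{t+1}(x, y_1, …, y_t, y') + V_{t+1}(y_1, …, y_t, y'; p)`. -/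
def stepCost (N : ℕ) (c : (t : ℕ) → ℝ → Path t → ℝ≥0∞) (κ : ℕ → Kernel ℝ ℝ)
    (θ : (t : ℕ) → Kernel (Path t) ℝ) (t : ℕ) (y : Path t) (y' : ℝ) (p : Measure ℝ) : ℝ≥0∞ :=
  (∫⁻ x, c (t + 1) x (Fin.snoc (α := fun _ => ℝ) y y') ∂p) +
    valueFn N c κ θ (t + 1) (Fin.snoc (α := fun _ => ℝ) y y') p

end CausalDPP

end

open MeasureTheory ProbabilityTheory Set
open scoped ENNReal NNReal

namespace CausalDPP

open Filter Topology TopologicalSpace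

/-! ### The weak topology on probability measures: countable subbasis, Borel structure. -/

section SpaceOfMeasures

variable {X : Type*} [MeasurableSpace X]

/-! Write `y^t` for the first `t` variables of `y`. Since `c_t` sees `x` only through `x_t`, the
cost of a plan depends only on its flow, the laws `m_t(y^t)` of `x_t` given `y^t`
(`lintegral_totalCost`). Under a causal plan with Markov first marginal, `x_{t+1}` given both pasts
is drawn from `μ^{x_t}`. Computing the law of `x_{t+1}` given `y^t` in two ways then yields the flow
equation `∫ ν^{y^t}(dy_{t+1}) m_{t+1}(y^{t+1}) = m_t(y^t) μ^{(t)}`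
(`ae_bind_eq_of_mem_causalPlans`). Conversely, a flow solving this equation comes from a causal
quasi-Markov plan: draw `x_{t+1}` from `μ^{x_t}`, then `y_{t+1}` from its conditional law given
`(y^t, x_{t+1})` that the flow prescribes (`nextKernel`). The causal problem is thus a control
problem with state `(y^t, m_t)`, and the `V_t` are its Bellman functions. Any causal plan costs at
least `V_0`, because its flow is admissible at each step and the one-step inequalities telescope; a
flow made of one-step optimizers turns them into equalities.

This requires optimizers that depend measurably on `(y^t, m)`. The one-step functional `γ ↦ ∫ C(y,
γ^y)` is nonlinear, but it is weakly lower semicontinuous when `C` is jointly lower semicontinuous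
and convex in the measure (`lowerSemicontinuous_disintegratedCost`): pass to the laws of `(y, γ^y)`,
extract a limit by tightness and apply Jensen's inequality. If the transition kernels are weakly
continuous, compactness of the sets of couplings gives attainment, measurable selection of
minimizers, and lower semicontinuity of the value. The value is again convex, since optimal kernels
can be mixed.

Kernels that are merely Borel become continuous for finer Polish topologies, which have the same
Borel sets. The backward induction (`regular_valueFn`) therefore carries convexity together with
lower semicontinuity for some refinement. For the last assertion the refinement is kept trivial on
the supports of the laws of `x_t`; the transition kernels send one support into the next, so that
for measures carried by these sets the refined and the original weak convergence agree. -/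

theorem lowerSemicontinuous_measure_of_isOpen [TopologicalSpace X] [PseudoMetrizableSpace X]
    [SecondCountableTopology X] [OpensMeasurableSpace X] {U : Set X} (hU : IsOpen U) :
    LowerSemicontinuous fun p : ProbabilityMeasure X => (p : Measure X) U := by
  intro p r hr
  have h := ProbabilityMeasure.le_liminf_measure_open_of_tendsto (tendsto_id (x := 𝓝 p)) hU
  exact eventually_lt_of_lt_liminf (hr.trans_le h)

/-- The finite unions of sets of a countable basis. -/
def basicUnions (X : Type*) [TopologicalSpace X] [SecondCountableTopology X] : Set (Set X) :=
  (fun F : Set (Set X) => ⋃₀ F) '' {F | F.Finite ∧ F ⊆ countableBasis X}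

theorem countable_basicUnions {X : Type*} [TopologicalSpace X] [SecondCountableTopology X] :
    (basicUnions X).Countable :=
  (Set.countable_ofPred_finite_subset (countable_countableBasis X)).image _

theorem isOpen_of_mem_basicUnions {X : Type*} [TopologicalSpace X] [SecondCountableTopology X] {U : Set X}
    (hU : U ∈ basicUnions X) : IsOpen U := by
  obtain ⟨F, ⟨-, hF⟩, rfl⟩ := hU
  exact isOpen_sUnion fun s hs => isOpen_of_mem_countableBasis (hF hs)

theorem exists_mem_basicUnions_lt [TopologicalSpace X] [SecondCountableTopology X]
    (p : ProbabilityMeasure X) {G : Set X} (hG : IsOpen G) {r : ℝ≥0∞}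
    (hr : r < (p : Measure X) G) : ∃ U ∈ basicUnions X, U ⊆ G ∧ r < (p : Measure X) U := by
  lift r to ℝ≥0 using (hr.trans_le le_top).ne
  rw [← ProbabilityMeasure.ennreal_coeFn_eq_coeFn_toMeasure, ENNReal.coe_lt_coe] at hr
  obtain ⟨T, hT, hTr, hTG⟩ := p.exists_lt_measure_biUnion_of_isOpen (S := countableBasis X)
    (fun u hu x hx => by
      obtain ⟨s, hs, hxs, hsu⟩ := (isBasis_countableBasis X).exists_subset_of_mem_open hx hu
      exact ⟨s, hs, (isOpen_of_mem_countableBasis hs).mem_nhds hxs, hsu⟩) hG hr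
  refine ⟨⋃ t ∈ T, t, ⟨T, ⟨T.finite_toSet, hT⟩, by simp [sUnion_eq_biUnion]⟩, hTG, ?_⟩
  rw [← ProbabilityMeasure.ennreal_coeFn_eq_coeFn_toMeasure]
  exact_mod_cast hTr

/-- Weak convergence follows from lower semicontinuity on finite unions of basic open sets. -/
theorem tendsto_of_forall_basicUnions [TopologicalSpace X] [SecondCountableTopology X]
    [OpensMeasurableSpace X] {ι : Type*} {l : Filter ι} [l.IsCountablyGenerated]
    {q : ι → ProbabilityMeasure X} {p : ProbabilityMeasure X}
    (h : ∀ U ∈ basicUnions X, ∀ r < (p : Measure X) U, ∀ᶠ i in l, r < (q i : Measure X) U) :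
    Tendsto q l (𝓝 p) := by
  refine tendsto_of_forall_isOpen_le_liminf' fun G hG => ?_
  refine le_of_forall_lt fun r hr => ?_
  obtain ⟨r', hr, hr'⟩ := exists_between hr
  obtain ⟨U, hU, hUG, hUr⟩ := exists_mem_basicUnions_lt p hG hr'
  refine hr.trans_le (le_liminf_of_le (by isBoundedDefault) ?_)
  filter_upwards [h U hU r' hUr] with i hi
  exact hi.le.trans (measure_mono hUG)

variable [TopologicalSpace X] [PseudoMetrizableSpace X] [SecondCountableTopology X]

/-- Countably many sets generating the weak topology. -/
def weakSubbasis (X : Type*) [MeasurableSpace X] [TopologicalSpace X]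
    [SecondCountableTopology X] : Set (Set (ProbabilityMeasure X)) :=
  (fun z : Set X × ℚ => {p : ProbabilityMeasure X | ENNReal.ofReal z.2 < (p : Measure X) z.1}) ''
    (basicUnions X ×ˢ univ)

theorem countable_weakSubbasis {X : Type*} [MeasurableSpace X] [TopologicalSpace X]
    [SecondCountableTopology X] : (weakSubbasis X).Countable :=
  (countable_basicUnions.prod countable_univ).image _

theorem weakTopology_eq_generateFrom [OpensMeasurableSpace X] :
    (inferInstance : TopologicalSpace (ProbabilityMeasure X)) = generateFrom (weakSubbasis X) := by
  apply le_antisymm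
  · refine le_generateFrom ?_
    rintro _ ⟨⟨U, q⟩, ⟨hU, -⟩, rfl⟩
    exact (lowerSemicontinuous_measure_of_isOpen (isOpen_of_mem_basicUnions hU)).isOpen_preimage _
  · refine continuous_id_iff_le.1 ?_
    rw [@continuous_iff_continuousAt _ _ (generateFrom (weakSubbasis X)) _]
    intro p
    -- The convergence criterion concerns countably generated filters, and the generated topology is
    -- second countable by construction.
    have hc : (@nhds _ (generateFrom (weakSubbasis X)) p).IsCountablyGenerated := by
      have (A : Type _) [TopologicalSpace A] [SecondCountableTopology A] (a : A) :
          (𝓝 a).IsCountablyGenerated := inferInstance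
      exact @this _ (generateFrom (weakSubbasis X))
        (@SecondCountableTopology.mk _ (generateFrom (weakSubbasis X))
          ⟨weakSubbasis X, countable_weakSubbasis, rfl⟩) p
    refine tendsto_of_forall_basicUnions fun U hU r hr => ?_
    obtain ⟨q, -, hrq, hq⟩ := ENNReal.lt_iff_exists_rat_btwn.1 hr
    have ho : IsOpen[generateFrom (weakSubbasis X)]
        {p : ProbabilityMeasure X | ENNReal.ofReal q < (p : Measure X) U} :=
      isOpen_generateFrom_of_mem ⟨(U, q), ⟨hU, mem_univ _⟩, rfl⟩
    filter_upwards [@IsOpen.mem_nhds _ (generateFrom (weakSubbasis X)) _ _ ho hq] with p' hp'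
    exact hrq.trans hp'

instance secondCountableTopology_probabilityMeasure [OpensMeasurableSpace X] :
    SecondCountableTopology (ProbabilityMeasure X) :=
  ⟨⟨weakSubbasis X, countable_weakSubbasis, weakTopology_eq_generateFrom⟩⟩

theorem measurable_probabilityMeasure_coe {X : Type*} [MeasurableSpace X] :
    Measurable fun p : ProbabilityMeasure X => (p : Measure X) :=
  measurable_subtype_coe

instance borelSpace_probabilityMeasure [BorelSpace X] : BorelSpace (ProbabilityMeasure X) := by
  constructor
  apply le_antisymm
  · let : MeasurableSpace (ProbabilityMeasure X) := borel _
    have : BorelSpace (ProbabilityMeasure X) := ⟨rfl⟩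
    have hm : Measurable fun p : ProbabilityMeasure X => (p : Measure X) := by
      refine Measurable.measure_of_isPiSystem_of_isProbabilityMeasure
        (BorelSpace.measurable_eq (α := X)) isPiSystem_isOpen fun s hs => ?_
      exact (lowerSemicontinuous_measure_of_isOpen hs).measurable
    exact measurable_iff_comap_le.1 hm
  · rw [borel_eq_generateFrom_of_subbasis weakTopology_eq_generateFrom]
    refine MeasurableSpace.generateFrom_le ?_
    rintro _ ⟨⟨U, q⟩, ⟨hU, -⟩, rfl⟩
    exact measurableSet_lt measurable_const
      ((Measure.measurable_coe (isOpen_of_mem_basicUnions hU).measurableSet).comp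
        measurable_probabilityMeasure_coe)

end SpaceOfMeasures

/-- A Borel embedding of `X` into the compact space `EReal` induces an injection of measures into
the Polish space of probability measures on `EReal`. Its range, the measures not charging the
complement of the image of `X`, is Borel. Making this range clopen in a finer Polish topology and
pulling back gives a Polish topology with the right Borel sets. -/
instance standardBorelSpace_probabilityMeasure {X : Type*} [MeasurableSpace X]
    [StandardBorelSpace X] : StandardBorelSpace (ProbabilityMeasure X) := by
  obtain ⟨f, hf⟩ : ∃ f : X → EReal, MeasurableEmbedding f :=
    ⟨_, EReal.measurableEmbedding_coe.comp (measurableEmbedding_embeddingReal X)⟩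
  let F : ProbabilityMeasure X → ProbabilityMeasure EReal :=
    fun p => p.map hf.measurable.aemeasurable
  have hFcoe (p : ProbabilityMeasure X) : (F p : Measure EReal) = (p : Measure X).map f := rfl
  have hFinj : Function.Injective F := by
    intro p q hpq
    have h : (p : Measure X).map f = (q : Measure X).map f := by rw [← hFcoe, ← hFcoe, hpq]
    apply ProbabilityMeasure.toMeasure_injective
    rw [← hf.comap_map (p : Measure X), ← hf.comap_map (q : Measure X), h]
  have hrange : range F = {q : ProbabilityMeasure EReal | (q : Measure EReal) (range f)ᶜ = 0} := by
    ext q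
    constructor
    · rintro ⟨p, rfl⟩
      change (F p : Measure EReal) (range f)ᶜ = 0
      rw [hFcoe, hf.map_apply]
      simp
    · intro hq
      have hq' : (((q : Measure EReal).comap f).map f) = q := by
        rw [hf.map_comap, Measure.restrict_eq_self_of_ae_mem]
        exact hq
      have : IsProbabilityMeasure ((q : Measure EReal).comap f) := by
        constructor
        rw [← preimage_univ (f := f), ← hf.map_apply, hq', measure_univ]
      exact ⟨⟨_, this⟩, Subtype.ext hq'⟩
  have hs : MeasurableSet (range F) := by
    rw [hrange]
    exact ((Measure.measurable_coe hf.measurableSet_range.compl).comp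
      measurable_probabilityMeasure_coe) (measurableSet_singleton 0)
  have hcomap : MeasurableSpace.comap F inferInstance =
      (inferInstance : MeasurableSpace (ProbabilityMeasure X)) := by
    apply le_antisymm
    · exact Measurable.comap_le
        ((Measure.measurable_map f hf.measurable).comp measurable_probabilityMeasure_coe).subtype_mk
    · have : @Measurable _ _ (MeasurableSpace.comap F inferInstance) _
          fun p : ProbabilityMeasure X => (p : Measure X) := by
        refine @Measure.measurable_of_measurable_coe _ _ _ (MeasurableSpace.comap F inferInstance)
          _ fun s hs => ?_
        have h : (fun p : ProbabilityMeasure X => (p : Measure X) s) =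
            (fun q : ProbabilityMeasure EReal => (q : Measure EReal) (f '' s)) ∘ F := by
          ext p
          simp only [Function.comp_apply, hFcoe]
          rw [hf.map_apply, preimage_image_eq _ hf.injective]
        rw [h]
        exact ((Measure.measurable_coe (hf.measurableSet_image.2 hs)).comp
          measurable_probabilityMeasure_coe).comp (comap_measurable F)
      exact measurable_iff_comap_le.1 this
  have : PolishSpace (ProbabilityMeasure EReal) := by
    have : MetrizableSpace (ProbabilityMeasure EReal) := inferInstance
    let := metrizableSpaceMetric (ProbabilityMeasure EReal)
    infer_instance
  obtain ⟨t, hB, hP, hcl, -⟩ := hs.isClopenable'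
  let t' : TopologicalSpace (ProbabilityMeasure X) := t.induced F
  have hemb : IsClosedEmbedding F := ⟨⟨⟨rfl⟩, hFinj⟩, hcl⟩
  have : PolishSpace (ProbabilityMeasure X) := hemb.polishSpace
  have : BorelSpace (ProbabilityMeasure X) := by
    constructor
    refine hcomap.symm.trans ?_
    rw [borel_comap]
    congr 1
    exact hB.measurable_eq
  infer_instance

theorem lowerSemicontinuous_of_seq {α : Type*} [TopologicalSpace α] [SequentialSpace α]
    {f : α → ℝ≥0∞} (h : ∀ (u : ℕ → α) (x : α) (r : ℝ≥0∞), Tendsto u atTop (𝓝 x) →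
      (∀ n, f (u n) ≤ r) → f x ≤ r) : LowerSemicontinuous f := by
  rw [lowerSemicontinuous_iff_isClosed_preimage]
  intro r
  refine IsSeqClosed.isClosed fun u x hu hx => ?_
  exact h u x r hx hu

theorem lowerSemicontinuous_le_of_tendsto {α : Type*} [TopologicalSpace α] {f : α → ℝ≥0∞}
    (hf : LowerSemicontinuous f) {u : ℕ → α} {x : α} {r : ℝ≥0∞} (hu : Tendsto u atTop (𝓝 x))
    (h : ∀ n, f (u n) ≤ r) : f x ≤ r :=
  (hf.isClosed_preimage r).mem_of_tendsto hu (Eventually.of_forall h)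

/-! ### Lower semicontinuity of integrals under weak convergence. -/

section Integral

variable {X : Type*} [MeasurableSpace X] [TopologicalSpace X] [PseudoMetrizableSpace X]
  [SecondCountableTopology X]

/-- The superlevel sets of `f` are open, so the layer-cake formula, the portmanteau theorem and
Fatou's lemma give the claim for the truncations of `f`; a supremum of lower semicontinuous
functions is lower semicontinuous. -/
theorem lowerSemicontinuous_lintegral [OpensMeasurableSpace X] {f : X → ℝ≥0∞}
    (hf : LowerSemicontinuous f) :
    LowerSemicontinuous fun p : ProbabilityMeasure X => ∫⁻ x, f x ∂(p : Measure X) := by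
  have htrunc (n : ℕ) : LowerSemicontinuous
      fun p : ProbabilityMeasure X => ∫⁻ x, min (f x) n ∂(p : Measure X) := by
    refine lowerSemicontinuous_of_seq fun u p r hu hr => ?_
    let g : X → ℝ := fun x => (min (f x) n).toReal
    have hfin (x : X) : min (f x) n ≠ ∞ := (min_lt_of_right_lt (ENNReal.natCast_lt_top n)).ne
    have hg (x : X) : min (f x) n = ENNReal.ofReal (g x) := (ENNReal.ofReal_toReal (hfin x)).symm
    have hgm : Measurable g := (hf.measurable.min measurable_const).ennreal_toReal
    have hg0 : 0 ≤ g := fun x => ENNReal.toReal_nonneg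
    have hopen (t : ℝ) (ht : t ∈ Ioi 0) : IsOpen {x | t < g x} := by
      have : {x | t < g x} = {x | ENNReal.ofReal t < f x} ∩ {_x | ENNReal.ofReal t < n} := by
        ext x
        simp only [mem_ofPred_eq, mem_inter_iff, g]
        rw [← ENNReal.ofReal_lt_iff_lt_toReal (le_of_lt ht) (hfin x), lt_min_iff]
      rw [this]
      exact (hf.isOpen_preimage _).inter isOpen_const
    have hlay (q : ProbabilityMeasure X) : ∫⁻ x, min (f x) n ∂(q : Measure X) =
        ∫⁻ t in Ioi (0 : ℝ), (q : Measure X) {x | t < g x} := by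
      simp_rw [hg]
      exact lintegral_eq_lintegral_meas_lt _ (Eventually.of_forall hg0) hgm.aemeasurable
    simp_rw [hlay] at hr ⊢
    calc ∫⁻ t in Ioi (0 : ℝ), (p : Measure X) {x | t < g x}
        ≤ ∫⁻ t in Ioi (0 : ℝ), atTop.liminf fun k => (u k : Measure X) {x | t < g x} :=
          setLIntegral_mono' measurableSet_Ioi fun t ht =>
            ProbabilityMeasure.le_liminf_measure_open_of_tendsto hu (hopen t ht)
      _ ≤ atTop.liminf fun k => ∫⁻ t in Ioi (0 : ℝ), (u k : Measure X) {x | t < g x} :=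
          lintegral_liminf_le fun k => Antitone.measurable fun s t hst =>
            measure_mono fun ω hω => lt_of_le_of_lt hst hω
      _ ≤ r := liminf_le_of_le (by isBoundedDefault) fun b hb => by
          obtain ⟨k, hk⟩ := hb.exists
          exact hk.trans (hr k)
  have hsup (p : ProbabilityMeasure X) : ∫⁻ x, f x ∂(p : Measure X) =
      ⨆ n : ℕ, ∫⁻ x, min (f x) n ∂(p : Measure X) := by
    rw [← lintegral_iSup (fun n => hf.measurable.min measurable_const)]
    · refine lintegral_congr fun x => ?_
      rw [← inf_iSup_eq, ENNReal.iSup_natCast, inf_top_eq]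
    · intro m n hmn x
      exact min_le_min le_rfl (by exact_mod_cast hmn)
  simp_rw [hsup]
  exact lowerSemicontinuous_iSup htrunc

end Integral

/-! ### Jensen's inequality on the space of probability measures. -/

section Jensen

theorem ae_tendsto_sample_mean {S : Type*} [MeasurableSpace S] (Γ : Measure S)
    [IsProbabilityMeasure Γ] {g : S → ℝ} (hg : Measurable g) (hint : Integrable g Γ) :
    ∀ᵐ ω ∂(Measure.infinitePi fun _ : ℕ => Γ),
      Tendsto (fun n : ℕ => (∑ i ∈ Finset.range n, g (ω i)) / n) atTop (𝓝 (∫ s, g s ∂Γ)) := by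
  have hmp (i : ℕ) : MeasurePreserving (fun ω : ℕ → S => ω i)
      (Measure.infinitePi fun _ : ℕ => Γ) Γ := measurePreserving_eval_infinitePi _ i
  have hi0 : Integrable (fun ω : ℕ → S => g (ω 0)) (Measure.infinitePi fun _ : ℕ => Γ) :=
    (hmp 0).integrable_comp_of_integrable hint
  have hind : iIndepFun (fun i (ω : ℕ → S) => g (ω i)) (Measure.infinitePi fun _ : ℕ => Γ) :=
    iIndepFun_infinitePi (X := fun _ => g) fun _ => hg
  have hid (i : ℕ) : IdentDistrib (fun ω : ℕ → S => g (ω i)) (fun ω : ℕ → S => g (ω 0))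
      (Measure.infinitePi fun _ : ℕ => Γ) (Measure.infinitePi fun _ : ℕ => Γ) := by
    refine IdentDistrib.comp (f := fun ω : ℕ → S => ω i) (g := fun ω : ℕ → S => ω 0)
      ⟨(hmp i).measurable.aemeasurable, (hmp 0).measurable.aemeasurable, ?_⟩ hg
    rw [(hmp i).map_eq, (hmp 0).map_eq]
  have h := strong_law_ae_real (fun i (ω : ℕ → S) => g (ω i)) hi0
    (fun i j hij => hind.indepFun hij) hid
  have hexp : ∫ ω, g (ω 0) ∂(Measure.infinitePi fun _ : ℕ => Γ) = ∫ s, g s ∂Γ := by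
    have := integral_map (μ := Measure.infinitePi fun _ : ℕ => Γ) (hmp 0).measurable.aemeasurable (f := g)
      hg.aestronglyMeasurable
    rw [(hmp 0).map_eq] at this
    exact this.symm
  rwa [hexp] at h

/-- The strong law in extended nonnegative form: the integrand is almost everywhere finite, so
almost no sample ever meets the value `∞`. -/
theorem ae_tendsto_sample_lmean {S : Type*} [MeasurableSpace S] (Γ : Measure S)
    [IsProbabilityMeasure Γ] {g : S → ℝ≥0∞} (hg : Measurable g) (hint : ∫⁻ s, g s ∂Γ ≠ ∞) :
    ∀ᵐ ω ∂(Measure.infinitePi fun _ : ℕ => Γ),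
      Tendsto (fun n : ℕ => (n : ℝ≥0∞)⁻¹ * ∑ i ∈ Finset.range n, g (ω i)) atTop
        (𝓝 (∫⁻ s, g s ∂Γ)) := by
  have hfin : ∀ᵐ ω ∂(Measure.infinitePi fun _ : ℕ => Γ), ∀ i : ℕ, g (ω i) < ∞ := by
    rw [ae_all_iff]
    intro i
    exact (measurePreserving_eval_infinitePi (fun _ : ℕ => Γ) i).quasiMeasurePreserving.ae
      (ae_lt_top hg hint)
  filter_upwards [hfin, ae_tendsto_sample_mean Γ hg.ennreal_toReal
    (integrable_toReal_of_lintegral_ne_top hg.aemeasurable hint)] with ω h1 h2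
  rw [integral_toReal hg.aemeasurable (ae_lt_top hg hint)] at h2
  have h3 := ENNReal.tendsto_ofReal h2
  rw [ENNReal.ofReal_toReal hint] at h3
  refine h3.congr' ?_
  filter_upwards [eventually_ne_atTop 0] with n hn
  have hn' : (0 : ℝ) < n := by exact_mod_cast Nat.pos_of_ne_zero hn
  rw [ENNReal.ofReal_div_of_pos hn', ENNReal.ofReal_natCast,
    ENNReal.ofReal_sum_of_nonneg fun i _ => ENNReal.toReal_nonneg, div_eq_mul_inv, mul_comm]
  congr 1
  exact Finset.sum_congr rfl fun i _ => ENNReal.ofReal_toReal (h1 i).ne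

variable {X : Type*} [MeasurableSpace X]

/-- The empirical mean of finitely many probability measures. -/
noncomputable def empiricalMean (ω : ℕ → ProbabilityMeasure X) (n : ℕ) : Measure X :=
  (n : ℝ≥0)⁻¹ • ∑ i ∈ Finset.range n, (ω i : Measure X)

theorem empiricalMean_succ (ω : ℕ → ProbabilityMeasure X) {n : ℕ} (hn : n ≠ 0) :
    empiricalMean ω (n + 1) =
      ((n : ℝ≥0) / (n + 1)) • empiricalMean ω n + ((n + 1 : ℝ≥0)⁻¹) • (ω n : Measure X) := by
  have : (n : ℝ≥0) ≠ 0 := by exact_mod_cast hn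
  rw [empiricalMean, empiricalMean, Finset.sum_range_succ, smul_add, smul_smul]
  congr 2
  · push_cast
    field_simp
  · push_cast
    rfl

theorem isProbabilityMeasure_empiricalMean (ω : ℕ → ProbabilityMeasure X) {n : ℕ} (hn : n ≠ 0) :
    IsProbabilityMeasure (empiricalMean ω n) := by
  constructor
  have : (n : ℝ≥0) ≠ 0 := by exact_mod_cast hn
  simp only [empiricalMean, Measure.smul_apply, Measure.finsetSum_apply, measure_univ,
    Finset.sum_const, Finset.card_range, nsmul_eq_mul, mul_one]
  rw [ENNReal.smul_def, smul_eq_mul, ENNReal.coe_inv this, ENNReal.coe_natCast]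
  exact ENNReal.inv_mul_cancel (by exact_mod_cast hn) (by simp)

/-- Finite Jensen with uniform weights, by adding one sample at a time to the mean. -/
theorem convexOn_empiricalMean_le {C : Measure X → ℝ≥0∞}
    (hC : ConvexOn ℝ≥0 {p : Measure X | IsProbabilityMeasure p} C)
    (ω : ℕ → ProbabilityMeasure X) {n : ℕ} (hn : n ≠ 0) :
    C (empiricalMean ω n) ≤ (n : ℝ≥0∞)⁻¹ * ∑ i ∈ Finset.range n, C (ω i) := by
  induction n with
  | zero => exact absurd rfl hn
  | succ n ih =>
    rcases eq_or_ne n 0 with rfl | h0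
    · simp [empiricalMean]
    · have hab : (n : ℝ≥0) / (n + 1) + (n + 1 : ℝ≥0)⁻¹ = 1 := by field_simp
      rw [empiricalMean_succ ω h0]
      refine (hC.2 (isProbabilityMeasure_empiricalMean ω h0) (inferInstanceAs
        (IsProbabilityMeasure (ω n : Measure X))) (zero_le) (zero_le) hab).trans ?_
      rw [Finset.sum_range_succ, mul_add]
      refine add_le_add ?_ (le_of_eq ?_)
      · refine (smul_le_smul_of_nonneg_left (ih h0) (zero_le)).trans (le_of_eq ?_)
        rw [ENNReal.smul_def, smul_eq_mul, ← mul_assoc]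
        congr 1
        rw [ENNReal.coe_div (by positivity)]
        push_cast
        rw [div_eq_mul_inv, mul_comm, ← mul_assoc, ENNReal.inv_mul_cancel
          (by exact_mod_cast h0) (by simp), one_mul]
      · rw [ENNReal.smul_def, smul_eq_mul, ENNReal.coe_inv (by positivity)]
        push_cast
        rfl

variable [TopologicalSpace X] [PseudoMetrizableSpace X] [SecondCountableTopology X]
  [BorelSpace X]

/-- Jensen's inequality for a convex lower semicontinuous function on the space of probability
measures: its value at a barycenter is at most its mean. -/
theorem convexOn_barycenter_le_lintegral {C : Measure X → ℝ≥0∞}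
    (hC : ConvexOn ℝ≥0 {p : Measure X | IsProbabilityMeasure p} C)
    (hlsc : LowerSemicontinuous fun p : ProbabilityMeasure X => C p)
    (Γ : Measure (ProbabilityMeasure X)) [IsProbabilityMeasure Γ] :
    C (Γ.bind fun p : ProbabilityMeasure X => (p : Measure X)) ≤ ∫⁻ p, C p ∂Γ := by
  by_cases htop : ∫⁻ p, C p ∂Γ = ∞
  · simp [htop]
  have hCm : Measurable fun p : ProbabilityMeasure X => C p := hlsc.measurable
  have hUm {U : Set X} (hU : MeasurableSet U) :
      Measurable fun p : ProbabilityMeasure X => (p : Measure X) U :=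
    (Measure.measurable_coe hU).comp measurable_probabilityMeasure_coe
  have hbary : IsProbabilityMeasure (Γ.bind fun p : ProbabilityMeasure X => (p : Measure X)) := by
    constructor
    rw [Measure.bind_apply MeasurableSet.univ measurable_probabilityMeasure_coe.aemeasurable]
    simp
  have h1 := ae_tendsto_sample_lmean Γ hCm htop
  -- Countably many open sets detect weak convergence, so for almost every i.i.d. sample from `Γ`
  -- the empirical means converge weakly to the barycenter, while the means of `C` converge to the
  -- integral of `C`.
  have h2 : ∀ᵐ ω ∂(Measure.infinitePi fun _ : ℕ => Γ), ∀ U ∈ basicUnions X,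
      Tendsto (fun n : ℕ => (n : ℝ≥0∞)⁻¹ * ∑ i ∈ Finset.range n, (ω i : Measure X) U) atTop
        (𝓝 (∫⁻ p : ProbabilityMeasure X, (p : Measure X) U ∂Γ)) := by
    rw [ae_ball_iff countable_basicUnions]
    intro U hU
    refine ae_tendsto_sample_lmean Γ (hUm (isOpen_of_mem_basicUnions hU).measurableSet)
      ((lintegral_mono (g := fun _ => 1) fun p => prob_le_one).trans_lt ?_).ne
    simp
  obtain ⟨ω, hω1, hω2⟩ := (h1.and h2).exists
  -- The shift by one avoids the mean of zero samples, which is not a probability measure.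
  let A : ℕ → ProbabilityMeasure X := fun n =>
    ⟨empiricalMean ω (n + 1), isProbabilityMeasure_empiricalMean ω n.succ_ne_zero⟩
  have hA : Tendsto A atTop (𝓝 ⟨_, hbary⟩) := by
    refine tendsto_of_forall_basicUnions fun U hU r hr => ?_
    have hUo := (isOpen_of_mem_basicUnions hU).measurableSet
    have hlim := (hω2 U hU).comp (tendsto_add_atTop_nat 1)
    rw [ProbabilityMeasure.coe_mk, Measure.bind_apply hUo
      measurable_probabilityMeasure_coe.aemeasurable] at hr
    filter_upwards [hlim.eventually (lt_mem_nhds hr)] with n hn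
    refine hn.trans_le (le_of_eq ?_)
    simp only [A, ProbabilityMeasure.coe_mk, empiricalMean, Measure.smul_apply,
      Measure.finsetSum_apply, Function.comp_apply]
    rw [ENNReal.smul_def, smul_eq_mul, ENNReal.coe_inv (by positivity), ENNReal.coe_natCast]
  refine le_of_forall_gt_imp_ge_of_dense fun r hr => ?_
  have hev : ∀ᶠ n in atTop, A n ∈ {p : ProbabilityMeasure X | C p ≤ r} := by
    filter_upwards [(hω1.comp (tendsto_add_atTop_nat 1)).eventually (gt_mem_nhds hr)] with n hn
    exact (convexOn_empiricalMean_le hC ω n.succ_ne_zero).trans hn.le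
  exact (hlsc.isClosed_preimage r).mem_of_tendsto hA hev

end Jensen

/-! ### Kernels acting on probability measures. -/

section KernelsAndMeasures

variable {X Z W : Type*} [MeasurableSpace X] [MeasurableSpace Z] [MeasurableSpace W]

/-- A Markov kernel as a map into the space of probability measures. -/
def kernelProb (κ : Kernel Z W) [IsMarkovKernel κ] (z : Z) : ProbabilityMeasure W :=
  ⟨κ z, inferInstance⟩

@[simp]
theorem coe_kernelProb (κ : Kernel Z W) [IsMarkovKernel κ] (z : Z) :
    (kernelProb κ z : Measure W) = κ z := rfl

theorem measurable_kernelProb (κ : Kernel Z W) [IsMarkovKernel κ] : Measurable (kernelProb κ) :=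
  κ.measurable.subtype_mk

/-- The tautological kernel on the space of probability measures. -/
noncomputable def probKernel (X : Type*) [MeasurableSpace X] : Kernel (ProbabilityMeasure X) X :=
  ⟨fun p => (p : Measure X), measurable_probabilityMeasure_coe⟩

instance : IsMarkovKernel (probKernel X) :=
  ⟨fun p => inferInstanceAs (IsProbabilityMeasure (p : Measure X))⟩

/-- The action of a Markov kernel on probability measures. -/
noncomputable def bindProb (κ : Kernel Z W) [IsMarkovKernel κ] (m : ProbabilityMeasure Z) :
    ProbabilityMeasure W :=
  ⟨(m : Measure Z).bind κ, inferInstance⟩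

@[simp]
theorem coe_bindProb (κ : Kernel Z W) [IsMarkovKernel κ] (m : ProbabilityMeasure Z) :
    (bindProb κ m : Measure W) = (m : Measure Z).bind κ := rfl

/-- The Feller property: `κ` turns a bounded continuous `f` into the bounded continuous function `z
↦ ∫ f dκ(z)`, which may then be tested against `m`. -/
theorem continuous_bindProb [TopologicalSpace Z] [OpensMeasurableSpace Z] [TopologicalSpace W]
    [OpensMeasurableSpace W] (κ : Kernel Z W) [IsMarkovKernel κ] (hκ : Continuous (kernelProb κ)) :
    Continuous (bindProb κ) := by
  rw [ProbabilityMeasure.continuous_iff_forall_continuous_lintegral] at hκ ⊢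
  intro f
  have hfm : Measurable fun w => (f w : ℝ≥0∞) := by fun_prop
  have hle (z : Z) : ∫⁻ w, f w ∂κ z ≤ nndist f 0 := by
    refine (lintegral_mono (g := fun _ => ((nndist f 0 : ℝ≥0) : ℝ≥0∞)) fun w => ?_).trans (by simp)
    exact ENNReal.coe_le_coe.2 (BoundedContinuousFunction.NNReal.upper_bound f w)
  have hne (z : Z) : ∫⁻ w, f w ∂κ z ≠ ∞ := ((hle z).trans_lt ENNReal.coe_lt_top).ne
  let g : Z → ℝ≥0 := fun z => (∫⁻ w, f w ∂κ z).toNNReal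
  have hg : Continuous g := by
    refine continuous_iff_continuousAt.2 fun z => ?_
    exact (ENNReal.tendsto_toNNReal (hne z)).comp (hκ f).continuousAt
  let G : BoundedContinuousFunction Z ℝ≥0 := BoundedContinuousFunction.mkOfBound ⟨g, hg⟩
    (nndist f 0 + nndist f 0) fun z z' => by
      have h (z : Z) : (g z : ℝ) ≤ nndist f 0 := by
        have := ENNReal.toNNReal_mono ENNReal.coe_ne_top (hle z)
        exact_mod_cast this
      have h0 (z : Z) : (0 : ℝ) ≤ g z := (g z).2
      change dist (g z) (g z') ≤ _
      rw [NNReal.dist_eq]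
      exact abs_sub_le_iff.2 ⟨by linarith [h z, h0 z', h z', h0 z],
        by linarith [h z, h0 z', h z', h0 z]⟩
  have hG (m : ProbabilityMeasure Z) :
      ∫⁻ w, f w ∂(bindProb κ m : Measure W) = ∫⁻ z, G z ∂(m : Measure Z) := by
    rw [coe_bindProb, Measure.lintegral_bind κ.measurable.aemeasurable hfm.aemeasurable]
    exact lintegral_congr fun z => (ENNReal.coe_toNNReal (hne z)).symm
  simp_rw [hG]
  exact ProbabilityMeasure.continuous_lintegral_boundedContinuousFunction G

/-- The kernel `(y, p) ↦ δ_y ⊗ p`. -/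
noncomputable def diracProdKernel (Y X : Type*) [MeasurableSpace Y] [MeasurableSpace X] :
    Kernel (Y × ProbabilityMeasure X) (Y × X) :=
  (Kernel.deterministic Prod.fst measurable_fst) ×ₖ ((probKernel X).comap Prod.snd measurable_snd)

instance {Y : Type*} [MeasurableSpace Y] : IsMarkovKernel (diracProdKernel Y X) := by
  unfold diracProdKernel; infer_instance

theorem diracProdKernel_apply {Y : Type*} [MeasurableSpace Y] (z : Y × ProbabilityMeasure X) :
    diracProdKernel Y X z = (Measure.dirac z.1).prod (z.2 : Measure X) := by
  rw [diracProdKernel, Kernel.prod_apply, Kernel.deterministic_apply, Kernel.comap_apply]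
  rfl

theorem lintegral_diracProdKernel {Y : Type*} [MeasurableSpace Y] (z : Y × ProbabilityMeasure X)
    {f : Y × X → ℝ≥0∞} (hf : Measurable f) :
    ∫⁻ w, f w ∂diracProdKernel Y X z = ∫⁻ x, f (z.1, x) ∂(z.2 : Measure X) := by
  rw [diracProdKernel_apply, Measure.dirac_prod, lintegral_map hf measurable_prodMk_left]

theorem continuous_kernelProb_diracProdKernel {Y : Type*} [MeasurableSpace Y] [TopologicalSpace Y]
    [PseudoMetrizableSpace Y] [SecondCountableTopology Y] [OpensMeasurableSpace Y]
    [TopologicalSpace X] [PseudoMetrizableSpace X] [SecondCountableTopology X]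
    [OpensMeasurableSpace X] : Continuous (kernelProb (diracProdKernel Y X)) := by
  have h : kernelProb (diracProdKernel Y X) =
      fun z : Y × ProbabilityMeasure X => (diracProba z.1).prod z.2 := by
    ext1 z
    apply ProbabilityMeasure.toMeasure_injective
    rw [coe_kernelProb, diracProdKernel_apply]
    rfl
  rw [h]
  exact ProbabilityMeasure.continuous_prod.comp
    ((continuous_diracProba.comp continuous_fst).prodMk continuous_snd)

theorem lowerSemicontinuous_lintegral_prod {Y : Type*} [MeasurableSpace Y] [TopologicalSpace Y]
    [PseudoMetrizableSpace Y] [SecondCountableTopology Y] [OpensMeasurableSpace Y]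
    [TopologicalSpace X] [PseudoMetrizableSpace X] [SecondCountableTopology X]
    [OpensMeasurableSpace X] {f : Y × X → ℝ≥0∞} (hf : LowerSemicontinuous f) :
    LowerSemicontinuous
      fun z : Y × ProbabilityMeasure X => ∫⁻ x, f (z.1, x) ∂(z.2 : Measure X) := by
  have h := (lowerSemicontinuous_lintegral hf).comp
    (continuous_kernelProb_diracProdKernel (X := X) (Y := Y))
  refine Eq.mp (congrArg _ (funext fun z => ?_)) h
  exact lintegral_diracProdKernel z hf.measurable

end KernelsAndMeasures

/-! ### Semicontinuity of the nonlinear cost of a disintegration. -/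

section DisintegratedCost

variable {X Y : Type*} [MeasurableSpace X] [MeasurableSpace Y]

/-- The integral of `C(y, γ^y)` for a measure `γ(dy, dx)`. -/
noncomputable def disintegratedCost [StandardBorelSpace X] [Nonempty X]
    (C : Y → Measure X → ℝ≥0∞) (γ : ProbabilityMeasure (Y × X)) : ℝ≥0∞ :=
  ∫⁻ y, C y ((γ : Measure (Y × X)).condKernel y) ∂(γ : Measure (Y × X)).fst

/-- The law of `(y, γ^y)` for a measure `γ(dy, dx)`. -/
noncomputable def conditionalLaw [StandardBorelSpace X] [Nonempty X]
    (γ : ProbabilityMeasure (Y × X)) : ProbabilityMeasure (Y × ProbabilityMeasure X) :=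
  ⟨(γ : Measure (Y × X)).fst.map
    fun y => (y, kernelProb (γ : Measure (Y × X)).condKernel y),
    Measure.isProbabilityMeasure_map
      (measurable_id.prodMk (measurable_kernelProb _)).aemeasurable⟩

theorem lintegral_conditionalLaw [StandardBorelSpace X] [Nonempty X] (γ : ProbabilityMeasure (Y × X))
    {f : Y × ProbabilityMeasure X → ℝ≥0∞} (hf : Measurable f) :
    ∫⁻ z, f z ∂(conditionalLaw γ : Measure (Y × ProbabilityMeasure X)) =
      ∫⁻ y, f (y, kernelProb (γ : Measure (Y × X)).condKernel y) ∂(γ : Measure (Y × X)).fst :=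
  lintegral_map hf (measurable_id.prodMk (measurable_kernelProb _))

/-- The conditional law is a section of the continuous mixing map. On this lift the nonlinear cost
`∫ C(y, γ^y)` becomes the integral of a fixed function, and a limit can be mixed back to a measure
on `Y × X`. -/
theorem bindProb_conditionalLaw [StandardBorelSpace X] [Nonempty X] (γ : ProbabilityMeasure (Y × X)) :
    bindProb (diracProdKernel Y X) (conditionalLaw γ) = γ := by
  apply ProbabilityMeasure.toMeasure_injective
  refine Measure.ext_of_lintegral _ fun f hf => ?_
  rw [coe_bindProb, Measure.lintegral_bind (Kernel.measurable _).aemeasurable hf.aemeasurable,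
    lintegral_conditionalLaw γ hf.lintegral_kernel, ← Measure.lintegral_condKernel hf]
  refine lintegral_congr fun y => ?_
  rw [lintegral_diracProdKernel _ hf]
  rfl

variable [TopologicalSpace X] [PolishSpace X] [BorelSpace X]

theorem isTightMeasureSet_range_of_tendsto {γ : ℕ → ProbabilityMeasure X}
    {γ₀ : ProbabilityMeasure X} (h : Tendsto γ atTop (𝓝 γ₀)) :
    IsTightMeasureSet {((μ : ProbabilityMeasure X) : Measure X) | μ ∈ range γ} := by
  let := upgradeIsCompletelyMetrizable X
  exact isTightMeasureSet_of_isCompact_closure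
    (h.isCompact_insert_range.closure_of_subset (subset_insert _ _))

variable [TopologicalSpace Y] [PolishSpace Y] [BorelSpace Y]

/-- If little mass of `γ` lies outside a compact set, Markov's inequality shows that most of the
conditional measures give it little mass too. Imposing this for a sequence of compact sets with
bounds `u n → 0` singles out a compact set `Q` of measures. -/
theorem isTightMeasureSet_conditionalLaw [Nonempty X] {S : Set (ProbabilityMeasure (Y × X))}
    (hS : IsTightMeasureSet {((μ : ProbabilityMeasure (Y × X)) : Measure (Y × X)) | μ ∈ S}) :
    IsTightMeasureSet {((μ : ProbabilityMeasure (Y × ProbabilityMeasure X)) :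
      Measure (Y × ProbabilityMeasure X)) | μ ∈ conditionalLaw '' S} := by
  rw [isTightMeasureSet_iff_exists_isCompact_measure_compl_le] at hS ⊢
  intro ε hε
  have hε2 : ε / 2 ≠ 0 := (ENNReal.half_pos hε.ne').ne'
  obtain ⟨K, hK, hKS⟩ := hS (ε / 2) hε2.bot_lt
  obtain ⟨δ, hδ, hδε⟩ := ENNReal.exists_pos_sum_of_countable hε2 ℕ
  let u : ℕ → ℝ≥0 := fun n => ((n : ℝ≥0) + 1)⁻¹
  have hu0 (n : ℕ) : u n ≠ 0 := by positivity
  have hu : Tendsto u atTop (𝓝 0) := by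
    have := tendsto_one_div_add_atTop_nhds_zero_nat (𝕜 := ℝ)
    rw [← NNReal.tendsto_coe]
    simpa [u] using this
  -- With mass at most `δ n * u n` outside `L n`, Markov's inequality at level `u n` leaves an
  -- exceptional set of mass at most `δ n`, and these sum to less than `ε / 2`.
  have hL (n : ℕ) := hS (δ n * u n)
    (ENNReal.mul_pos (by exact_mod_cast (hδ n).ne') (by exact_mod_cast hu0 n))
  choose L hLc hLS using hL
  let Q : Set (ProbabilityMeasure X) := {p | ∀ n, p (Prod.snd '' L n)ᶜ ≤ u n}
  have hQ : IsCompact Q := isCompact_setOfPred_probabilityMeasure_mass_eq_compl_isCompact_le hu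
    (fun n => (hLc n).image continuous_snd) (Or.inl inferInstance)
  refine ⟨(Prod.fst '' K) ×ˢ Q, (hK.image continuous_fst).prod hQ, ?_⟩
  rintro _ ⟨_, ⟨γ, hγ, rfl⟩, rfl⟩
  have hmL (n : ℕ) : MeasurableSet (Prod.snd '' L n)ᶜ :=
    ((hLc n).image continuous_snd).measurableSet.compl
  have hmK : MeasurableSet (Prod.fst '' K)ᶜ := (hK.image continuous_fst).measurableSet.compl
  have hmap : (conditionalLaw γ : Measure (Y × ProbabilityMeasure X)) ((Prod.fst '' K) ×ˢ Q)ᶜ =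
      (γ : Measure (Y × X)).fst ((fun y => (y, kernelProb (γ : Measure (Y × X)).condKernel y)) ⁻¹'
        ((Prod.fst '' K) ×ˢ Q)ᶜ) :=
    Measure.map_apply (measurable_id.prodMk (measurable_kernelProb _))
      ((hK.image continuous_fst).prod hQ).measurableSet.compl
  rw [hmap]
  have hsub : ((fun y => (y, kernelProb (γ : Measure (Y × X)).condKernel y)) ⁻¹'
        ((Prod.fst '' K) ×ˢ Q)ᶜ) ⊆ (Prod.fst '' K)ᶜ ∪
      ⋃ n, {y | (u n : ℝ≥0∞) ≤ (γ : Measure (Y × X)).condKernel y (Prod.snd '' L n)ᶜ} := by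
    intro y hy
    by_contra hcon
    simp only [mem_union, not_or, mem_compl_iff, not_not, mem_iUnion, not_exists] at hcon
    refine hy ⟨hcon.1, fun n => ?_⟩
    have h := hcon.2 n
    rw [mem_ofPred_eq, not_le] at h
    rw [← ENNReal.coe_le_coe, ProbabilityMeasure.ennreal_coeFn_eq_coeFn_toMeasure]
    exact h.le
  have h1 : (γ : Measure (Y × X)).fst (Prod.fst '' K)ᶜ ≤ ε / 2 := by
    rw [Measure.fst_apply hmK]
    refine (measure_mono ?_).trans (hKS _ ⟨γ, hγ, rfl⟩)
    exact fun z hz hzK => hz ⟨z, hzK, rfl⟩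
  have h2 (n : ℕ) : (γ : Measure (Y × X)).fst
      {y | (u n : ℝ≥0∞) ≤ (γ : Measure (Y × X)).condKernel y (Prod.snd '' L n)ᶜ} ≤ δ n := by
    have hm := mul_meas_ge_le_lintegral (μ := (γ : Measure (Y × X)).fst)
      (Kernel.measurable_coe (γ : Measure (Y × X)).condKernel (hmL n)) (u n)
    have hle : ∫⁻ y, (γ : Measure (Y × X)).condKernel y (Prod.snd '' L n)ᶜ
        ∂(γ : Measure (Y × X)).fst ≤ u n * δ n := by
      have := Measure.lintegral_condKernel_mem (ρ := (γ : Measure (Y × X)))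
        (s := Prod.snd ⁻¹' (Prod.snd '' L n)ᶜ) (measurable_snd (hmL n))
      refine (le_of_eq this).trans ?_
      rw [mul_comm]
      refine (measure_mono ?_).trans (hLS n _ ⟨γ, hγ, rfl⟩)
      exact fun z hz hzK => hz ⟨z, hzK, rfl⟩
    exact (ENNReal.mul_le_mul_iff_right (by exact_mod_cast hu0 n) (by simp)).1 (hm.trans hle)
  calc _ ≤ _ := measure_mono hsub
    _ ≤ ε / 2 + ∑' n, (δ n : ℝ≥0∞) := (measure_union_le _ _).trans
        (add_le_add h1 ((measure_iUnion_le _).trans (ENNReal.tsum_le_tsum h2)))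
    _ ≤ ε / 2 + ε / 2 := by gcongr
    _ = ε := ENNReal.add_halves ε

/-- If `C` is lower semicontinuous, and convex in the measure, then `γ ↦ ∫ C(y, γ^y)` is lower
semicontinuous for weak convergence. -/
theorem lowerSemicontinuous_disintegratedCost [Nonempty X] {C : Y → Measure X → ℝ≥0∞}
    (hC : LowerSemicontinuous fun z : Y × ProbabilityMeasure X => C z.1 z.2)
    (hconv : ∀ y, ConvexOn ℝ≥0 {p : Measure X | IsProbabilityMeasure p} (C y)) :
    LowerSemicontinuous (disintegratedCost C) := by
  refine lowerSemicontinuous_of_seq fun γ γ₀ r hγ hr => ?_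
  have htight := isTightMeasureSet_conditionalLaw (isTightMeasureSet_range_of_tendsto hγ)
  have hcomp := isCompact_closure_of_isTightMeasureSet htight
  -- The limit `Γ` mixes to `γ₀` but need not be its conditional law: over one `y` it may spread
  -- over several measures. Convexity pays for this below.
  obtain ⟨Γ, -, φ, hφ, hΓ⟩ := hcomp.isSeqCompact (x := fun n => conditionalLaw (γ n))
    fun n => subset_closure ⟨γ n, ⟨n, rfl⟩, rfl⟩
  have hle : ∫⁻ z, C z.1 z.2 ∂(Γ : Measure (Y × ProbabilityMeasure X)) ≤ r := by
    refine lowerSemicontinuous_le_of_tendsto (lowerSemicontinuous_lintegral hC) hΓ fun n => ?_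
    refine (le_of_eq ?_).trans (hr (φ n))
    exact lintegral_conditionalLaw (γ (φ n)) hC.measurable
  have hbind : bindProb (diracProdKernel Y X) Γ = γ₀ := by
    have h1 := ((continuous_bindProb _ (continuous_kernelProb_diracProdKernel
      (X := X) (Y := Y))).tendsto Γ).comp hΓ
    refine tendsto_nhds_unique (h1.congr fun n => ?_) (hγ.comp hφ.tendsto_atTop)
    exact bindProb_conditionalLaw _
  refine le_trans ?_ hle
  have hne : Nonempty (ProbabilityMeasure X) := ⟨diracProba (Classical.arbitrary X)⟩
  let R := (Γ : Measure (Y × ProbabilityMeasure X)).condKernel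
  -- `R y` is the law under `Γ` of the measure given `y`; its barycenter `q y` turns out to be the
  -- disintegration of `γ₀`.
  let q : Kernel Y X := probKernel X ∘ₖ R
  have hint {f : Y × X → ℝ≥0∞} (hf : Measurable f) : ∫⁻ w, f w ∂(γ₀ : Measure (Y × X)) =
      ∫⁻ y, ∫⁻ x, f (y, x) ∂q y ∂(Γ : Measure (Y × ProbabilityMeasure X)).fst := by
    rw [← hbind, coe_bindProb,
      Measure.lintegral_bind (Kernel.measurable _).aemeasurable hf.aemeasurable,
      ← Measure.lintegral_condKernel hf.lintegral_kernel]
    refine lintegral_congr fun y => ?_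
    rw [Kernel.lintegral_comp _ _ _ (by fun_prop)]
    exact lintegral_congr fun p => lintegral_diracProdKernel (y, p) hf
  have hγ₀ : (γ₀ : Measure (Y × X)) = (Γ : Measure (Y × ProbabilityMeasure X)).fst ⊗ₘ q :=
    Measure.ext_of_lintegral _ fun f hf => by rw [hint hf, Measure.lintegral_compProd hf]
  have hfst : (γ₀ : Measure (Y × X)).fst = (Γ : Measure (Y × ProbabilityMeasure X)).fst := by
    rw [hγ₀, Measure.fst_compProd]
  have hcond := eq_condKernel_of_measure_eq_compProd (ρ := (γ₀ : Measure (Y × X))) q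
    (by rw [hfst]; exact hγ₀)
  calc disintegratedCost C γ₀ = ∫⁻ y, C y (q y) ∂(γ₀ : Measure (Y × X)).fst :=
        lintegral_congr_ae (by filter_upwards [hcond] with y hy; rw [hy])
    _ ≤ ∫⁻ y, ∫⁻ p, C y (p : ProbabilityMeasure X) ∂(R y) ∂(Γ : Measure (Y × ProbabilityMeasure X)).fst := by
        rw [hfst]
        refine lintegral_mono fun y => ?_
        have := convexOn_barycenter_le_lintegral (hconv y)
          (hC.comp (continuous_const.prodMk continuous_id : Continuous
            fun p : ProbabilityMeasure X => (y, p))) (R y)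
        rw [Kernel.comp_apply]
        exact this
    _ = _ := Measure.lintegral_condKernel hC.measurable

end DisintegratedCost

/-! ### Measurable selection of minimizers. -/

section Selection

/-- Intersections of closed balls with radii `2⁻ⁿ` around the points of a sequence. -/
def ballCell {W : Type*} [PseudoMetricSpace W] (d : ℕ → W) : List ℕ → Set W
  | [] => univ
  | j :: l => ballCell d l ∩ Metric.closedBall (d j) ((1 / 2) ^ l.length)

theorem isClosed_ballCell {W : Type*} [PseudoMetricSpace W] (d : ℕ → W) (l : List ℕ) :
    IsClosed (ballCell d l) := by
  induction l with
  | nil => exact isClosed_univ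
  | cons j l ih => exact ih.inter Metric.isClosed_closedBall

/-- The successive least indices of balls meeting `A`. -/
noncomputable def cellIndex {W : Type*} [PseudoMetricSpace W] (d : ℕ → W) (A : Set W) : ℕ → List ℕ
  | 0 => []
  | n + 1 => sInf {j | (A ∩ ballCell d (j :: cellIndex d A n)).Nonempty} :: cellIndex d A n

/-- A compact-valued multifunction with measurable hitting sets has a measurable selection. -/
theorem exists_measurable_selection {Z W : Type*} [MeasurableSpace Z] [TopologicalSpace W]
    [MetrizableSpace W] [SecondCountableTopology W] [MeasurableSpace W] [BorelSpace W]
    {A : Z → Set W} (hcomp : ∀ z, IsCompact (A z)) (hne : ∀ z, (A z).Nonempty)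
    (hm : ∀ C, IsClosed C → MeasurableSet {z | (A z ∩ C).Nonempty}) :
    ∃ s : Z → W, Measurable s ∧ ∀ z, s z ∈ A z := by
  let := metrizableSpaceMetric W
  rcases isEmpty_or_nonempty Z with hZ | ⟨⟨z₀⟩⟩
  · exact ⟨fun z => (hZ.false z).elim, measurable_of_empty _, fun z => (hZ.false z).elim⟩
  have : Nonempty W := ⟨(hne z₀).some⟩
  let d := denseSeq W
  let L : ℕ → Z → List ℕ := fun n z => cellIndex d (A z) n
  have hlen (n : ℕ) (z : Z) : (L n z).length = n := by
    induction n with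
    | zero => rfl
    | succ n ih => exact congrArg Nat.succ ih
  have hex (l : List ℕ) (z : Z) (h : (A z ∩ ballCell d l).Nonempty) :
      {j | (A z ∩ ballCell d (j :: l)).Nonempty}.Nonempty := by
    obtain ⟨w, hwA, hwl⟩ := h
    obtain ⟨j, hj⟩ := (denseRange_denseSeq W).exists_dist_lt w
      (ε := (1 / 2) ^ l.length) (by positivity)
    exact ⟨j, w, hwA, hwl, hj.le⟩
  have hmeet (n : ℕ) (z : Z) : (A z ∩ ballCell d (L n z)).Nonempty := by
    induction n with
    | zero => simpa [L, cellIndex, ballCell] using hne z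
    | succ n ih => exact Nat.sInf_mem (hex _ z ih)
  -- The next index is `j` exactly when the `j`-th cell meets `A z` and no earlier one does, so only
  -- hitting sets of closed sets occur.
  have hLm (n : ℕ) (l : List ℕ) : MeasurableSet {z | L n z = l} := by
    induction n generalizing l with
    | zero => exact MeasurableSet.const ([] = l)
    | succ n ih =>
      rcases l with _ | ⟨j, l⟩
      · convert MeasurableSet.empty
        ext z
        simp [L, cellIndex]
      · have : {z | L (n + 1) z = j :: l} = {z | L n z = l} ∩
            ({z | (A z ∩ ballCell d (j :: l)).Nonempty} ∩
              ⋂ i ∈ Iio j, {z | (A z ∩ ballCell d (i :: l)).Nonempty}ᶜ) := by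
          ext z
          simp only [mem_ofPred_eq, mem_inter_iff, mem_iInter, mem_compl_iff, mem_Iio]
          constructor
          · intro h
            obtain ⟨h1, h2⟩ := List.cons.inj h
            have h3 : L n z = l := h2
            subst h3
            refine ⟨rfl, h1 ▸ Nat.sInf_mem (hex _ z (hmeet n z)), fun i hi hmem => ?_⟩
            rw [← h1] at hi
            exact Nat.notMem_of_lt_sInf hi hmem
          · rintro ⟨rfl, h1, h2⟩
            change _ :: L n z = _
            congr 1
            refine le_antisymm (Nat.sInf_le h1) ?_
            by_contra! hlt
            exact h2 _ hlt (Nat.sInf_mem (hex _ z (hmeet n z)))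
        rw [this]
        refine (ih l).inter ((hm _ (isClosed_ballCell d _)).inter ?_)
        exact MeasurableSet.biInter (to_countable _) fun i _ =>
          (hm _ (isClosed_ballCell d _)).compl
  have hinter (z : Z) : (⋂ n, A z ∩ ballCell d (L n z)).Nonempty :=
    IsCompact.nonempty_iInter_of_sequence_nonempty_isCompact_isClosed _
      (fun n => inter_subset_inter_right _ inter_subset_left) (hmeet · z)
      ((hcomp z).inter_right (isClosed_ballCell d _))
      fun n => (hcomp z).isClosed.inter (isClosed_ballCell d _)
  choose s hs using hinter
  simp only [mem_iInter] at hs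
  refine ⟨s, ?_, fun z => (hs z 0).1⟩
  let : MeasurableSpace (List ℕ) := ⊤
  have hL (n : ℕ) : Measurable (L n) := measurable_to_countable' fun l => hLm n l
  -- The selected point is the limit of the centers of the chosen balls. The list at stage `n + 1`
  -- is nonempty, so the default index `0` is never used.
  refine measurable_of_tendsto_metrizable (f := fun n z => d ((L (n + 1) z).headD 0))
    (fun n => (measurable_from_top (f := fun l : List ℕ => d (l.headD 0))).comp (hL (n + 1))) ?_
  refine tendsto_pi_nhds.2 fun z => ?_
  refine tendsto_iff_dist_tendsto_zero.2 (squeeze_zero (fun _ => dist_nonneg) (fun n => ?_)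
    (tendsto_pow_atTop_nhds_zero_of_lt_one (r := (1 / 2 : ℝ)) (by norm_num) (by norm_num)))
  have h := (hs z (n + 1)).2.2
  rw [Metric.mem_closedBall, dist_comm] at h
  have hl : (cellIndex d (A z) n).length = n := hlen n z
  rwa [hl] at h

variable {Z W : Type*} [TopologicalSpace Z] [TopologicalSpace W]

/-- Sequences in the fibers of `D` over a convergent sequence have convergent subsequences. -/
def SeqProper (D : Set (Z × W)) : Prop :=
  ∀ (z : ℕ → Z) (z₀ : Z) (w : ℕ → W), Tendsto z atTop (𝓝 z₀) → (∀ n, (z n, w n) ∈ D) →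
    ∃ (w₀ : W) (φ : ℕ → ℕ), StrictMono φ ∧ Tendsto (w ∘ φ) atTop (𝓝 w₀)

theorem SeqProper.mono {D D' : Set (Z × W)} (h : SeqProper D) (hD : D' ⊆ D) : SeqProper D' :=
  fun z z₀ w hz hw => h z z₀ w hz fun n => hD (hw n)

variable [FirstCountableTopology Z]

/-- Almost-minimizers over a convergent sequence of parameters have a limit point, admissible for
the limit parameter since `D` is closed. -/
theorem lowerSemicontinuous_fiber_iInf {D : Set (Z × W)} (hD : IsClosed D) (hprop : SeqProper D)
    {F : W → ℝ≥0∞} (hF : LowerSemicontinuous F) :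
    LowerSemicontinuous fun z => ⨅ (w : W) (_ : (z, w) ∈ D), F w := by
  refine lowerSemicontinuous_of_seq fun u z r hu hr => ?_
  refine le_of_forall_gt_imp_ge_of_dense fun r' hr' => ?_
  have hex (n : ℕ) : ∃ w, (u n, w) ∈ D ∧ F w ≤ r' := by
    obtain ⟨w, hw⟩ := iInf_lt_iff.1 ((hr n).trans_lt hr')
    obtain ⟨hwD, hw⟩ := iInf_lt_iff.1 hw
    exact ⟨w, hwD, hw.le⟩
  choose w hwD hwr using hex
  obtain ⟨w₀, φ, hφ, hw₀⟩ := hprop u z w hu hwD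
  refine (iInf₂_le w₀ (hD.mem_of_tendsto ((hu.comp hφ.tendsto_atTop).prodMk_nhds hw₀)
    (Eventually.of_forall fun n => hwD (φ n)))).trans ?_
  exact lowerSemicontinuous_le_of_tendsto hF hw₀ fun n => hwr (φ n)

theorem isClosed_fst_image_of_seqProper {D : Set (Z × W)} (hD : IsClosed D)
    (hprop : SeqProper D) : IsClosed {z | ∃ w, (z, w) ∈ D} := by
  refine IsSeqClosed.isClosed fun u z hu hz => ?_
  choose w hw using hu
  obtain ⟨w₀, φ, hφ, hw₀⟩ := hprop u z w hz hw
  exact ⟨w₀, hD.mem_of_tendsto ((hz.comp hφ.tendsto_atTop).prodMk_nhds hw₀)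
    (Eventually.of_forall fun n => hw (φ n))⟩

/-- Measurable selection of minimizers. -/
theorem exists_measurable_argmin {W : Type*} [TopologicalSpace W] [MetrizableSpace W]
    [SecondCountableTopology W] [MeasurableSpace W] [BorelSpace W] [MeasurableSpace Z]
    [OpensMeasurableSpace Z] {D : Set (Z × W)} (hD : IsClosed D) (hprop : SeqProper D)
    (hne : ∀ z, ∃ w, (z, w) ∈ D) {F : W → ℝ≥0∞} (hF : LowerSemicontinuous F) :
    ∃ s : Z → W, Measurable s ∧
      ∀ z, (z, s z) ∈ D ∧ F (s z) = ⨅ (w : W) (_ : (z, w) ∈ D), F w := by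
  let V : Z → ℝ≥0∞ := fun z => ⨅ (w : W) (_ : (z, w) ∈ D), F w
  have hVD (D' : Set (Z × W)) (hD' : IsClosed D') (hsub : D' ⊆ D) :
      Measurable fun z => ⨅ (w : W) (_ : (z, w) ∈ D'), F w :=
    (lowerSemicontinuous_fiber_iInf hD' (hprop.mono hsub) hF).measurable
  have hfib (D' : Set (Z × W)) (hD' : IsClosed D') (hsub : D' ⊆ D) (z : Z) :
      IsCompact {w | (z, w) ∈ D'} := by
    let := metrizableSpaceMetric W
    refine IsSeqCompact.isCompact fun w hw => ?_
    obtain ⟨w₀, φ, hφ, hw₀⟩ := hprop (fun _ => z) z w tendsto_const_nhds fun n => hsub (hw n)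
    exact ⟨w₀, hD'.mem_of_tendsto (tendsto_const_nhds.prodMk_nhds hw₀)
      (Eventually.of_forall fun n => hw (φ n)), φ, hφ, hw₀⟩
  have hmin (D' : Set (Z × W)) (hD' : IsClosed D') (hsub : D' ⊆ D) (z : Z)
      (h : ∃ w, (z, w) ∈ D') : ∃ w, (z, w) ∈ D' ∧ F w = ⨅ (w : W) (_ : (z, w) ∈ D'), F w := by
    obtain ⟨w, hw, hwmin⟩ := LowerSemicontinuousOn.exists_isMinOn (s := {w | (z, w) ∈ D'}) h
      (hfib D' hD' hsub z) (hF.lowerSemicontinuousOn _)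
    exact ⟨w, hw, le_antisymm (le_iInf₂ fun w' hw' => hwmin hw') (iInf₂_le w hw)⟩
  obtain ⟨s, hs, hsA⟩ := exists_measurable_selection
    (A := fun z => {w | (z, w) ∈ D} ∩ {w | F w ≤ V z})
    (fun z => (hfib D hD subset_rfl z).inter_right (hF.isClosed_preimage (V z)))
    (fun z => by
      obtain ⟨w, hw, hwV⟩ := hmin D hD subset_rfl z (hne z)
      exact ⟨w, hw, hwV.le⟩)
    (fun C hC => by
      have hD' : IsClosed (D ∩ (Prod.snd ⁻¹' C)) := hD.inter (hC.preimage continuous_snd)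
      have hsub : D ∩ (Prod.snd ⁻¹' C) ⊆ D := inter_subset_left
      -- Minimizers meet `C` when restricting the fiber to `C` does not raise the infimum.
      -- Nonemptiness of the restricted fiber is a separate condition, needed where `V z = ∞`.
      have heq : {z | ({w | (z, w) ∈ D} ∩ {w | F w ≤ V z} ∩ C).Nonempty} =
          {z | ∃ w, (z, w) ∈ D ∩ (Prod.snd ⁻¹' C)} ∩
            {z | (⨅ (w : W) (_ : (z, w) ∈ D ∩ (Prod.snd ⁻¹' C)), F w) ≤ V z} := by
        ext z
        constructor
        · rintro ⟨w, ⟨hwD, hwV⟩, hwC⟩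
          have hw : (z, w) ∈ D ∩ (Prod.snd ⁻¹' C) := ⟨hwD, hwC⟩
          refine ⟨⟨w, hw⟩, ?_⟩
          exact (iInf₂_le (f := fun w (_ : (z, w) ∈ D ∩ (Prod.snd ⁻¹' C)) => F w) w hw).trans hwV
        · rintro ⟨h1, h2⟩
          obtain ⟨w, hw, hwF⟩ := hmin _ hD' hsub z h1
          exact ⟨w, ⟨hw.1, hwF.le.trans h2⟩, hw.2⟩
      rw [heq]
      exact (isClosed_fst_image_of_seqProper hD' (hprop.mono hsub)).measurableSet.inter
        (measurableSet_le (hVD _ hD' hsub) (hVD D hD subset_rfl)))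
  exact ⟨s, hs, fun z => ⟨(hsA z).1, le_antisymm (hsA z).2 (iInf₂_le _ (hsA z).1)⟩⟩

end Selection

/-! ### The one-step transport problem with continuous kernels. -/

section OneStep

variable {X X' Y Y' : Type*} [MeasurableSpace X] [MeasurableSpace X'] [MeasurableSpace Y]
  [MeasurableSpace Y']

theorem isTightMeasureSet_of_marginals [TopologicalSpace X] [TopologicalSpace Y] [T2Space X]
    [T2Space Y] [OpensMeasurableSpace X] [OpensMeasurableSpace Y] {S : Set (Measure (Y × X))}
    (hfst : IsTightMeasureSet (Measure.fst '' S)) (hsnd : IsTightMeasureSet (Measure.snd '' S)) :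
    IsTightMeasureSet S := by
  rw [isTightMeasureSet_iff_exists_isCompact_measure_compl_le] at *
  intro ε hε
  have hε2 : 0 < ε / 2 := ENNReal.half_pos hε.ne'
  obtain ⟨K, hK, hKS⟩ := hfst _ hε2
  obtain ⟨L, hL, hLS⟩ := hsnd _ hε2
  refine ⟨K ×ˢ L, hK.prod hL, fun γ hγ => ?_⟩
  have hsub : (K ×ˢ L)ᶜ ⊆ Prod.fst ⁻¹' Kᶜ ∪ Prod.snd ⁻¹' Lᶜ := by
    rintro ⟨y, x⟩ h
    by_contra hcon
    simp only [mem_union, mem_preimage, mem_compl_iff, not_or, not_not] at hcon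
    exact h hcon
  calc γ (K ×ˢ L)ᶜ ≤ γ (Prod.fst ⁻¹' Kᶜ) + γ (Prod.snd ⁻¹' Lᶜ) :=
        (measure_mono hsub).trans (measure_union_le _ _)
    _ = γ.fst Kᶜ + γ.snd Lᶜ := by
        rw [Measure.fst_apply hK.measurableSet.compl, Measure.snd_apply hL.measurableSet.compl]
    _ ≤ ε / 2 + ε / 2 := add_le_add (hKS _ ⟨γ, hγ, rfl⟩) (hLS _ ⟨γ, hγ, rfl⟩)
    _ = ε := ENNReal.add_halves ε

/-- The general transport problem between measures on arbitrary spaces. -/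
noncomputable def kernelTransport (η : Measure X') (ρ : Measure Y')
    (C : Y' → Measure X' → ℝ≥0∞) : ℝ≥0∞ :=
  ⨅ (q : Kernel Y' X') (_ : IsMarkovKernel q) (_ : ρ.bind q = η), ∫⁻ y, C y (q y) ∂ρ

/-- Disintegration identifies kernels, up to null sets, with couplings, and it is couplings that
enjoy weak compactness. -/
theorem kernelTransport_eq_iInf_disintegratedCost [StandardBorelSpace X'] [Nonempty X']
    (η : Measure X') (ρ : Measure Y') [IsProbabilityMeasure ρ] (C : Y' → Measure X' → ℝ≥0∞) :
    kernelTransport η ρ C = ⨅ (γ : ProbabilityMeasure (Y' × X'))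
      (_ : (γ : Measure (Y' × X')).fst = ρ ∧ (γ : Measure (Y' × X')).snd = η),
        disintegratedCost C γ := by
  apply le_antisymm
  · refine le_iInf₂ fun γ hγ => ?_
    have hq : IsMarkovKernel (γ : Measure (Y' × X')).condKernel := inferInstance
    refine (iInf₂_le (γ : Measure (Y' × X')).condKernel hq).trans
      ((iInf_le _ ?_).trans (le_of_eq ?_))
    · rw [← hγ.1, ← hγ.2]
      conv_rhs => rw [← Measure.disintegrate (γ : Measure (Y' × X')) (γ : Measure _).condKernel]
      rw [Measure.snd_compProd]
    · rw [disintegratedCost, hγ.1]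
  · refine le_iInf₂ fun q hq => le_iInf fun h => ?_
    let γ : ProbabilityMeasure (Y' × X') := ⟨ρ ⊗ₘ q, inferInstance⟩
    have hfst : (γ : Measure (Y' × X')).fst = ρ := Measure.fst_compProd _ _
    have hsnd : (γ : Measure (Y' × X')).snd = η := (Measure.snd_compProd _ _).trans h
    refine (iInf₂_le γ ⟨hfst, hsnd⟩).trans (le_of_eq ?_)
    rw [disintegratedCost, hfst]
    refine lintegral_congr_ae ?_
    filter_upwards [condKernel_compProd ρ q] with y hy
    exact congrArg (C y) hy

/-- The transport problems with cost `C` between `Φ(y)` and `m κ` are solvable by a kernel which is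
measurable in the data. -/
def HasOptimalKernel (κ : Kernel X X') (Φ : Kernel Y Y') (C : Y' → Measure X' → ℝ≥0∞) : Prop :=
  ∃ Q : Kernel ((Y × ProbabilityMeasure X) × Y') X', IsMarkovKernel Q ∧
    ∀ (y : Y) (m : ProbabilityMeasure X), (Φ y).bind (Q.sectR (y, m)) = (m : Measure X).bind κ ∧
      ∫⁻ y', C y' (Q ((y, m), y')) ∂(Φ y) = kernelTransport ((m : Measure X).bind κ) (Φ y) C

/-- The couplings of `Φ(y)` and `m κ`, over `(y, m)`. -/
def couplingBundle (κ : Kernel X X') (Φ : Kernel Y Y') :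
    Set ((Y × ProbabilityMeasure X) × ProbabilityMeasure (Y' × X')) :=
  {z | (z.2 : Measure (Y' × X')).fst = Φ z.1.1 ∧
    (z.2 : Measure (Y' × X')).snd = (z.1.2 : Measure X).bind κ}

theorem mem_couplingBundle_iff (κ : Kernel X X') (Φ : Kernel Y Y') [IsMarkovKernel κ]
    [IsMarkovKernel Φ] (z : (Y × ProbabilityMeasure X) × ProbabilityMeasure (Y' × X')) :
    z ∈ couplingBundle κ Φ ↔ z.2.map measurable_fst.aemeasurable = kernelProb Φ z.1.1 ∧
      z.2.map measurable_snd.aemeasurable = bindProb κ z.1.2 := by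
  simp only [← ProbabilityMeasure.toMeasure_injective.eq_iff]
  rfl

theorem kernelTransport_eq_iInf_couplingBundle [StandardBorelSpace X'] [Nonempty X']
    (κ : Kernel X X') (Φ : Kernel Y Y') [IsMarkovKernel Φ] (C : Y' → Measure X' → ℝ≥0∞) (z : Y × ProbabilityMeasure X) :
    kernelTransport ((z.2 : Measure X).bind κ) (Φ z.1) C =
      ⨅ (γ : ProbabilityMeasure (Y' × X')) (_ : (z, γ) ∈ couplingBundle κ Φ),
        disintegratedCost C γ :=
  kernelTransport_eq_iInf_disintegratedCost _ _ _

variable [TopologicalSpace X] [BorelSpace X] [TopologicalSpace X'] [PolishSpace X']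
  [BorelSpace X'] [TopologicalSpace Y] [TopologicalSpace Y'] [PolishSpace Y'] [BorelSpace Y']

theorem isClosed_couplingBundle {κ : Kernel X X'} {Φ : Kernel Y Y'} [IsMarkovKernel κ]
    [IsMarkovKernel Φ] (hκ : Continuous (kernelProb κ)) (hΦ : Continuous (kernelProb Φ)) :
    IsClosed (couplingBundle κ Φ) := by
  have : couplingBundle κ Φ = {z | z.2.map measurable_fst.aemeasurable = kernelProb Φ z.1.1} ∩
      {z | z.2.map measurable_snd.aemeasurable = bindProb κ z.1.2} := by
    ext z
    exact mem_couplingBundle_iff κ Φ z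
  rw [this]
  exact (isClosed_eq ((ProbabilityMeasure.continuous_map continuous_fst).comp continuous_snd)
    (hΦ.comp (continuous_fst.comp continuous_fst))).inter
    (isClosed_eq ((ProbabilityMeasure.continuous_map continuous_snd).comp continuous_snd)
    ((continuous_bindProb κ hκ).comp (continuous_snd.comp continuous_fst)))

/-- The marginals converge with the parameters, hence are tight; tight marginals make the couplings
tight, and Prokhorov's theorem applies. -/
theorem seqProper_couplingBundle {κ : Kernel X X'} {Φ : Kernel Y Y'} [IsMarkovKernel κ]
    [IsMarkovKernel Φ] (hκ : Continuous (kernelProb κ)) (hΦ : Continuous (kernelProb Φ)) :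
    SeqProper (couplingBundle κ Φ) := by
  intro z z₀ γ hz hγ
  have h1 := isTightMeasureSet_range_of_tendsto
    (((hΦ.comp continuous_fst).tendsto z₀).comp hz)
  have h2 := isTightMeasureSet_range_of_tendsto
    ((((continuous_bindProb κ hκ).comp continuous_snd).tendsto z₀).comp hz)
  have htight : IsTightMeasureSet
      {((μ : ProbabilityMeasure (Y' × X')) : Measure (Y' × X')) | μ ∈ range γ} := by
    apply isTightMeasureSet_of_marginals
    · refine h1.subset ?_
      rintro _ ⟨_, ⟨_, ⟨n, rfl⟩, rfl⟩, rfl⟩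
      exact ⟨_, ⟨n, rfl⟩, (hγ n).1.symm⟩
    · refine h2.subset ?_
      rintro _ ⟨_, ⟨_, ⟨n, rfl⟩, rfl⟩, rfl⟩
      exact ⟨_, ⟨n, rfl⟩, (hγ n).2.symm⟩
  obtain ⟨γ₀, -, φ, hφ, hγ₀⟩ := (isCompact_closure_of_isTightMeasureSet htight).isSeqCompact
    (x := γ) fun n => subset_closure ⟨n, rfl⟩
  exact ⟨γ₀, φ, hφ, hγ₀⟩

variable [PolishSpace X] [PolishSpace Y] {C : Y' → Measure X' → ℝ≥0∞}
  (hC : LowerSemicontinuous fun z : Y' × ProbabilityMeasure X' => C z.1 z.2)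
  (hconv : ∀ y, ConvexOn ℝ≥0 {p : Measure X' | IsProbabilityMeasure p} (C y))
include hC hconv

theorem lowerSemicontinuous_kernelTransport [Nonempty X'] {κ : Kernel X X'} {Φ : Kernel Y Y'}
    [IsMarkovKernel κ] [IsMarkovKernel Φ] (hκ : Continuous (kernelProb κ))
    (hΦ : Continuous (kernelProb Φ)) :
    LowerSemicontinuous fun z : Y × ProbabilityMeasure X =>
      kernelTransport ((z.2 : Measure X).bind κ) (Φ z.1) C := by
  simp_rw [kernelTransport_eq_iInf_couplingBundle]
  exact lowerSemicontinuous_fiber_iInf (isClosed_couplingBundle hκ hΦ)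
    (seqProper_couplingBundle hκ hΦ) (lowerSemicontinuous_disintegratedCost hC hconv)

/-- Optimal couplings are selected measurably in `(y, m)` and then disintegrated jointly in `(y, m)`
and `y'`; for each fixed `(y, m)` this agrees almost everywhere with the disintegration of the
single coupling. -/
theorem hasOptimalKernel_of_continuous [BorelSpace Y] [Nonempty X'] {κ : Kernel X X'} {Φ : Kernel Y Y'}
    [IsMarkovKernel κ] [IsMarkovKernel Φ] (hκ : Continuous (kernelProb κ))
    (hΦ : Continuous (kernelProb Φ)) : HasOptimalKernel κ Φ C := by
  obtain ⟨s, hs, hsD⟩ := exists_measurable_argmin (isClosed_couplingBundle hκ hΦ)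
    (seqProper_couplingBundle hκ hΦ) (fun z => ⟨(kernelProb Φ z.1).prod (bindProb κ z.2), by
      constructor <;> simp⟩) (lowerSemicontinuous_disintegratedCost hC hconv)
  let S : Kernel (Y × ProbabilityMeasure X) (Y' × X') := (probKernel (Y' × X')).comap s hs
  have hS (z : Y × ProbabilityMeasure X) : S z = (s z : Measure (Y' × X')) := rfl
  have hfst (z : Y × ProbabilityMeasure X) : S.fst z = Φ z.1 := by
    rw [← (hsD z).1.1, Kernel.fst_apply]
    rfl
  refine ⟨S.condKernel, inferInstance, fun y m => ?_⟩
  have hae := Kernel.condKernel_apply_eq_condKernel S (y, m)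
  rw [hfst] at hae
  have hcong : ⇑(S.condKernel.sectR (y, m)) =ᵐ[Φ y] (s (y, m) : Measure (Y' × X')).condKernel := hae
  constructor
  · rw [Measure.bind_congr_right hcong, ← (hsD (y, m)).1.2, ← (hsD (y, m)).1.1]
    conv_rhs => rw [← Measure.disintegrate (s (y, m) : Measure (Y' × X'))
      (s (y, m) : Measure (Y' × X')).condKernel]
    rw [Measure.snd_compProd]
  · rw [kernelTransport_eq_iInf_couplingBundle κ Φ C (y, m), ← (hsD (y, m)).2, disintegratedCost,
      (hsD (y, m)).1.1]
    refine lintegral_congr_ae ?_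
    filter_upwards [hae] with y' hy'
    exact congrArg (C y') hy'

end OneStep

/-! ### Polish refinements that make Borel kernels continuous. -/

section Refinement

/-- A Polish refinement of a topology which agrees with it on the set `S`. -/
structure IsPolishRefinement {X : Type*} (τ t : TopologicalSpace X) (S : Set X) : Prop where
  le : τ ≤ t
  polish : @PolishSpace X τ
  agree : ∀ U, IsOpen[τ] U → ∃ O, IsOpen[t] O ∧ U ∩ S = O ∩ S

theorem IsPolishRefinement.rfl {X : Type*} {t : TopologicalSpace X} [h : PolishSpace X]
    (S : Set X) : IsPolishRefinement t t S :=
  ⟨le_rfl, h, fun U hU => ⟨U, hU, Eq.refl _⟩⟩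

/-- Comparable Polish topologies have the same Borel sets. -/
theorem IsPolishRefinement.borelSpace {X : Type*} {τ t : TopologicalSpace X} {S : Set X}
    [m : MeasurableSpace X] [hP : PolishSpace X] [hB : BorelSpace X]
    (h : IsPolishRefinement τ t S) : @BorelSpace X τ m :=
  @BorelSpace.mk X τ m (hB.measurable_eq.trans (borel_eq_borel_of_le h.polish hP h.le).symm)

/-- A Borel map which is continuous on a closed set becomes continuous for a Polish refinement of
the topology which does not change the topology of the closed set. -/
theorem exists_isPolishRefinement_continuous {X B : Type*} [t : TopologicalSpace X] [PolishSpace X]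
    [MeasurableSpace X] [BorelSpace X] [TopologicalSpace B] [SecondCountableTopology B]
    [MeasurableSpace B] [OpensMeasurableSpace B] {f : X → B} (hf : Measurable f) {S : Set X}
    (hS : IsClosed S) (hfS : ContinuousOn f S) :
    ∃ τ : TopologicalSpace X, IsPolishRefinement τ t S ∧ Continuous[τ, _] f := by
  classical
  have hPS : PolishSpace S := hS.polishSpace
  have hPT : PolishSpace ↥Sᶜ := hS.isOpen_compl.polishSpace
  have hval (U : Set X) (hU : IsOpen U) : IsOpen ((fun x : ↥Sᶜ => (x : X)) ⁻¹' U) :=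
    hU.preimage continuous_subtype_val
  obtain ⟨t', ht'le, ht'c, ht'P⟩ :=
    (hf.comp (measurable_subtype_coe (p := fun x => x ∈ Sᶜ))).exists_continuous
  -- Only the complement of `S` is refined, until `f` is continuous there; the space is then
  -- reassembled as the topological sum of `S` and its complement.
  let e : S ⊕ ↥Sᶜ ≃ X := Equiv.Set.sumCompl S
  let tS : TopologicalSpace (S ⊕ ↥Sᶜ) := @instTopologicalSpaceSum _ _ _ t'
  have hPsum : @PolishSpace _ tS := by
    have (A B : Type _) [TopologicalSpace A] [PolishSpace A] [TopologicalSpace B]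
      [PolishSpace B] : PolishSpace (A ⊕ B) := inferInstance
    exact @this S ↥Sᶜ _ hPS t' ht'P
  have hopen (U : Set X) : IsOpen[.coinduced e tS] U ↔
      IsOpen ((fun x : S => (x : X)) ⁻¹' U) ∧ IsOpen[t'] ((fun x : ↥Sᶜ => (x : X)) ⁻¹' U) := by
    have (A B : Type _) [TopologicalSpace A] [TopologicalSpace B] (U : Set (A ⊕ B)) :
        IsOpen U ↔ IsOpen (Sum.inl ⁻¹' U) ∧ IsOpen (Sum.inr ⁻¹' U) := isOpen_sum_iff
    rw [isOpen_coinduced]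
    exact @this S ↥Sᶜ _ t' (e ⁻¹' U)
  refine ⟨.coinduced e tS, ⟨fun U hU => ?_, ?_, fun U hU => ?_⟩, ?_⟩
  · exact (hopen U).2 ⟨hU.preimage continuous_subtype_val, ht'le _ (hval U hU)⟩
  · rw [← e.induced_symm]
    exact e.symm.polishSpace_induced
  · obtain ⟨O, hO, hOU⟩ := isOpen_induced_iff.1 ((hopen U).1 hU).1
    refine ⟨O, hO, ?_⟩
    ext x
    constructor
    · rintro ⟨hxU, hxS⟩
      exact ⟨(Set.ext_iff.1 hOU ⟨x, hxS⟩).2 hxU, hxS⟩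
    · rintro ⟨hxO, hxS⟩
      exact ⟨(Set.ext_iff.1 hOU ⟨x, hxS⟩).1 hxO, hxS⟩
  · rw [continuous_def]
    intro U hU
    rw [hopen]
    exact ⟨hU.preimage (continuousOn_iff_continuous_domRestrict.1 hfS),
      @IsOpen.preimage _ _ t' _ _ ht'c _ hU⟩

/-- `V(y, p)` is jointly lower semicontinuous on `Y` times the space of probability measures. -/
def JointlyLsc {Y X : Type*} [TopologicalSpace Y] [MeasurableSpace X] [TopologicalSpace X]
    [OpensMeasurableSpace X] (V : Y → Measure X → ℝ≥0∞) : Prop :=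
  LowerSemicontinuous fun z : Y × ProbabilityMeasure X => V z.1 z.2

/-- Joint lower semicontinuity for Polish refinements of the topologies, the one of the second space
being unchanged on `S`. -/
def RefinedLsc {Y X : Type*} [tY : TopologicalSpace Y] [MeasurableSpace X]
    [tX : TopologicalSpace X] (S : Set X) (V : Y → Measure X → ℝ≥0∞) : Prop :=
  ∃ (σ : TopologicalSpace Y) (τ : TopologicalSpace X) (hτ : @OpensMeasurableSpace X τ _),
    IsPolishRefinement σ tY ∅ ∧ IsPolishRefinement τ tX S ∧ @JointlyLsc Y X σ _ τ hτ V

theorem RefinedLsc.measurable {Y X : Type*} [TopologicalSpace Y] [PolishSpace Y]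
    [MeasurableSpace Y] [BorelSpace Y] [MeasurableSpace X] [TopologicalSpace X] [PolishSpace X]
    [BorelSpace X] {S : Set X} {V : Y → Measure X → ℝ≥0∞} (h : RefinedLsc S V) :
    Measurable fun z : Y × ProbabilityMeasure X => V z.1 z.2 := by
  obtain ⟨σ, τ, hτ, hσ, hτ', hV⟩ := h
  have aux (Y X : Type _) [TopologicalSpace Y] [PolishSpace Y] [MeasurableSpace Y] [BorelSpace Y]
      [MeasurableSpace X] [TopologicalSpace X] [PolishSpace X] [BorelSpace X]
      (V : Y → Measure X → ℝ≥0∞) (hV : JointlyLsc V) :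
      Measurable fun z : Y × ProbabilityMeasure X => V z.1 z.2 :=
    LowerSemicontinuous.measurable hV
  exact @aux Y X σ hσ.polish _ hσ.borelSpace _ τ hτ'.polish hτ'.borelSpace V hV

/-- Weak convergence for a topology implies weak convergence for a refinement of it, if all measures
are concentrated on a set where the topologies agree. -/
theorem tendsto_of_isPolishRefinement {X ι : Type*} [MeasurableSpace X] {τ t : TopologicalSpace X}
    [PolishSpace X] [BorelSpace X] {S : Set X} (hS : MeasurableSet S)
    (hτ : IsPolishRefinement τ t S) (hO : @OpensMeasurableSpace X τ _) {l : Filter ι}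
    [l.IsCountablyGenerated] {q : ι → ProbabilityMeasure X} {p : ProbabilityMeasure X}
    (hq : ∀ᶠ i in l, (q i : Measure X) Sᶜ = 0) (hp : (p : Measure X) Sᶜ = 0)
    (h : Tendsto q l (𝓝 p)) :
    Tendsto q l (@nhds _ (@ProbabilityMeasure.instTopologicalSpace X _ τ hO) p) := by
  refine @tendsto_of_forall_isOpen_le_liminf' X _ τ hO _ _ _ _ _ fun U hU => ?_
  obtain ⟨O, hO, hUO⟩ := hτ.agree U hU
  -- A measure carried by `S` does not distinguish a refined open set from an original open set with
  -- the same trace on `S`, so the portmanteau inequality carries over.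
  have hmeas (r : Measure X) (hr : r Sᶜ = 0) : r U = r O := by
    have hd (A : Set X) : r (A \ S) = 0 := measure_mono_null (fun x hx => hx.2) hr
    rw [← measure_inter_add_sdiff U hS, ← measure_inter_add_sdiff O hS, hUO, hd, hd]
  rw [hmeas _ hp]
  refine (ProbabilityMeasure.le_liminf_measure_open_of_tendsto h hO).trans (le_of_eq ?_)
  refine liminf_congr ?_
  filter_upwards [hq] with i hi
  exact (hmeas _ hi).symm

theorem RefinedLsc.lowerSemicontinuousOn {Y X : Type*} [TopologicalSpace Y] [MeasurableSpace X]
    [TopologicalSpace X] [PolishSpace X] [BorelSpace X] {S : Set X} (hS : MeasurableSet S)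
    {V : Y → Measure X → ℝ≥0∞} (h : RefinedLsc S V) (y : Y) :
    LowerSemicontinuousOn (fun p : ProbabilityMeasure X => V y p)
      {p | (p : Measure X) Sᶜ = 0} := by
  intro p hp r hr
  have hev : ∀ᶠ q in 𝓝[{p : ProbabilityMeasure X | (p : Measure X) Sᶜ = 0}] p,
      ((q : ProbabilityMeasure X) : Measure X) Sᶜ = 0 := eventually_mem_nhdsWithin
  have hlim : Tendsto id (𝓝[{p : ProbabilityMeasure X | (p : Measure X) Sᶜ = 0}] p) (𝓝 p) :=
    tendsto_id.mono_left nhdsWithin_le_nhds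
  have hcg : (𝓝[{p : ProbabilityMeasure X | (p : Measure X) Sᶜ = 0}] p).IsCountablyGenerated :=
    inferInstance
  obtain ⟨σ, τ, hτ, hσ, hτ', hV⟩ := h
  have hV' : ∀ᶠ q : ProbabilityMeasure X in
      @nhds _ (@ProbabilityMeasure.instTopologicalSpace X _ τ hτ) p, r < V y q := by
    have aux (Y X : Type _) [TopologicalSpace Y] [MeasurableSpace X] [TopologicalSpace X]
        [OpensMeasurableSpace X] (V : Y → Measure X → ℝ≥0∞) (hV : JointlyLsc V) (y : Y)
        (p : ProbabilityMeasure X) (hr : r < V y p) :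
        ∀ᶠ q : ProbabilityMeasure X in 𝓝 p, r < V y q :=
      (LowerSemicontinuous.comp hV (continuous_const.prodMk continuous_id : Continuous
            fun p : ProbabilityMeasure X => (y, p))) p r hr
    exact @aux Y X σ _ τ hτ V hV y p hr
  exact (tendsto_of_isPolishRefinement hS hτ' hτ hev hp hlim).eventually hV'

theorem continuousOn_of_isPolishRefinement {A X : Type*} [TopologicalSpace A]
    [FirstCountableTopology A] [MeasurableSpace X] {τ t : TopologicalSpace X}
    [PolishSpace X] [BorelSpace X] {S : Set X} (hS : MeasurableSet S)
    (hτ : IsPolishRefinement τ t S) (hO : @OpensMeasurableSpace X τ _) {T : Set A}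
    {q : A → ProbabilityMeasure X} (hq : ∀ a ∈ T, (q a : Measure X) Sᶜ = 0)
    (h : ContinuousOn q T) :
    @ContinuousOn _ _ _ (@ProbabilityMeasure.instTopologicalSpace X _ τ hO) q T := by
  intro a ha
  exact tendsto_of_isPolishRefinement hS hτ hO
    (eventually_mem_nhdsWithin.mono fun b hb => hq b hb) (hq a ha) (h a ha)

end Refinement

/-! ### One step of the backward induction. -/

section Step

variable {X X' Y Y' : Type*} [MeasurableSpace X] [MeasurableSpace X'] [MeasurableSpace Y]
  [MeasurableSpace Y']

theorem isProbabilityMeasure_convexCombination {a b : ℝ≥0} (hab : a + b = 1) (p q : Measure X)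
    [IsProbabilityMeasure p] [IsProbabilityMeasure q] :
    IsProbabilityMeasure (a • p + b • q) := by
  constructor
  simp only [Measure.add_apply, Measure.smul_apply, measure_univ, ENNReal.smul_def,
    smul_eq_mul, mul_one]
  exact_mod_cast hab

theorem lintegral_convexCombination {ρ : Measure X} {f g : X → ℝ≥0∞} (hf : Measurable f)
    (hg : Measurable g) (a b : ℝ≥0) :
    ∫⁻ x, a • f x + b • g x ∂ρ = a • ∫⁻ x, f x ∂ρ + b • ∫⁻ x, g x ∂ρ := by
  simp only [ENNReal.smul_def, smul_eq_mul]
  rw [lintegral_add_left (hf.const_mul _), lintegral_const_mul _ hf, lintegral_const_mul _ hg]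

/-- The mixture of optimal kernels for `p` and `q` is admissible for the mixture of `p` and `q`, and
`C` is convex in the kernel. -/
theorem convexOn_kernelTransport {κ : Kernel X X'} {Φ : Kernel Y Y'}
    {C : Y' → Measure X' → ℝ≥0∞} (hopt : HasOptimalKernel κ Φ C)
    (hCm : Measurable fun z : Y' × ProbabilityMeasure X' => C z.1 z.2)
    (hconv : ∀ y, ConvexOn ℝ≥0 {p : Measure X' | IsProbabilityMeasure p} (C y)) (y : Y) :
    ConvexOn ℝ≥0 {p : Measure X | IsProbabilityMeasure p}
      fun m => kernelTransport (m.bind κ) (Φ y) C := by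
  obtain ⟨Q, hQ, hQo⟩ := hopt
  refine ⟨fun p hp q hq a b _ _ hab => ?_, fun p hp q hq a b _ _ hab => ?_⟩
  · have : IsProbabilityMeasure p := hp
    have : IsProbabilityMeasure q := hq
    exact isProbabilityMeasure_convexCombination hab p q
  have : IsProbabilityMeasure p := hp
  have : IsProbabilityMeasure q := hq
  let p' : ProbabilityMeasure X := ⟨p, hp⟩
  let q' : ProbabilityMeasure X := ⟨q, hq⟩
  let k : Kernel Y' X' := ⟨fun y' => a • Q ((y, p'), y') + b • Q ((y, q'), y'), by
    refine Measure.measurable_of_measurable_coe _ fun s hs => ?_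
    simp only [Measure.add_apply, Measure.smul_apply]
    exact (((Kernel.measurable_coe Q hs).comp measurable_prodMk_left).const_smul a).add
      (((Kernel.measurable_coe Q hs).comp measurable_prodMk_left).const_smul b)⟩
  have hk (y' : Y') : k y' = a • Q ((y, p'), y') + b • Q ((y, q'), y') := rfl
  have hkM : IsMarkovKernel k := ⟨fun y' => isProbabilityMeasure_convexCombination hab _ _⟩
  have hbind : (Φ y).bind k = (a • p + b • q).bind κ := by
    have h1 := (hQo y p').1
    have h2 := (hQo y q').1
    have h3 : (Φ y).bind k =
        a • (Φ y).bind (Q.sectR (y, p')) + b • (Φ y).bind (Q.sectR (y, q')) := by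
      ext s hs
      simp only [Measure.add_apply, Measure.smul_apply, Measure.bind_apply hs
        (Kernel.measurable _).aemeasurable, hk, Kernel.sectR_apply]
      exact lintegral_convexCombination ((Kernel.measurable_coe Q hs).comp measurable_prodMk_left)
        ((Kernel.measurable_coe Q hs).comp measurable_prodMk_left) a b
    rw [h3, h1, h2]
    ext s hs
    simp only [Measure.add_apply, Measure.smul_apply, Measure.bind_apply hs
        (Kernel.measurable _).aemeasurable, lintegral_add_measure, lintegral_smul_measure]
    rfl
  have hm (r : ProbabilityMeasure X) : Measurable fun y' => C y' (Q ((y, r), y')) :=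
    hCm.comp (measurable_id.prodMk ((measurable_kernelProb Q).comp measurable_prodMk_left))
  calc kernelTransport ((a • p + b • q).bind κ) (Φ y) C
      ≤ ∫⁻ y', C y' (k y') ∂(Φ y) := (iInf₂_le k hkM).trans (iInf_le _ hbind)
    _ ≤ ∫⁻ y', (a • C y' (Q ((y, p'), y')) + b • C y' (Q ((y, q'), y'))) ∂(Φ y) :=
        lintegral_mono fun y' => (hconv y').2 (inferInstanceAs (IsProbabilityMeasure (Q _)))
          (inferInstanceAs (IsProbabilityMeasure (Q _))) zero_le zero_le hab
    _ = _ := by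
        rw [lintegral_convexCombination (hm p') (hm q'), (hQo y p').2, (hQo y q').2]
        rfl

/-- One step of the backward induction: regularity of the cost passes to the value, and there is an
optimal kernel. -/
theorem refinedLsc_kernelTransport [Nonempty X'] [tX : TopologicalSpace X] [PolishSpace X]
    [BorelSpace X] [TopologicalSpace X'] [PolishSpace X'] [BorelSpace X'] [tY : TopologicalSpace Y]
    [PolishSpace Y] [BorelSpace Y] [TopologicalSpace Y'] [PolishSpace Y'] [BorelSpace Y']
    {κ : Kernel X X'} {Φ : Kernel Y Y'} [IsMarkovKernel κ] [IsMarkovKernel Φ] {S : Set X}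
    (hS : IsClosed S) (hκ : ContinuousOn (kernelProb κ) S) {C : Y' → Measure X' → ℝ≥0∞}
    (hC : JointlyLsc C)
    (hconv : ∀ y, ConvexOn ℝ≥0 {p : Measure X' | IsProbabilityMeasure p} (C y)) :
    RefinedLsc S (fun (y : Y) m => kernelTransport (m.bind κ) (Φ y) C) ∧
      HasOptimalKernel κ Φ C := by
  -- The topology of `X` is changed only off `S`, where `κ` may be discontinuous; that of `Y` is
  -- refined without restriction.
  obtain ⟨τ, hτ, hτκ⟩ := exists_isPolishRefinement_continuous (measurable_kernelProb κ) hS hκ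
  obtain ⟨σ, hσ, hσΦ⟩ := exists_isPolishRefinement_continuous (measurable_kernelProb Φ)
    isClosed_empty (continuousOn_empty _)
  have hτB := hτ.borelSpace
  have hσB := hσ.borelSpace
  refine ⟨⟨σ, τ, @BorelSpace.opensMeasurable X τ _ hτB, hσ, hτ, ?_⟩, ?_⟩
  · exact @lowerSemicontinuous_kernelTransport X X' Y Y' _ _ _ _ τ hτB _ _ _ σ _ _ _ hτ.polish
      hσ.polish C hC hconv _ κ Φ _ _ hτκ hσΦ
  · exact @hasOptimalKernel_of_continuous X X' Y Y' _ _ _ _ τ hτB _ _ _ σ _ _ _ hτ.polish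
      hσ.polish C hC hconv hσB _ κ Φ _ _ hτκ hσΦ

theorem RefinedLsc.lintegral_add [tX : TopologicalSpace X] [PolishSpace X] [BorelSpace X]
    [tY : TopologicalSpace Y] [PolishSpace Y] [BorelSpace Y] {S : Set X}
    {V : Y → Measure X → ℝ≥0∞} (hV : RefinedLsc S V) {f : X → Y → ℝ≥0∞}
    (hf : LowerSemicontinuous fun z : X × Y => f z.1 z.2) :
    RefinedLsc S fun y p => ∫⁻ x, f x y ∂p + V y p := by
  obtain ⟨σ, τ, hτ, hσ, hτ', hV⟩ := hV
  refine ⟨σ, τ, hτ, hσ, hτ', ?_⟩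
  have aux (Y X : Type _) [TopologicalSpace Y] [PolishSpace Y] [MeasurableSpace Y] [BorelSpace Y]
      [MeasurableSpace X] [TopologicalSpace X] [PolishSpace X] [BorelSpace X]
      (V : Y → Measure X → ℝ≥0∞) (hV : JointlyLsc V) (f : Y × X → ℝ≥0∞)
      (hf : LowerSemicontinuous f) : JointlyLsc fun y p => ∫⁻ x, f (y, x) ∂p + V y p :=
    (lowerSemicontinuous_lintegral_prod hf).add hV
  refine @aux Y X σ hσ.polish _ hσ.borelSpace _ τ hτ'.polish hτ'.borelSpace V hV
    (fun z => f z.2 z.1) ?_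
  have aux' (Y₁ X₁ Y₂ X₂ : Type _) [TopologicalSpace Y₁] [TopologicalSpace X₁] [TopologicalSpace Y₂]
      [TopologicalSpace X₂] (i : X₁ → X₂) (j : Y₁ → Y₂) (hi : Continuous i) (hj : Continuous j)
      (g : X₂ × Y₂ → ℝ≥0∞) (hg : LowerSemicontinuous g) :
      LowerSemicontinuous fun z : Y₁ × X₁ => g (i z.2, j z.1) :=
    hg.comp ((hi.comp continuous_snd).prodMk (hj.comp continuous_fst))
  exact @aux' Y X Y X σ τ tY tX id id (continuous_id_of_le hτ'.le) (continuous_id_of_le hσ.le) _ hf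

end Step

theorem RefinedLsc.congr {X Y : Type*} [TopologicalSpace Y] [MeasurableSpace X]
    [TopologicalSpace X] {S : Set X} {V V' : Y → Measure X → ℝ≥0∞} (h : RefinedLsc S V)
    (hVV' : ∀ (y : Y) (p : ProbabilityMeasure X), V y p = V' y p) : RefinedLsc S V' := by
  obtain ⟨σ, τ, hτ, hσ, hτ', hV⟩ := h
  refine ⟨σ, τ, hτ, hσ, hτ', ?_⟩
  have : (fun z : Y × ProbabilityMeasure X => V z.1 z.2) =
      fun z : Y × ProbabilityMeasure X => V' z.1 z.2 := funext fun z => hVV' z.1 z.2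
  rw [JointlyLsc, ← this]
  exact hV

theorem refinedLsc_const {X Y : Type*} [TopologicalSpace Y] [PolishSpace Y] [MeasurableSpace X]
    [TopologicalSpace X] [PolishSpace X] [OpensMeasurableSpace X] (S : Set X) (r : ℝ≥0∞) :
    RefinedLsc S fun (_ : Y) (_ : Measure X) => r :=
  ⟨_, _, inferInstance, .rfl ∅, .rfl S, lowerSemicontinuous_const⟩

/-- The step is run with the refined topologies on `X'` and `Y'` inherited from the later stage. For
`x ∈ S` the measure `κ x` is carried by `S'`, where the topology of `X'` is unchanged, so `κ` stays
weakly continuous on `S` for the refined topology. -/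
theorem RefinedLsc.kernelTransport {X X' Y Y' : Type*} [MeasurableSpace X] [MeasurableSpace X']
    [MeasurableSpace Y] [MeasurableSpace Y'] [Nonempty X'] [TopologicalSpace X] [PolishSpace X]
    [BorelSpace X] [TopologicalSpace X'] [PolishSpace X'] [BorelSpace X'] [TopologicalSpace Y]
    [PolishSpace Y] [BorelSpace Y] [TopologicalSpace Y'] [PolishSpace Y'] [BorelSpace Y']
    {κ : Kernel X X'} {Φ : Kernel Y Y'} [IsMarkovKernel κ] [IsMarkovKernel Φ] {S : Set X}
    (hS : IsClosed S) (hκ : ContinuousOn (kernelProb κ) S) {S' : Set X'} (hS' : IsClosed S')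
    (hκS : ∀ x ∈ S, κ x S'ᶜ = 0) {C : Y' → Measure X' → ℝ≥0∞} (hC : RefinedLsc S' C)
    (hconv : ∀ y, ConvexOn ℝ≥0 {p : Measure X' | IsProbabilityMeasure p} (C y)) :
    RefinedLsc S (fun (y : Y) m => CausalDPP.kernelTransport (m.bind κ) (Φ y) C) ∧
      HasOptimalKernel κ Φ C := by
  have hS'm := hS'.measurableSet
  obtain ⟨σ, τ, hO, hσ, hτ, hlsc⟩ := hC
  exact @refinedLsc_kernelTransport X X' Y Y' _ _ _ _ _ _ _ _ τ hτ.polish hτ.borelSpace _ _ _ σ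
    hσ.polish hσ.borelSpace κ Φ _ _ S hS
    (continuousOn_of_isPolishRefinement hS'm hτ hO hκS hκ) C hlsc hconv

/-! ### Value functions as transport problems on path space, and their regularity. -/

section Paths

/-- The path `(y_1, …, y_t, a)`. -/
abbrev snocPath {t : ℕ} (y : Path t) (a : ℝ) : Path (t + 1) := Fin.snoc (α := fun _ => ℝ) y a

@[fun_prop]
theorem measurable_snocPath {t : ℕ} : Measurable fun z : Path t × ℝ => snocPath z.1 z.2 := by
  refine measurable_pi_iff.2 fun i => ?_
  refine Fin.lastCases ?_ (fun j => ?_) i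
  · simpa [snocPath] using measurable_snd
  · simp only [snocPath, Fin.snoc_castSucc]
    exact (measurable_pi_apply j).comp measurable_fst

theorem measurable_snocPath_left {t : ℕ} (y : Path t) : Measurable (snocPath y) :=
  measurable_snocPath.comp measurable_prodMk_left

/-- The kernel `y ↦ δ_y ⊗ θ(y)`, which extends a path by one more variable. -/
noncomputable def extendKernel {t : ℕ} (θ : Kernel (Path t) ℝ) : Kernel (Path t) (Path (t + 1)) :=
  (Kernel.id ×ₖ θ).map fun z => snocPath z.1 z.2

instance {t : ℕ} (θ : Kernel (Path t) ℝ) [IsMarkovKernel θ] : IsMarkovKernel (extendKernel θ) :=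
  Kernel.IsMarkovKernel.map _ measurable_snocPath

theorem extendKernel_apply {t : ℕ} (θ : Kernel (Path t) ℝ) [IsMarkovKernel θ] (y : Path t) :
    extendKernel θ y = (θ y).map (snocPath y) := by
  rw [extendKernel, Kernel.map_apply _ measurable_snocPath, Kernel.prod_apply, Kernel.id_apply,
    Measure.dirac_prod, Measure.map_map measurable_snocPath measurable_prodMk_left]
  rfl

variable (N : ℕ) (c : (t : ℕ) → ℝ → Path t → ℝ≥0∞) (κ : ℕ → Kernel ℝ ℝ)
  (θ : (t : ℕ) → Kernel (Path t) ℝ)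

/-- The function `(y, p) ↦ ∫ p(dx) c_t(x, y) + V_t(y; p)`. -/
noncomputable def stageCost (t : ℕ) (y : Path t) (p : Measure ℝ) : ℝ≥0∞ :=
  ∫⁻ x, c t x y ∂p + valueFn N c κ θ t y p

variable {N c κ θ}

section StepIntegrand

variable {t : ℕ} {f : ℝ → Path (t + 1) → ℝ≥0∞} {W : Path (t + 1) → Measure ℝ → ℝ≥0∞}
  (hf : Measurable fun z : ℝ × Path (t + 1) => f z.1 z.2)
  (hW : Measurable fun z : Path (t + 1) × ProbabilityMeasure ℝ => W z.1 z.2)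
include hf hW

instance (γ : ProbabilityMeasure (ℝ × ℝ)) : IsMarkovKernel (kernelGivenSnd γ) := by
  have : IsProbabilityMeasure ((γ : Measure (ℝ × ℝ)).map Prod.swap) :=
    Measure.isProbabilityMeasure_map measurable_swap.aemeasurable
  unfold kernelGivenSnd
  infer_instance

theorem measurable_stepIntegrand (y : Path t) (γ : ProbabilityMeasure (ℝ × ℝ)) :
    Measurable (stepIntegrand f W y γ) := by
  have h1 : Measurable fun p : ℝ × ℝ => snocPath y p.2 :=
    (measurable_snocPath_left y).comp measurable_snd
  exact (hf.comp (measurable_fst.prodMk h1)).add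
    (hW.comp (h1.prodMk ((measurable_kernelProb (kernelGivenSnd γ)).comp measurable_snd)))

theorem measurable_lintegral_add_kernel (y : Path t) (q : Kernel ℝ ℝ) [IsMarkovKernel q] :
    Measurable fun y' => ∫⁻ x, f x (snocPath y y') ∂(q y') + W (snocPath y y') (q y') := by
  have h1 := measurable_snocPath_left y
  refine Measurable.add ?_ (hW.comp (h1.prodMk (measurable_kernelProb q)))
  exact Measurable.lintegral_kernel_prod_right' (κ := q)
    (f := fun z : ℝ × ℝ => f z.2 (snocPath y z.1))
    (hf.comp (measurable_snd.prodMk (h1.comp measurable_fst)))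

theorem lintegral_stepIntegrand (y : Path t) (γ : ProbabilityMeasure (ℝ × ℝ)) :
    ∫⁻ p, stepIntegrand f W y γ p ∂(γ : Measure (ℝ × ℝ)) =
      ∫⁻ y', (∫⁻ x, f x (snocPath y y') ∂(kernelGivenSnd γ y') +
        W (snocPath y y') (kernelGivenSnd γ y')) ∂(γ : Measure (ℝ × ℝ)).snd := by
  have hm := measurable_stepIntegrand hf hW y γ
  have hswap : (γ : Measure (ℝ × ℝ)) = ((γ : Measure (ℝ × ℝ)).map Prod.swap).map Prod.swap := by
    rw [Measure.map_map measurable_swap measurable_swap]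
    simp
  have hfst : ((γ : Measure (ℝ × ℝ)).map Prod.swap).fst = (γ : Measure (ℝ × ℝ)).snd := by
    rw [Measure.fst_map_swap]
  conv_lhs => rw [hswap]
  rw [lintegral_map hm measurable_swap, ← hfst]
  refine Eq.trans (Measure.lintegral_condKernel (f := fun a => stepIntegrand f W y γ a.swap)
    (hm.comp measurable_swap)).symm ?_
  refine lintegral_congr fun y' => ?_
  have h1 : Measurable fun x => f x (snocPath y y') :=
    hf.comp (measurable_id.prodMk measurable_const)
  change ∫⁻ x, (f x (snocPath y y') + W (snocPath y y') (kernelGivenSnd γ y'))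
    ∂(kernelGivenSnd γ y') = _
  rw [lintegral_add_left h1, lintegral_const, measure_univ, mul_one]

/-- After disintegration in the second variable, the term `W` does not depend on `x` and integrates
to itself. Kernels and couplings then correspond up to null sets. -/
theorem iInf_stepIntegrand_eq_generalTransport (y : Path t) (η ρ : Measure ℝ)
    [IsProbabilityMeasure ρ] :
    ⨅ γ ∈ Couplings η ρ, ∫⁻ p, stepIntegrand f W y γ p ∂(γ : Measure (ℝ × ℝ)) =
      generalTransport η ρ
        fun y' p => ∫⁻ x, f x (snocPath y y') ∂p + W (snocPath y y') p := by
  apply le_antisymm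
  · refine le_iInf₂ fun q hq => le_iInf fun h => ?_
    let γ : ProbabilityMeasure (ℝ × ℝ) := ⟨(ρ ⊗ₘ q).map Prod.swap,
      Measure.isProbabilityMeasure_map measurable_swap.aemeasurable⟩
    have hγ : (γ : Measure (ℝ × ℝ)) = (ρ ⊗ₘ q).map Prod.swap := rfl
    have hsnd : (γ : Measure (ℝ × ℝ)).snd = ρ := by
      rw [hγ, Measure.snd_map_swap, Measure.fst_compProd]
    have hfst : (γ : Measure (ℝ × ℝ)).fst = η := by
      rw [hγ, Measure.fst_map_swap, Measure.snd_compProd, h]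
    have hswap : (γ : Measure (ℝ × ℝ)).map Prod.swap = ρ ⊗ₘ q := by
      rw [hγ, Measure.map_map measurable_swap measurable_swap]
      simp
    have hk : ∀ᵐ y' ∂ρ, kernelGivenSnd γ y' = q y' := by
      have hfst' : ((γ : Measure (ℝ × ℝ)).map Prod.swap).fst = ρ := by
        rw [hswap, Measure.fst_compProd]
      have h1 := eq_condKernel_of_measure_eq_compProd
        (ρ := (γ : Measure (ℝ × ℝ)).map Prod.swap) q (by rw [hfst', hswap])
      rw [hfst'] at h1
      filter_upwards [h1] with y' hy'
      exact hy'.symm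
    refine (iInf₂_le γ ⟨hfst, hsnd⟩).trans (le_of_eq ?_)
    rw [lintegral_stepIntegrand hf hW y γ, hsnd]
    refine lintegral_congr_ae ?_
    filter_upwards [hk] with y' hy'
    rw [hy']
  · refine le_iInf₂ fun γ hγ => ?_
    rw [lintegral_stepIntegrand hf hW y γ, hγ.2]
    have hk : IsMarkovKernel (kernelGivenSnd γ) := inferInstance
    refine (iInf₂_le (kernelGivenSnd γ) hk).trans (iInf_le _ ?_)
    have hswap : (γ : Measure (ℝ × ℝ)).fst = ((γ : Measure (ℝ × ℝ)).map Prod.swap).snd := by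
      rw [Measure.snd_map_swap]
    have hfst : ((γ : Measure (ℝ × ℝ)).map Prod.swap).fst = ρ := by
      rw [Measure.fst_map_swap, hγ.2]
    rw [← hγ.1, hswap]
    conv_rhs => rw [← Measure.disintegrate ((γ : Measure (ℝ × ℝ)).map Prod.swap)
      ((γ : Measure (ℝ × ℝ)).map Prod.swap).condKernel]
    rw [Measure.snd_compProd, hfst]
    rfl

end StepIntegrand

/-- The new value is the last variable of the extended path, so kernels may be indexed by either. In
path space the cost no longer depends on the parameter `y`, which enters through the marginals only,
as the one-step results require. -/
theorem generalTransport_eq_kernelTransport {t : ℕ} (y : Path t) (η ρ : Measure ℝ)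
    {C : Path (t + 1) → Measure ℝ → ℝ≥0∞}
    (hC : Measurable fun z : Path (t + 1) × ProbabilityMeasure ℝ => C z.1 z.2) :
    generalTransport η ρ (fun y' p => C (snocPath y y') p) =
      kernelTransport η (ρ.map (snocPath y)) C := by
  have hs := measurable_snocPath_left y
  apply le_antisymm
  · refine le_iInf₂ fun q hq => le_iInf fun h => ?_
    have hq' : IsMarkovKernel (q.comap (snocPath y) hs) := inferInstance
    refine (iInf₂_le (q.comap (snocPath y) hs) hq').trans ((iInf_le _ ?_).trans (le_of_eq ?_))
    · rw [← h]
      ext s hms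
      rw [Measure.bind_apply hms (Kernel.measurable _).aemeasurable, Measure.bind_apply hms
        (Kernel.measurable _).aemeasurable, lintegral_map (Kernel.measurable_coe q hms) hs]
      rfl
    · have hm : Measurable fun z => C z (q z) :=
        hC.comp (measurable_id.prodMk (measurable_kernelProb q))
      rw [lintegral_map hm hs]
      rfl
  · refine le_iInf₂ fun q hq => le_iInf fun h => ?_
    have hlast : Measurable fun z : Path (t + 1) => z (Fin.last t) := measurable_pi_apply _
    have hq' : IsMarkovKernel (q.comap _ hlast) := inferInstance
    refine (iInf₂_le (q.comap _ hlast) hq').trans ((iInf_le _ ?_).trans (le_of_eq ?_))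
    · rw [← h]
      ext s hms
      rw [Measure.bind_apply hms (Kernel.measurable _).aemeasurable, Measure.bind_apply hms
        (Kernel.measurable _).aemeasurable, lintegral_map (Kernel.measurable_coe _ hms) hs]
      simp [Kernel.comap_apply, snocPath]
    · have hm : Measurable fun z => C z (q.comap _ hlast z) :=
        hC.comp (measurable_id.prodMk (measurable_kernelProb (q.comap _ hlast)))
      rw [lintegral_map hm hs]
      simp [Kernel.comap_apply, snocPath]

theorem measurable_stageCost {t : ℕ} (hf : Measurable fun z : ℝ × Path t => c t z.1 z.2)
    (hW : Measurable fun z : Path t × ProbabilityMeasure ℝ => valueFn N c κ θ t z.1 z.2) :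
    Measurable fun z : Path t × ProbabilityMeasure ℝ => stageCost N c κ θ t z.1 z.2 := by
  refine Measurable.add ?_ hW
  exact Measurable.lintegral_kernel_prod_right' (κ := (probKernel ℝ).comap Prod.snd measurable_snd)
    (f := fun z : (Path t × ProbabilityMeasure ℝ) × ℝ => c t z.2 z.1.1)
    (hf.comp (measurable_snd.prodMk (measurable_fst.comp measurable_fst)))

theorem valueFn_eq_generalTransport [∀ t, IsMarkovKernel (θ t)] {t : ℕ} (ht : t < N)
    (hf : Measurable fun z : ℝ × Path (t + 1) => c (t + 1) z.1 z.2)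
    (hW : Measurable fun z : Path (t + 1) × ProbabilityMeasure ℝ =>
      valueFn N c κ θ (t + 1) z.1 z.2) (y : Path t) (m : Measure ℝ) :
    valueFn N c κ θ t y m =
      generalTransport (m.bind (κ t)) (θ t y) (stepCost N c κ θ t y) := by
  rw [valueFn, dif_pos ht]
  refine (iInf_stepIntegrand_eq_generalTransport (f := c (t + 1)) (W := valueFn N c κ θ (t + 1))
    hf hW y (m.bind (κ t)) (θ t y)).trans ?_
  unfold stepCost
  rfl

theorem valueFn_eq_kernelTransport [∀ t, IsMarkovKernel (θ t)] {t : ℕ} (ht : t < N)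
    (hf : Measurable fun z : ℝ × Path (t + 1) => c (t + 1) z.1 z.2)
    (hW : Measurable fun z : Path (t + 1) × ProbabilityMeasure ℝ =>
      valueFn N c κ θ (t + 1) z.1 z.2) (y : Path t) (m : Measure ℝ) :
    valueFn N c κ θ t y m =
      kernelTransport (m.bind (κ t)) (extendKernel (θ t) y) (stageCost N c κ θ (t + 1)) := by
  rw [valueFn_eq_generalTransport ht hf hW, extendKernel_apply]
  exact generalTransport_eq_kernelTransport (C := stageCost N c κ θ (t + 1)) y (m.bind (κ t))
    (θ t y) (measurable_stageCost hf hW)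

theorem convexOn_stageCost {t : ℕ} {y : Path t}
    (hW : ConvexOn ℝ≥0 {p : Measure ℝ | IsProbabilityMeasure p} (valueFn N c κ θ t y)) :
    ConvexOn ℝ≥0 {p : Measure ℝ | IsProbabilityMeasure p} (stageCost N c κ θ t y) := by
  refine ⟨hW.1, fun p hp q hq a b ha hb hab => ?_⟩
  have h := hW.2 hp hq ha hb hab
  unfold stageCost
  rw [lintegral_add_measure, lintegral_smul_measure, lintegral_smul_measure, smul_add, smul_add,
    add_add_add_comm]
  gcongr

/-- Regularity of the value functions, for sets `S t` which carry the transition kernels and on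
which these are continuous. -/
theorem regular_valueFn [∀ t, IsMarkovKernel (κ t)] [∀ t, IsMarkovKernel (θ t)]
    (hc : ∀ t, 1 ≤ t → t ≤ N → LowerSemicontinuous (fun p : ℝ × Path t => c t p.1 p.2))
    {S : ℕ → Set ℝ} (hS : ∀ t, IsClosed (S t))
    (hκ : ∀ t < N, ContinuousOn (kernelProb (κ t)) (S t))
    (hκS : ∀ t < N, ∀ x ∈ S t, κ t x (S (t + 1))ᶜ = 0) {t : ℕ} (htN : t ≤ N) :
    RefinedLsc (S t) (valueFn N c κ θ t) ∧
      (∀ y, ConvexOn ℝ≥0 {p : Measure ℝ | IsProbabilityMeasure p} (valueFn N c κ θ t y)) ∧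
      (t < N → HasOptimalKernel (κ t) (extendKernel (θ t)) (stageCost N c κ θ (t + 1))) := by
  induction k : N - t generalizing t with
  | zero =>
    obtain rfl : t = N := by omega
    have h0 : valueFn t c κ θ t = fun _ _ => 0 := by
      ext y m
      rw [valueFn, dif_neg (lt_irrefl t)]
    rw [h0]
    refine ⟨refinedLsc_const _ _, fun y => ⟨fun p hp q hq a b _ _ hab => ?_, by simp⟩,
      fun h => absurd h (lt_irrefl t)⟩
    have : IsProbabilityMeasure p := hp
    have : IsProbabilityMeasure q := hq
    exact isProbabilityMeasure_convexCombination hab p q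
  | succ k ih =>
    have ht : t < N := by omega
    obtain ⟨ihV, ihc, -⟩ := @ih (t + 1) ht (by omega)
    have hct := hc (t + 1) (by omega) ht
    have hC : RefinedLsc (S (t + 1)) (stageCost N c κ θ (t + 1)) := ihV.lintegral_add hct
    have hCc (y : Path (t + 1)) := convexOn_stageCost (ihc y)
    obtain ⟨hV, hopt⟩ := hC.kernelTransport (Φ := extendKernel (θ t)) (hS t) (hκ t ht)
      (hS (t + 1)) (hκS t ht) hCc
    have heq (y : Path t) (m : Measure ℝ) :=
      valueFn_eq_kernelTransport (κ := κ) (θ := θ) ht hct.measurable ihV.measurable y m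
    refine ⟨hV.congr fun y p => (heq y p).symm, fun y => ?_, fun _ => hopt⟩
    exact (convexOn_kernelTransport hopt hC.measurable hCc y).congr fun m _ => (heq y m).symm

end Paths

/-! ### Regular conditional distributions, tested by integrals. -/

section RegularConditional

variable {Ω α β : Type*} [MeasurableSpace Ω] [MeasurableSpace α] [MeasurableSpace β]
  {P : Measure Ω} {X : Ω → α} {Y : Ω → β} {K : Kernel α β}

theorem IsRegCond.lintegral_eq [IsFiniteMeasure P] [IsMarkovKernel K] (h : IsRegCond P X Y K) (hX : Measurable X)
    (hY : Measurable Y) {f : α × β → ℝ≥0∞} (hf : Measurable f) :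
    ∫⁻ ω, f (X ω, Y ω) ∂P = ∫⁻ ω, ∫⁻ b, f (X ω, b) ∂(K (X ω)) ∂P := by
  have h1 : ∫⁻ z, f z ∂(P.map fun ω => (X ω, Y ω)) = ∫⁻ ω, f (X ω, Y ω) ∂P :=
    lintegral_map hf (hX.prodMk hY)
  rw [← h1, ← h, Measure.lintegral_compProd hf, lintegral_map hf.lintegral_kernel_prod_right' hX]

theorem isRegCond_of_lintegral [IsFiniteMeasure P] [IsMarkovKernel K] (hX : Measurable X) (hY : Measurable Y)
    (h : ∀ f : α × β → ℝ≥0∞, Measurable f →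
      ∫⁻ ω, f (X ω, Y ω) ∂P = ∫⁻ ω, ∫⁻ b, f (X ω, b) ∂(K (X ω)) ∂P) : IsRegCond P X Y K := by
  refine Measure.ext_of_lintegral _ fun f hf => ?_
  rw [lintegral_map hf (hX.prodMk hY), h f hf, Measure.lintegral_compProd hf,
    lintegral_map hf.lintegral_kernel_prod_right' hX]

theorem isRegCond_condDistrib [IsFiniteMeasure P] [StandardBorelSpace β] [Nonempty β] (hY : Measurable Y) :
    IsRegCond P X Y (condDistrib Y X P) :=
  compProd_map_condDistrib hY.aemeasurable

theorem IsRegCond.ae_eq [IsFiniteMeasure P] [MeasurableSpace.CountableOrCountablyGenerated α β] {K' : Kernel α β}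
    [IsMarkovKernel K] [IsMarkovKernel K'] (h : IsRegCond P X Y K) (h' : IsRegCond P X Y K') :
    K =ᵐ[P.map X] K' :=
  Kernel.ae_eq_of_compProd_eq (h.trans h'.symm)

end RegularConditional

section Paths

variable {N : ℕ}

theorem measurable_hist (n : ℕ) (h : n ≤ N) : Measurable (hist n h) :=
  measurable_pi_iff.2 fun _ => measurable_pi_apply _

theorem hist_succ (n : ℕ) (h : n < N) (x : Path N) :
    hist (n + 1) h x = snocPath (hist n h.le x) (x ⟨n, h⟩) := by
  ext i
  refine Fin.lastCases ?_ (fun j => ?_) i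
  · rw [snocPath, Fin.snoc_last]
    rfl
  · rw [snocPath, Fin.snoc_castSucc]
    rfl

theorem hist_snocPath {n : ℕ} (k : ℕ) (h : k ≤ n) (x : Path n) (a : ℝ) :
    hist k (h.trans n.le_succ) (snocPath x a) = hist k h x := by
  ext i
  change snocPath x a (Fin.castSucc (Fin.castLE h i)) = _
  rw [snocPath, Fin.snoc_castSucc]
  rfl

theorem hist_self_apply (x : Path N) : hist N le_rfl x = x := rfl

/-- The last variable of a path; `0` for the empty path. -/
def lastVar : {n : ℕ} → Path n → ℝ
  | 0, _ => 0
  | s + 1, x => x (Fin.last s)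

theorem measurable_lastVar : {n : ℕ} → Measurable (lastVar : Path n → ℝ)
  | 0 => measurable_const
  | s + 1 => measurable_pi_apply (Fin.last s)

theorem lastVar_snocPath {n : ℕ} (x : Path n) (a : ℝ) : lastVar (snocPath x a) = a :=
  Fin.snoc_last (α := fun _ => ℝ) a x

theorem lintegral_extendKernel {n : ℕ} (θ : Kernel (Path n) ℝ) [IsMarkovKernel θ] (y : Path n)
    {f : Path (n + 1) → ℝ≥0∞} (hf : Measurable f) :
    ∫⁻ z, f z ∂(extendKernel θ y) = ∫⁻ a, f (snocPath y a) ∂(θ y) := by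
  rw [extendKernel_apply, lintegral_map hf (measurable_snocPath_left y)]

/-- The kernel acting on the last variable of a path. -/
noncomputable def lastKernel (κ : Kernel ℝ ℝ) (n : ℕ) : Kernel (Path n) ℝ :=
  κ.comap lastVar measurable_lastVar

instance (κ : Kernel ℝ ℝ) [IsMarkovKernel κ] (n : ℕ) : IsMarkovKernel (lastKernel κ n) := by
  unfold lastKernel
  infer_instance

theorem lintegral_hist_succ {ρ : Measure (Path N)} [IsFiniteMeasure ρ] {n : ℕ} (h : n < N)
    {K : Kernel (Path n) ℝ} [IsMarkovKernel K]
    (hK : IsRegCond ρ (hist n h.le) (fun x => x ⟨n, h⟩) K) {f : Path (n + 1) → ℝ≥0∞}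
    (hf : Measurable f) :
    ∫⁻ x, f (hist (n + 1) h x) ∂ρ =
      ∫⁻ x, ∫⁻ a, f (snocPath (hist n h.le x) a) ∂(K (hist n h.le x)) ∂ρ := by
  rw [← hK.lintegral_eq (measurable_hist n h.le) (measurable_pi_apply _)
    (f := fun z => f (snocPath z.1 z.2)) (hf.comp measurable_snocPath)]
  simp_rw [hist_succ n h]

end Paths

/-! ### Causality as conditional independence. -/

section Causality

variable {N : ℕ} {μ ν : Measure (Path N)} {γ : ProbabilityMeasure (Path N × Path N)}

theorem measurable_hist_fst (n : ℕ) (h : n ≤ N) :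
    Measurable fun p : Path N × Path N => hist n h p.1 :=
  (measurable_hist n h).comp measurable_fst

theorem measurable_hist_snd (n : ℕ) (h : n ≤ N) :
    Measurable fun p : Path N × Path N => hist n h p.2 :=
  (measurable_hist n h).comp measurable_snd

theorem isRegCond_condKernel_map_hist (P : Measure (Path N × Path N)) [IsProbabilityMeasure P]
    (n : ℕ) (h : n ≤ N) :
    IsRegCond P Prod.fst (fun p => hist n h p.2) (P.condKernel.map (hist n h)) := by
  have hM := Kernel.IsMarkovKernel.map P.condKernel (measurable_hist (N := N) n h)
  refine isRegCond_of_lintegral measurable_fst (measurable_hist_snd n h) fun f hf => ?_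
  have hf' : Measurable fun z : Path N × Path N => f (z.1, hist n h z.2) :=
    hf.comp (measurable_fst.prodMk (measurable_hist_snd n h))
  rw [← Measure.lintegral_condKernel hf', Measure.fst, lintegral_map
    hf'.lintegral_kernel_prod_right' measurable_fst]
  refine lintegral_congr fun p => ?_
  exact (Kernel.lintegral_map _ (measurable_hist n h) _ (hf.comp measurable_prodMk_left)).symm

/-- The conditional law of the past of `y` given the past of `x`. -/
noncomputable def pastKernel (P : Measure (Path N × Path N)) [IsFiniteMeasure P] (n : ℕ)
    (h : n ≤ N) : Kernel (Path n) (Path n) :=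
  condDistrib (fun p => hist n h p.2) (fun p => hist n h p.1) P

instance (P : Measure (Path N × Path N)) [IsFiniteMeasure P] (n : ℕ) (h : n ≤ N) :
    IsMarkovKernel (pastKernel P n h) := by
  unfold pastKernel
  infer_instance

theorem isRegCond_pastKernel (P : Measure (Path N × Path N)) [IsFiniteMeasure P] (n : ℕ)
    (h : n ≤ N) :
    IsRegCond P (fun p => hist n h p.1) (fun p => hist n h p.2) (pastKernel P n h) :=
  isRegCond_condDistrib (measurable_hist_snd n h)

/-- If the law of the past of `y` given all of `x` is a function of the past of `x`, that function
must be the law given the past of `x`. Causality thus reads: given the past of `x`, the past of `y`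
is independent of the rest of `x`. -/
theorem isRegCond_of_mem_causalPlans (hγ : γ ∈ CausalPlans μ ν) (n : ℕ) (h : n ≤ N) :
    IsRegCond (γ : Measure (Path N × Path N)) Prod.fst (fun p => hist n h p.2)
      ((pastKernel (γ : Measure (Path N × Path N)) n h).comap (hist n h) (measurable_hist n h)) := by
  obtain ⟨⟨hfst, -⟩, hcaus⟩ := hγ
  set P : Measure (Path N × Path N) := (γ : Measure (Path N × Path N))
  have hmap := Kernel.IsMarkovKernel.map P.condKernel (measurable_hist (N := N) n h)
  set L := pastKernel P n h with hL
  have hx := measurable_hist_fst (N := N) n h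
  have hy := measurable_hist_snd (N := N) n h
  refine Measure.ext_prod fun {A B} hA hB => ?_
  obtain ⟨g, hg, hgae⟩ := hcaus n h B hB
  have hgae' : ∀ᵐ p ∂P, P.condKernel.map (hist n h) p.1 B = g (hist n h p.1) := by
    rw [← hfst] at hgae
    filter_upwards [ae_of_ae_map measurable_fst.aemeasurable hgae] with p hp
    rw [Kernel.map_apply' _ (measurable_hist n h) _ hB, hp]
  have key (A : Set (Path N)) (hA : MeasurableSet A) :
      P (Prod.fst ⁻¹' A ∩ (fun p => hist n h p.2) ⁻¹' B) =
        ∫⁻ p, A.indicator 1 p.1 * g (hist n h p.1) ∂P := by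
    have h1 := (isRegCond_condKernel_map_hist P n h)
    have h2 := congrArg (fun ρ => ρ (A ×ˢ B)) h1
    simp only at h2
    rw [Measure.map_apply (measurable_fst.prodMk hy) (hA.prod hB)] at h2
    change _ = P (Prod.fst ⁻¹' A ∩ (fun p => hist n h p.2) ⁻¹' B) at h2
    rw [← h2, Measure.compProd_apply_prod hA hB, ← lintegral_indicator hA, lintegral_map
      ((Kernel.measurable_coe _ hB).indicator hA) measurable_fst]
    refine lintegral_congr_ae ?_
    filter_upwards [hgae'] with p hp
    by_cases hpA : p.1 ∈ A <;> simp [hpA, hp]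
  -- Testing `key` on events of the past of `x` identifies `g` with the conditional probability.
  have hgL : g =ᵐ[P.map fun p => hist n h p.1] fun x => L x B := by
    refine ae_eq_of_forall_setLIntegral_eq_of_sigmaFinite hg (Kernel.measurable_coe L hB)
      fun D hD _ => ?_
    have h2 := congrArg (fun ρ => ρ (D ×ˢ B)) (isRegCond_pastKernel P n h)
    simp only at h2
    rw [Measure.map_apply (hx.prodMk hy) (hD.prod hB), Measure.compProd_apply_prod hD hB] at h2
    rw [← hL] at h2
    rw [h2]
    change _ = P (Prod.fst ⁻¹' (hist n h ⁻¹' D) ∩ (fun p => hist n h p.2) ⁻¹' B)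
    rw [key _ (measurable_hist n h hD), ← lintegral_indicator hD, lintegral_map
      (hg.indicator hD) hx]
    refine lintegral_congr fun p => ?_
    by_cases hpD : hist n h p.1 ∈ D <;> simp [hpD]
  rw [Measure.map_apply (measurable_fst.prodMk hy) (hA.prod hB)]
  change _ = P (Prod.fst ⁻¹' A ∩ (fun p => hist n h p.2) ⁻¹' B)
  rw [key A hA, Measure.compProd_apply_prod hA hB, ← lintegral_indicator hA, lintegral_map
      ((Kernel.measurable_coe _ hB).indicator hA) measurable_fst]
  refine lintegral_congr_ae ?_
  filter_upwards [ae_of_ae_map hx.aemeasurable hgL] with p hp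
  by_cases hpA : p.1 ∈ A <;> simp [hpA, hp, Kernel.comap_apply]

theorem mem_causalPlans_of_isRegCond (hγ : γ ∈ Couplings μ ν)
    (hreg : ∀ (n : ℕ) (h : n ≤ N), IsRegCond (γ : Measure (Path N × Path N)) Prod.fst
      (fun p => hist n h p.2) ((pastKernel (γ : Measure (Path N × Path N)) n h).comap (hist n h)
        (measurable_hist n h))) : γ ∈ CausalPlans μ ν := by
  refine ⟨hγ, fun n h B hB => ⟨fun x => pastKernel (γ : Measure (Path N × Path N)) n h x B,
    Kernel.measurable_coe _ hB, ?_⟩⟩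
  have hmap := Kernel.IsMarkovKernel.map (γ : Measure (Path N × Path N)).condKernel
    (measurable_hist (N := N) n h)
  have hae := (isRegCond_condKernel_map_hist (γ : Measure (Path N × Path N)) n h).ae_eq (hreg n h)
  have hfst : (γ : Measure (Path N × Path N)).map Prod.fst = μ := hγ.1
  rw [hfst] at hae
  filter_upwards [hae] with x hx
  rw [← Kernel.map_apply' _ (measurable_hist n h) _ hB, hx, Kernel.comap_apply]

end Causality

/-! ### Construction of a plan from a flow. -/

section Construction

theorem measurable_hist_prod {N : ℕ} (n : ℕ) (h : n ≤ N) :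
    Measurable fun p : Path N × Path N => (hist n h p.1, hist n h p.2) :=
  (measurable_hist_fst n h).prodMk (measurable_hist_snd n h)

theorem measurable_apply_prod {N : ℕ} (i : Fin N) :
    Measurable fun p : Path N × Path N => (p.1 i, p.2 i) :=
  ((measurable_pi_apply i).comp measurable_fst).prodMk ((measurable_pi_apply i).comp measurable_snd)

/-- A law on pairs of paths with prescribed successive conditional distributions. -/
theorem exists_measure_isRegCond (K : (n : ℕ) → Kernel (Path n × Path n) (ℝ × ℝ))
    [∀ n, IsMarkovKernel (K n)] (N : ℕ) :
    ∃ G : Measure (Path N × Path N), IsProbabilityMeasure G ∧ ∀ (n : ℕ) (h : n < N),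
      IsRegCond G (fun p => (hist n h.le p.1, hist n h.le p.2))
        (fun p => (p.1 ⟨n, h⟩, p.2 ⟨n, h⟩)) (K n) := by
  induction N with
  | zero => exact ⟨Measure.dirac default, inferInstance, fun n h => absurd h (Nat.not_lt_zero n)⟩
  | succ N ih =>
    obtain ⟨G, hG, hreg⟩ := ih
    let Ψ : (Path N × Path N) × (ℝ × ℝ) → Path (N + 1) × Path (N + 1) :=
      fun z => (snocPath z.1.1 z.2.1, snocPath z.1.2 z.2.2)
    have hΨ : Measurable Ψ := by
      refine Measurable.prodMk ?_ ?_
      · exact measurable_snocPath.comp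
          ((measurable_fst.comp measurable_fst).prodMk (measurable_fst.comp measurable_snd))
      · exact measurable_snocPath.comp
          ((measurable_snd.comp measurable_fst).prodMk (measurable_snd.comp measurable_snd))
    have hG' : IsProbabilityMeasure ((G ⊗ₘ K N).map Ψ) :=
      Measure.isProbabilityMeasure_map hΨ.aemeasurable
    have hint {f : Path (N + 1) × Path (N + 1) → ℝ≥0∞} (hf : Measurable f) :
        ∫⁻ p, f p ∂((G ⊗ₘ K N).map Ψ) = ∫⁻ p, ∫⁻ z, f (Ψ (p, z)) ∂(K N p) ∂G := by
      rw [lintegral_map hf hΨ, Measure.lintegral_compProd (f := fun z => f (Ψ z)) (hf.comp hΨ)]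
    refine ⟨_, hG', fun n h => ?_⟩
    refine isRegCond_of_lintegral (measurable_hist_prod n h.le) (measurable_apply_prod _)
      fun f hf => ?_
    rw [hint (f := fun p => f ((hist n h.le p.1, hist n h.le p.2), (p.1 ⟨n, h⟩, p.2 ⟨n, h⟩)))
      (hf.comp ((measurable_hist_prod n h.le).prodMk (measurable_apply_prod _))),
      hint (f := fun p => ∫⁻ b, f ((hist n h.le p.1, hist n h.le p.2), b)
        ∂(K n (hist n h.le p.1, hist n h.le p.2)))
        ((hf.lintegral_kernel_prod_right' (κ := K n)).comp (measurable_hist_prod n h.le))]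
    rcases Nat.lt_succ_iff_lt_or_eq.1 h with hn | rfl
    · have h1 (x : Path N) (a : ℝ) : hist n h.le (snocPath x a) = hist n hn.le x :=
        hist_snocPath n hn.le x a
      have h2 (x : Path N) (a : ℝ) : snocPath x a ⟨n, h⟩ = x ⟨n, hn⟩ :=
        Fin.snoc_castSucc (α := fun _ => ℝ) a x ⟨n, hn⟩
      simp only [Ψ, h1, h2, lintegral_const, measure_univ, mul_one]
      exact (hreg n hn).lintegral_eq (measurable_hist_prod n hn.le) (measurable_apply_prod _) hf
    · have h1 (x : Path n) (a : ℝ) : hist n h.le (snocPath x a) = x := hist_snocPath n le_rfl x a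
      have h2 (x : Path n) (a : ℝ) : snocPath x a ⟨n, h⟩ = a :=
        Fin.snoc_last (α := fun _ => ℝ) a x
      simp only [Ψ, h1, h2, lintegral_const, measure_univ, mul_one]

variable (κ : ℕ → Kernel ℝ ℝ) (θ : (n : ℕ) → Kernel (Path n) ℝ) (m : (n : ℕ) → Kernel (Path n) ℝ)
  [∀ n, IsMarkovKernel (κ n)] [∀ n, IsMarkovKernel (θ n)] [∀ n, IsMarkovKernel (m n)]

/-- The law of the next pair `(x', y')` given the past of `y`, when `m n` is the conditional law of
the current value of `x` given the past of `y`. -/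
noncomputable def pairKernel (n : ℕ) : Kernel (Path n) (ℝ × ℝ) :=
  (θ n ⊗ₖ (m (n + 1)).comap (fun z : Path n × ℝ => snocPath z.1 z.2) measurable_snocPath).map
    Prod.swap

instance (n : ℕ) : IsMarkovKernel (pairKernel θ m n) :=
  Kernel.IsMarkovKernel.map _ measurable_swap

theorem lintegral_pairKernel (n : ℕ) (y : Path n) {f : ℝ × ℝ → ℝ≥0∞} (hf : Measurable f) :
    ∫⁻ z, f z ∂(pairKernel θ m n y) =
      ∫⁻ b, ∫⁻ a, f (a, b) ∂(m (n + 1) (snocPath y b)) ∂(θ n y) := by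
  rw [pairKernel, Kernel.lintegral_map _ measurable_swap _ hf,
    Kernel.lintegral_compProd _ _ _ (f := fun z => f z.swap) (hf.comp measurable_swap)]
  rfl

/-- The law of the next pair `(x', y')` given the current value of `x` and the past of `y`. -/
noncomputable def nextKernel (n : ℕ) : Kernel (ℝ × Path n) (ℝ × ℝ) :=
  (κ n).comap Prod.fst measurable_fst ⊗ₖ (pairKernel θ m n).condKernel.comap
    (fun z : (ℝ × Path n) × ℝ => (z.1.2, z.2))
    ((measurable_snd.comp measurable_fst).prodMk measurable_snd)

instance (n : ℕ) : IsMarkovKernel (nextKernel κ θ m n) := by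
  unfold nextKernel
  infer_instance

theorem lintegral_nextKernel (n : ℕ) (z : ℝ × Path n) {f : ℝ × ℝ → ℝ≥0∞} (hf : Measurable f) :
    ∫⁻ p, f p ∂(nextKernel κ θ m n z) =
      ∫⁻ a, ∫⁻ b, f (a, b) ∂((pairKernel θ m n).condKernel (z.2, a)) ∂(κ n z.1) := by
  rw [nextKernel, Kernel.lintegral_compProd _ _ _ hf]
  rfl

theorem lintegral_nextKernel_fst (n : ℕ) (z : ℝ × Path n) {f : ℝ → ℝ≥0∞} (hf : Measurable f) :
    ∫⁻ p, f p.1 ∂(nextKernel κ θ m n z) = ∫⁻ a, f a ∂(κ n z.1) := by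
  rw [lintegral_nextKernel κ θ m n z (f := fun p => f p.1) (hf.comp measurable_fst)]
  simp

/-- The flow equation says that the first marginal of `pairKernel` is `m_n κ_n`. Drawing `x'` by `κ`
and then `y'` by the conditional law therefore reproduces the pair law. -/
theorem lintegral_nextKernel_of_bind_eq {n : ℕ} {y : Path n}
    (hflow : (extendKernel (θ n) y).bind (m (n + 1)) = (m n y).bind (κ n)) {f : ℝ × ℝ → ℝ≥0∞}
    (hf : Measurable f) :
    ∫⁻ a, ∫⁻ p, f p ∂(nextKernel κ θ m n (a, y)) ∂(m n y) =
      ∫⁻ b, ∫⁻ a, f (a, b) ∂(m (n + 1) (snocPath y b)) ∂(θ n y) := by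
  have hfst : (pairKernel θ m n).fst y = (m n y).bind (κ n) := by
    rw [← hflow]
    refine Measure.ext_of_lintegral _ fun g hg => ?_
    rw [Kernel.fst_apply, lintegral_map hg measurable_fst,
      lintegral_pairKernel θ m n y (f := fun p => g p.1) (hg.comp measurable_fst),
      Measure.lintegral_bind (Kernel.measurable _).aemeasurable hg.aemeasurable,
      lintegral_extendKernel _ _ hg.lintegral_kernel]
  have hg : Measurable fun a => ∫⁻ b, f (a, b) ∂((pairKernel θ m n).condKernel (y, a)) :=
    hf.lintegral_kernel_prod_right' (κ := (pairKernel θ m n).condKernel.sectR y)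
  simp only [lintegral_nextKernel κ θ m n _ hf]
  rw [← lintegral_pairKernel θ m n y hf,
    ← Measure.lintegral_bind (Kernel.measurable _).aemeasurable hg.aemeasurable, ← hfst]
  conv_rhs => rw [← Kernel.disintegrate (pairKernel θ m n) (pairKernel θ m n).condKernel]
  rw [Kernel.lintegral_compProd _ _ _ hf]

end Construction

/-! ### Marginals, causality and the quasi-Markov property of the constructed plan. -/

section PlanOfFlow

variable {N : ℕ} {μ ν : Measure (Path N)} [IsProbabilityMeasure μ] [IsProbabilityMeasure ν]
  {κ : ℕ → Kernel ℝ ℝ} {θ : (n : ℕ) → Kernel (Path n) ℝ} {m : (n : ℕ) → Kernel (Path n) ℝ}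
  [∀ n, IsMarkovKernel (κ n)] [∀ n, IsMarkovKernel (θ n)] [∀ n, IsMarkovKernel (m n)]

/-- The plan `G` has the conditional distributions `nextKernel κ θ m`. -/
def HasNextKernel (κ : ℕ → Kernel ℝ ℝ) (θ : (n : ℕ) → Kernel (Path n) ℝ)
    (m : (n : ℕ) → Kernel (Path n) ℝ) [∀ n, IsMarkovKernel (κ n)] [∀ n, IsMarkovKernel (θ n)]
    [∀ n, IsMarkovKernel (m n)] (G : Measure (Path N × Path N)) : Prop :=
  ∀ (n : ℕ) (h : n < N), IsRegCond G (fun p => (hist n h.le p.1, hist n h.le p.2))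
    (fun p => (p.1 ⟨n, h⟩, p.2 ⟨n, h⟩)) ((nextKernel κ θ m n).comap
      (fun z : Path n × Path n => (lastVar z.1, z.2))
      ((measurable_lastVar.comp measurable_fst).prodMk measurable_snd))

variable {G : Measure (Path N × Path N)} [IsProbabilityMeasure G] (hG : HasNextKernel κ θ m G)
include hG

theorem HasNextKernel.lintegral_eq {n : ℕ} (h : n < N)
    {f : (Path n × Path n) × (ℝ × ℝ) → ℝ≥0∞} (hf : Measurable f) :
    ∫⁻ p, f ((hist n h.le p.1, hist n h.le p.2), (p.1 ⟨n, h⟩, p.2 ⟨n, h⟩)) ∂G =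
      ∫⁻ p, ∫⁻ b, f ((hist n h.le p.1, hist n h.le p.2), b)
        ∂(nextKernel κ θ m n (lastVar (hist n h.le p.1), hist n h.le p.2)) ∂G :=
  (hG n h).lintegral_eq (measurable_hist_prod n h.le) (measurable_apply_prod _) hf

theorem HasNextKernel.lintegral_fst_eq {n : ℕ} (h : n < N)
    {f : (Path n × Path n) × ℝ → ℝ≥0∞} (hf : Measurable f) :
    ∫⁻ p, f ((hist n h.le p.1, hist n h.le p.2), p.1 ⟨n, h⟩) ∂G =
      ∫⁻ p, ∫⁻ a, f ((hist n h.le p.1, hist n h.le p.2), a)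
        ∂(κ n (lastVar (hist n h.le p.1))) ∂G := by
  rw [hG.lintegral_eq h (f := fun z => f (z.1, z.2.1))
    (hf.comp (measurable_fst.prodMk (measurable_fst.comp measurable_snd)))]
  refine lintegral_congr fun p => ?_
  exact lintegral_nextKernel_fst κ θ m n _ (hf.comp measurable_prodMk_left)

theorem HasNextKernel.lintegral_hist_fst
    (hμ : ∀ (n : ℕ) (h : n < N),
      IsRegCond μ (hist n h.le) (fun x => x ⟨n, h⟩) (lastKernel (κ n) n))
    {n : ℕ} (h : n ≤ N) {f : Path n → ℝ≥0∞} (hf : Measurable f) :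
    ∫⁻ p, f (hist n h p.1) ∂G = ∫⁻ x, f (hist n h x) ∂μ := by
  induction n with
  | zero =>
    have h0 (x : Path N) : hist 0 h x = default := Subsingleton.elim _ _
    simp [h0]
  | succ n ih =>
    rw [lintegral_hist_succ h (hμ n h) hf]
    simp only [hist_succ n h]
    rw [hG.lintegral_fst_eq h (f := fun z => f (snocPath z.1.1 z.2)) (hf.comp
      (measurable_snocPath.comp ((measurable_fst.comp measurable_fst).prodMk measurable_snd)))]
    exact ih (Nat.le_of_succ_le h)
      (f := fun x => ∫⁻ a, f (snocPath x a) ∂(lastKernel (κ n) n x))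
      (hf.comp measurable_snocPath).lintegral_kernel_prod_right'

/-- The invariant of the construction: `y` has the right law and `m n` is the conditional law of
`x_n` given `y^n`. It yields both the second marginal and the cost of the plan. At `n = 0` the
convention `lastVar = 0` matches the Dirac mass at `0`. -/
theorem HasNextKernel.lintegral_hist_snd
    (hν : ∀ (n : ℕ) (h : n < N), IsRegCond ν (hist n h.le) (fun y => y ⟨n, h⟩) (θ n))
    (hm0 : ∀ y, m 0 y = Measure.dirac 0)
    (hflow : ∀ n < N, ∀ y, (extendKernel (θ n) y).bind (m (n + 1)) = (m n y).bind (κ n))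
    {n : ℕ} (h : n ≤ N) {f : Path n × ℝ → ℝ≥0∞} (hf : Measurable f) :
    ∫⁻ p, f (hist n h p.2, lastVar (hist n h p.1)) ∂G =
      ∫⁻ y, ∫⁻ a, f (hist n h y, a) ∂(m n (hist n h y)) ∂ν := by
  induction n with
  | zero =>
    have h0 (x : Path N) : hist 0 h x = default := Subsingleton.elim _ _
    simp only [h0, hm0]
    rw [lintegral_dirac' (f := fun a => f (default, a)) _ (hf.comp measurable_prodMk_left)]
    simp [lastVar]
  | succ n ih =>
    rw [lintegral_hist_succ h (hν n h) (f := fun y => ∫⁻ a, f (y, a) ∂(m (n + 1) y))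
      hf.lintegral_kernel_prod_right']
    simp only [hist_succ n h, lastVar_snocPath]
    have hf' : Measurable fun z : Path n × (ℝ × ℝ) => f (snocPath z.1 z.2.2, z.2.1) :=
      hf.comp ((measurable_snocPath.comp (measurable_fst.prodMk
        (measurable_snd.comp measurable_snd))).prodMk (measurable_fst.comp measurable_snd))
    rw [hG.lintegral_eq h (f := fun z => f (snocPath z.1.2 z.2.2, z.2.1))
      (hf'.comp ((measurable_snd.comp measurable_fst).prodMk measurable_snd))]
    have hint : Measurable fun z : Path n × ℝ =>
        ∫⁻ p, f (snocPath z.1 p.2, p.1) ∂(nextKernel κ θ m n (z.2, z.1)) :=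
      Measurable.lintegral_kernel_prod_right' (κ := (nextKernel κ θ m n).comap Prod.swap
        measurable_swap) (f := fun w : (Path n × ℝ) × (ℝ × ℝ) => f (snocPath w.1.1 w.2.2, w.2.1))
        (hf'.comp ((measurable_fst.comp measurable_fst).prodMk measurable_snd))
    refine (ih (Nat.le_of_succ_le h) hint).trans (lintegral_congr fun y => ?_)
    exact lintegral_nextKernel_of_bind_eq κ θ m (hflow n h _)
      (f := fun p => f (snocPath (hist n (Nat.le_of_succ_le h) y) p.2, p.1))
      (hf'.comp measurable_prodMk_left)

/-- Given both pasts, the next value of `x` is drawn from `κ` at the current value of `x`. Revealing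
later values of `x` one at a time hence brings no information on the past of `y`; the inductive step
is Tonelli's theorem. -/
theorem HasNextKernel.isRegCond_pastKernel (n : ℕ) (h : n ≤ N) :
    IsRegCond G Prod.fst (fun p => hist n h p.2)
      ((pastKernel G n h).comap (hist n h) (measurable_hist n h)) := by
  set L := pastKernel G n h with hL
  have key (k : ℕ) (hk : k ≤ N) (hnk : n ≤ k) {f : Path k × Path n → ℝ≥0∞} (hf : Measurable f) :
      ∫⁻ p, f (hist k hk p.1, hist n h p.2) ∂G =
        ∫⁻ p, ∫⁻ b, f (hist k hk p.1, b) ∂(L (hist n h p.1)) ∂G := by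
    induction k, hnk using Nat.le_induction with
    | base =>
      exact (CausalDPP.isRegCond_pastKernel G n h).lintegral_eq (measurable_hist_fst n h)
        (measurable_hist_snd n h) hf
    | succ k hnk ih =>
      have hk' : k ≤ N := Nat.le_of_succ_le hk
      have hs : Measurable fun w : (Path k × Path n) × ℝ => f (snocPath w.1.1 w.2, w.1.2) :=
        hf.comp ((measurable_snocPath.comp ((measurable_fst.comp measurable_fst).prodMk
          measurable_snd)).prodMk (measurable_snd.comp measurable_fst))
      have hf' : Measurable fun z : Path k × Path n =>
          ∫⁻ a, f (snocPath z.1 a, z.2) ∂(κ k (lastVar z.1)) :=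
        Measurable.lintegral_kernel_prod_right' (κ := (lastKernel (κ k) k).comap Prod.fst
          measurable_fst) hs
      have hL' : Measurable fun w : Path k × ℝ =>
          ∫⁻ b, f (snocPath w.1 w.2, b) ∂(L (hist n hnk w.1)) :=
        Measurable.lintegral_kernel_prod_right' (κ := L.comap (fun w : Path k × ℝ => hist n hnk w.1)
          ((measurable_hist n hnk).comp measurable_fst))
          (f := fun v : (Path k × ℝ) × Path n => f (snocPath v.1.1 v.1.2, v.2))
          (hf.comp ((measurable_snocPath.comp measurable_fst).prodMk measurable_snd))
      simp only [hist_succ k hk]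
      calc ∫⁻ p, f (snocPath (hist k hk' p.1) (p.1 ⟨k, hk⟩), hist n h p.2) ∂G
          = ∫⁻ p, ∫⁻ a, f (snocPath (hist k hk' p.1) a, hist n h p.2)
              ∂(κ k (lastVar (hist k hk' p.1))) ∂G :=
            hG.lintegral_fst_eq hk (f := fun w => f (snocPath w.1.1 w.2, hist n hnk w.1.2))
              (hs.comp (((measurable_fst.comp measurable_fst).prodMk ((measurable_hist n hnk).comp
                (measurable_snd.comp measurable_fst))).prodMk measurable_snd))
        _ = ∫⁻ p, ∫⁻ b, ∫⁻ a, f (snocPath (hist k hk' p.1) a, b)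
              ∂(κ k (lastVar (hist k hk' p.1))) ∂(L (hist n h p.1)) ∂G := ih hk' hf'
        _ = ∫⁻ p, ∫⁻ a, ∫⁻ b, f (snocPath (hist k hk' p.1) a, b)
              ∂(L (hist n h p.1)) ∂(κ k (lastVar (hist k hk' p.1))) ∂G := by
            refine lintegral_congr fun p => lintegral_lintegral_swap ?_
            exact (hs.comp ((measurable_const.prodMk measurable_fst).prodMk
              measurable_snd)).aemeasurable
        _ = _ := (hG.lintegral_fst_eq hk (f := fun w => ∫⁻ b, f (snocPath w.1.1 w.2, b)
              ∂(L (hist n hnk w.1.1)))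
              (hL'.comp ((measurable_fst.comp measurable_fst).prodMk measurable_snd))).symm
  exact isRegCond_of_lintegral measurable_fst (measurable_hist_snd n h) fun f hf =>
    key N le_rfl h hf

theorem HasNextKernel.isQuasiMarkov {γ : ProbabilityMeasure (Path N × Path N)}
    (hγ : (γ : Measure (Path N × Path N)) = G) : IsQuasiMarkov γ := by
  intro s h
  subst hγ
  have hY : Measurable fun p : Path N × Path N => (p.1 ⟨s + 1, h⟩, p.2 ⟨s + 1, h⟩) :=
    measurable_apply_prod _
  have hX := measurable_hist_prod (N := N) (s + 1) h.le
  have hX' : Measurable fun p : Path N × Path N =>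
      (p.1 ⟨s, Nat.lt_of_succ_lt h⟩, hist (s + 1) h.le p.2) :=
    ((measurable_pi_apply _).comp measurable_fst).prodMk (measurable_hist_snd _ h.le)
  have h1 := (isRegCond_condDistrib (P := (γ : Measure (Path N × Path N))) (X := fun p : Path N × Path N =>
    (hist (s + 1) h.le p.1, hist (s + 1) h.le p.2)) hY).ae_eq (hG (s + 1) h)
  have hreg : IsRegCond (γ : Measure (Path N × Path N)) (fun p : Path N × Path N =>
      (p.1 ⟨s, Nat.lt_of_succ_lt h⟩, hist (s + 1) h.le p.2))
      (fun p => (p.1 ⟨s + 1, h⟩, p.2 ⟨s + 1, h⟩)) (nextKernel κ θ m (s + 1)) := by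
    refine isRegCond_of_lintegral hX' hY fun f hf => ?_
    exact hG.lintegral_eq h (f := fun z => f ((lastVar z.1.1, z.1.2), z.2))
      (hf.comp (((measurable_lastVar.comp (measurable_fst.comp measurable_fst)).prodMk
        (measurable_snd.comp measurable_fst)).prodMk measurable_snd))
  have h2 := (isRegCond_condDistrib (P := (γ : Measure (Path N × Path N))) (X := fun p : Path N × Path N =>
    (p.1 ⟨s, Nat.lt_of_succ_lt h⟩, hist (s + 1) h.le p.2)) hY).ae_eq hreg
  filter_upwards [ae_of_ae_map hX.aemeasurable h1, ae_of_ae_map hX'.aemeasurable h2] with p hp hp'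
  rw [hp, hp']
  rfl

end PlanOfFlow

/-! ### The flow of a causal plan. -/

section CausalFlow

variable {N : ℕ} {μ ν : Measure (Path N)} {κ : ℕ → Kernel ℝ ℝ} {θ : (n : ℕ) → Kernel (Path n) ℝ}
  [∀ n, IsMarkovKernel (κ n)] [∀ n, IsMarkovKernel (θ n)]
  {γ : ProbabilityMeasure (Path N × Path N)}

theorem lintegral_fst_of_mem_couplings (hγ : γ ∈ Couplings μ ν) {f : Path N → ℝ≥0∞}
    (hf : Measurable f) : ∫⁻ p, f p.1 ∂(γ : Measure (Path N × Path N)) = ∫⁻ x, f x ∂μ := by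
  rw [← hγ.1, Measure.fst, lintegral_map hf measurable_fst]

theorem lintegral_snd_of_mem_couplings (hγ : γ ∈ Couplings μ ν) {f : Path N → ℝ≥0∞}
    (hf : Measurable f) : ∫⁻ p, f p.2 ∂(γ : Measure (Path N × Path N)) = ∫⁻ x, f x ∂ν := by
  rw [← hγ.2, Measure.snd, lintegral_map hf measurable_snd]

/-- Under a causal plan, the next value of `x` depends on the pasts of `x` and `y` through the
current value of `x` only. -/
theorem lintegral_next_of_mem_causalPlans [IsProbabilityMeasure μ] (hγ : γ ∈ CausalPlans μ ν)
    {n : ℕ} (h : n < N)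
    (hμ : IsRegCond μ (hist n h.le) (fun x => x ⟨n, h⟩) (lastKernel (κ n) n))
    {f : (Path n × Path n) × ℝ → ℝ≥0∞} (hf : Measurable f) :
    ∫⁻ p, f ((hist n h.le p.1, hist n h.le p.2), p.1 ⟨n, h⟩) ∂(γ : Measure (Path N × Path N)) =
      ∫⁻ p, ∫⁻ a, f ((hist n h.le p.1, hist n h.le p.2), a) ∂(κ n (lastVar (hist n h.le p.1)))
        ∂(γ : Measure (Path N × Path N)) := by
  have hL := isRegCond_of_mem_causalPlans hγ n h.le
  set L := pastKernel (γ : Measure (Path N × Path N)) n h.le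
  have hh := measurable_hist (N := N) n h.le
  have hg : Measurable fun z : Path n × ℝ => ∫⁻ b, f ((z.1, b), z.2) ∂(L z.1) :=
    Measurable.lintegral_kernel_prod_right' (κ := L.comap Prod.fst measurable_fst)
      (f := fun w : (Path n × ℝ) × Path n => f ((w.1.1, w.2), w.1.2))
      (hf.comp (((measurable_fst.comp measurable_fst).prodMk measurable_snd).prodMk
        (measurable_snd.comp measurable_fst)))
  have hk : Measurable fun z : Path n × Path n =>
      ∫⁻ a, f (z, a) ∂(κ n (lastVar z.1)) :=
    Measurable.lintegral_kernel_prod_right' (κ := (lastKernel (κ n) n).comap Prod.fst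
      measurable_fst) hf
  have hkL : Measurable fun x : Path n => ∫⁻ b, ∫⁻ a, f ((x, b), a) ∂(κ n (lastVar x)) ∂(L x) :=
    hk.lintegral_kernel_prod_right'
  -- Causality integrates out the past of `y` given `x`, leaving an integral over `μ`. There the
  -- Markov property replaces the next value of `x`; after interchanging the integrals, causality
  -- restores the past of `y`.
  calc ∫⁻ p, f ((hist n h.le p.1, hist n h.le p.2), p.1 ⟨n, h⟩) ∂(γ : Measure (Path N × Path N))
      = ∫⁻ p, ∫⁻ b, f ((hist n h.le p.1, b), p.1 ⟨n, h⟩) ∂(L (hist n h.le p.1))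
          ∂(γ : Measure (Path N × Path N)) :=
        hL.lintegral_eq measurable_fst (measurable_hist_snd n h.le)
          (f := fun z => f ((hist n h.le z.1, z.2), z.1 ⟨n, h⟩))
          (hf.comp (((hh.comp measurable_fst).prodMk measurable_snd).prodMk
            ((measurable_pi_apply _).comp measurable_fst)))
    _ = ∫⁻ x, ∫⁻ b, f ((hist n h.le x, b), x ⟨n, h⟩) ∂(L (hist n h.le x)) ∂μ :=
        lintegral_fst_of_mem_couplings hγ.1 (hg.comp (hh.prodMk (measurable_pi_apply _)))
    _ = ∫⁻ x, ∫⁻ a, ∫⁻ b, f ((hist n h.le x, b), a) ∂(L (hist n h.le x))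
          ∂(κ n (lastVar (hist n h.le x))) ∂μ :=
        hμ.lintegral_eq hh (measurable_pi_apply _) hg
    _ = ∫⁻ x, ∫⁻ b, ∫⁻ a, f ((hist n h.le x, b), a) ∂(κ n (lastVar (hist n h.le x)))
          ∂(L (hist n h.le x)) ∂μ := by
        refine lintegral_congr fun x => lintegral_lintegral_swap ?_
        exact (hf.comp ((measurable_const.prodMk measurable_snd).prodMk
          measurable_fst)).aemeasurable
    _ = ∫⁻ p, ∫⁻ b, ∫⁻ a, f ((hist n h.le p.1, b), a) ∂(κ n (lastVar (hist n h.le p.1)))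
          ∂(L (hist n h.le p.1)) ∂(γ : Measure (Path N × Path N)) :=
        (lintegral_fst_of_mem_couplings hγ.1 (hkL.comp hh)).symm
    _ = _ := (hL.lintegral_eq measurable_fst (measurable_hist_snd n h.le)
          (f := fun z => ∫⁻ a, f ((hist n h.le z.1, z.2), a) ∂(κ n (lastVar (hist n h.le z.1))))
          (hk.comp ((hh.comp measurable_fst).prodMk measurable_snd))).symm

/-- The conditional laws of the current value of `x` given the past of `y` under a causal plan. -/
theorem ae_bind_eq_of_mem_causalPlans [IsProbabilityMeasure μ] [IsProbabilityMeasure ν]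
    (hγ : γ ∈ CausalPlans μ ν) {n : ℕ} (h : n < N)
    (hμ : IsRegCond μ (hist n h.le) (fun x => x ⟨n, h⟩) (lastKernel (κ n) n))
    (hν : IsRegCond ν (hist n h.le) (fun y => y ⟨n, h⟩) (θ n))
    {m : Kernel (Path n) ℝ} {m' : Kernel (Path (n + 1)) ℝ} [IsMarkovKernel m] [IsMarkovKernel m']
    (hm : IsRegCond (γ : Measure (Path N × Path N)) (fun p => hist n h.le p.2)
      (fun p => lastVar (hist n h.le p.1)) m)
    (hm' : IsRegCond (γ : Measure (Path N × Path N)) (fun p => hist (n + 1) h p.2)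
      (fun p => p.1 ⟨n, h⟩) m') :
    ∀ᵐ y ∂ν, (extendKernel (θ n) (hist n h.le y)).bind m' = (m (hist n h.le y)).bind (κ n) := by
  have hY := measurable_hist_snd (N := N) n h.le
  have hh := measurable_hist (N := N) n h.le
  have hX : Measurable fun p : Path N × Path N => p.1 ⟨n, h⟩ :=
    (measurable_pi_apply _).comp measurable_fst
  -- The law of the next value of `x` given the past of `y` is computed twice: by conditioning first
  -- on one more value of `y`, and by conditioning first on the current value of `x`. Almost sure
  -- uniqueness gives the flow equation.
  have h1 : IsRegCond (γ : Measure (Path N × Path N)) (fun p => hist n h.le p.2)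
      (fun p => p.1 ⟨n, h⟩) (m' ∘ₖ extendKernel (θ n)) := by
    refine isRegCond_of_lintegral hY hX fun f hf => ?_
    have hg : Measurable fun y : Path (n + 1) => ∫⁻ a, f (hist n n.le_succ y, a) ∂(m' y) :=
      Measurable.lintegral_kernel_prod_right' (κ := m')
        (f := fun z : Path (n + 1) × ℝ => f (hist n n.le_succ z.1, z.2))
        (hf.comp (((measurable_hist n n.le_succ).comp measurable_fst).prodMk measurable_snd))
    have hJ : Measurable fun y : Path n => ∫⁻ a, f (y, a) ∂((m' ∘ₖ extendKernel (θ n)) y) :=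
      hf.lintegral_kernel_prod_right'
    calc ∫⁻ p, f (hist n h.le p.2, p.1 ⟨n, h⟩) ∂(γ : Measure (Path N × Path N))
        = ∫⁻ p, ∫⁻ a, f (hist n h.le p.2, a) ∂(m' (hist (n + 1) h p.2))
            ∂(γ : Measure (Path N × Path N)) :=
          hm'.lintegral_eq (measurable_hist_snd (n + 1) h) hX
            (f := fun z => f (hist n n.le_succ z.1, z.2))
            (hf.comp (((measurable_hist n n.le_succ).comp measurable_fst).prodMk measurable_snd))
      _ = ∫⁻ y, ∫⁻ a, f (hist n h.le y, a) ∂(m' (hist (n + 1) h y)) ∂ν :=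
          lintegral_snd_of_mem_couplings hγ.1 (hg.comp (measurable_hist (n + 1) h))
      _ = ∫⁻ y, ∫⁻ a, f (hist n h.le y, a) ∂((m' ∘ₖ extendKernel (θ n)) (hist n h.le y)) ∂ν := by
          refine (lintegral_hist_succ h hν hg).trans (lintegral_congr fun y => ?_)
          have hfy : Measurable fun a => f (hist n h.le y, a) := hf.comp measurable_prodMk_left
          rw [Kernel.lintegral_comp _ _ _ hfy, lintegral_extendKernel _ _ hfy.lintegral_kernel]
          refine lintegral_congr fun b => ?_
          rw [hist_snocPath n le_rfl]
          rfl
      _ = _ := (lintegral_snd_of_mem_couplings hγ.1 (hJ.comp hh)).symm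
  have h2 : IsRegCond (γ : Measure (Path N × Path N)) (fun p => hist n h.le p.2)
      (fun p => p.1 ⟨n, h⟩) (κ n ∘ₖ m) := by
    refine isRegCond_of_lintegral hY hX fun f hf => ?_
    have hg : Measurable fun z : Path n × ℝ => ∫⁻ a, f (z.1, a) ∂(κ n z.2) :=
      Measurable.lintegral_kernel_prod_right' (κ := (κ n).comap Prod.snd measurable_snd)
        (f := fun w : (Path n × ℝ) × ℝ => f (w.1.1, w.2))
        (hf.comp ((measurable_fst.comp measurable_fst).prodMk measurable_snd))
    refine (lintegral_next_of_mem_causalPlans hγ h hμ (f := fun z => f (z.1.2, z.2))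
      (hf.comp ((measurable_snd.comp measurable_fst).prodMk measurable_snd))).trans ?_
    refine (hm.lintegral_eq hY (measurable_lastVar.comp (measurable_hist_fst n h.le)) hg).trans
      (lintegral_congr fun p => ?_)
    exact (Kernel.lintegral_comp _ _ _ (hf.comp measurable_prodMk_left)).symm
  have hmap : (γ : Measure (Path N × Path N)).map (fun p => hist n h.le p.2) =
      ν.map (hist n h.le) := by
    rw [← hγ.1.2, Measure.snd, Measure.map_map hh measurable_snd]
    rfl
  have hae := h1.ae_eq h2
  rw [hmap] at hae
  filter_upwards [ae_of_ae_map hh.aemeasurable hae] with y hy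
  rwa [Kernel.comp_apply, Kernel.comp_apply] at hy

end CausalFlow

/-! ### Telescoping of values and costs along a flow. -/

section Value

variable (N : ℕ) (c : (t : ℕ) → ℝ → Path t → ℝ≥0∞) (κ : ℕ → Kernel ℝ ℝ)
  (θ : (n : ℕ) → Kernel (Path n) ℝ) (ν : Measure (Path N)) (m : (n : ℕ) → Kernel (Path n) ℝ)

/-- The expected value `∫ ν(dy) V_n(y_1, …, y_n; m_n(y_1, …, y_n))` along a flow `m`. -/
noncomputable def valueAlong (n : ℕ) (h : n ≤ N) : ℝ≥0∞ :=
  ∫⁻ y, valueFn N c κ θ n (hist n h y) (m n (hist n h y)) ∂ν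

/-- The expected cost `∫ ν(dy) ∫ m_n(y_1, …, y_n; dx) c_n(x, y_1, …, y_n)` along a flow `m`. -/
noncomputable def costAlong (n : ℕ) (h : n ≤ N) : ℝ≥0∞ :=
  ∫⁻ y, ∫⁻ x, c n x (hist n h y) ∂(m n (hist n h y)) ∂ν

variable {N c κ θ ν m}

theorem valueAlong_self : valueAlong N c κ θ ν m N le_rfl = 0 := by
  unfold valueAlong
  have (y : Path N) (p : Measure ℝ) : valueFn N c κ θ N y p = 0 := by
    rw [valueFn, dif_neg (lt_irrefl N)]
  simp [this]

theorem valueAlong_zero [IsProbabilityMeasure ν] (hm : IsMarkovKernel (m 0)) {v : ℝ≥0∞}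
    (hv : ∀ p : Measure ℝ, IsProbabilityMeasure p → valueFn N c κ θ 0 Fin.elim0 p = v) :
    valueAlong N c κ θ ν m 0 N.zero_le = v := by
  have h0 (y : Path N) : hist 0 N.zero_le y = Fin.elim0 := Subsingleton.elim _ _
  simp [valueAlong, h0, hv (m 0 Fin.elim0) inferInstance]

theorem lintegral_stageCost_hist [∀ n, IsMarkovKernel (m n)] {n : ℕ} (h : n ≤ N)
    (hc : Measurable fun z : ℝ × Path n => c n z.1 z.2) :
    ∫⁻ y, stageCost N c κ θ n (hist n h y) (m n (hist n h y)) ∂ν =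
      costAlong N c ν m n h + valueAlong N c κ θ ν m n h := by
  unfold stageCost
  refine lintegral_add_left ?_ _
  have : Measurable fun y : Path n => ∫⁻ x, c n x y ∂(m n y) :=
    Measurable.lintegral_kernel_prod_right' (κ := m n) (f := fun z : Path n × ℝ => c n z.2 z.1)
      (hc.comp measurable_swap)
  exact this.comp (measurable_hist n h)

theorem lintegral_stageCost_succ [IsProbabilityMeasure ν] [∀ n, IsMarkovKernel (θ n)]
    [∀ n, IsMarkovKernel (m n)] {n : ℕ} (h : n < N)
    (hν : IsRegCond ν (hist n h.le) (fun y => y ⟨n, h⟩) (θ n))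
    (hc : Measurable fun z : ℝ × Path (n + 1) => c (n + 1) z.1 z.2)
    (hV : Measurable fun z : Path (n + 1) × ProbabilityMeasure ℝ =>
      valueFn N c κ θ (n + 1) z.1 z.2) :
    ∫⁻ y, ∫⁻ z, stageCost N c κ θ (n + 1) z (m (n + 1) z) ∂(extendKernel (θ n) (hist n h.le y)) ∂ν =
      costAlong N c ν m (n + 1) h + valueAlong N c κ θ ν m (n + 1) h := by
  have hs : Measurable fun z => stageCost N c κ θ (n + 1) z (m (n + 1) z) :=
    (measurable_stageCost hc hV).comp (measurable_id.prodMk (measurable_kernelProb (m (n + 1))))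
  rw [← lintegral_stageCost_hist h hc, lintegral_hist_succ h hν hs]
  exact lintegral_congr fun y => lintegral_extendKernel _ _ hs

/-- By the flow equation, `m (n + 1)` is a competitor in the one-step problem for almost every `y`.
-/
theorem valueAlong_le [IsProbabilityMeasure ν] [∀ n, IsMarkovKernel (θ n)]
    [hm : ∀ n, IsMarkovKernel (m n)] {n : ℕ} (h : n < N)
    (hν : IsRegCond ν (hist n h.le) (fun y => y ⟨n, h⟩) (θ n))
    (hc : Measurable fun z : ℝ × Path (n + 1) => c (n + 1) z.1 z.2)
    (hV : Measurable fun z : Path (n + 1) × ProbabilityMeasure ℝ =>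
      valueFn N c κ θ (n + 1) z.1 z.2)
    (hflow : ∀ᵐ y ∂ν, (extendKernel (θ n) (hist n h.le y)).bind (m (n + 1)) =
      (m n (hist n h.le y)).bind (κ n)) :
    valueAlong N c κ θ ν m n h.le ≤
      costAlong N c ν m (n + 1) h + valueAlong N c κ θ ν m (n + 1) h := by
  rw [← lintegral_stageCost_succ h hν hc hV]
  refine lintegral_mono_ae ?_
  filter_upwards [hflow] with y hy
  rw [valueFn_eq_kernelTransport h hc hV]
  exact (iInf₂_le (m (n + 1)) (hm (n + 1))).trans (iInf_le _ hy)

theorem valueAlong_zero_le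
    (hstep : ∀ (n : ℕ) (h : n < N), valueAlong N c κ θ ν m n h.le ≤
      costAlong N c ν m (n + 1) h + valueAlong N c κ θ ν m (n + 1) h) :
    valueAlong N c κ θ ν m 0 N.zero_le ≤ ∑ i : Fin N, costAlong N c ν m (i + 1) i.2 := by
  have key (n : ℕ) (h : n ≤ N) : valueAlong N c κ θ ν m 0 N.zero_le ≤
      (∑ i : Fin n, costAlong N c ν m (i + 1) (i.2.trans_le h)) +
        valueAlong N c κ θ ν m n h := by
    induction n with
    | zero => simp
    | succ n ih =>
      refine (ih (Nat.le_of_succ_le h)).trans ?_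
      rw [Fin.sum_univ_castSucc, add_assoc]
      exact add_le_add le_rfl (hstep n h)
  refine (key N le_rfl).trans ?_
  rw [valueAlong_self, add_zero]

theorem valueAlong_zero_eq
    (hstep : ∀ (n : ℕ) (h : n < N), valueAlong N c κ θ ν m n h.le =
      costAlong N c ν m (n + 1) h + valueAlong N c κ θ ν m (n + 1) h) :
    valueAlong N c κ θ ν m 0 N.zero_le = ∑ i : Fin N, costAlong N c ν m (i + 1) i.2 := by
  have key (n : ℕ) (h : n ≤ N) : valueAlong N c κ θ ν m 0 N.zero_le =
      (∑ i : Fin n, costAlong N c ν m (i + 1) (i.2.trans_le h)) +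
        valueAlong N c κ θ ν m n h := by
    induction n with
    | zero => simp
    | succ n ih =>
      rw [ih (Nat.le_of_succ_le h), Fin.sum_univ_castSucc, add_assoc]
      exact congrArg _ (hstep n h)
  rw [key N le_rfl, valueAlong_self, add_zero]

/-- This is where semiseparability enters: the `t`-th cost needs only the joint law of `x_t` and
`y^t`. -/
theorem lintegral_totalCost (hc : ∀ t, 1 ≤ t → t ≤ N → Measurable fun z : ℝ × Path t => c t z.1 z.2)
    {P : Measure (Path N × Path N)}
    (hP : ∀ (n : ℕ) (h : n < N) (f : Path (n + 1) × ℝ → ℝ≥0∞), Measurable f →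
      ∫⁻ p, f (hist (n + 1) h p.2, p.1 ⟨n, h⟩) ∂P =
        ∫⁻ y, ∫⁻ a, f (hist (n + 1) h y, a) ∂(m (n + 1) (hist (n + 1) h y)) ∂ν) :
    ∫⁻ p, totalCost c p ∂P = ∑ i : Fin N, costAlong N c ν m (i + 1) i.2 := by
  have hci (i : Fin N) := hc (i + 1) (Nat.le_add_left 1 i) i.2
  have hci' (i : Fin N) : Measurable fun p : Path N × Path N =>
      c (i + 1) (p.1 i) (hist (i + 1) i.2 p.2) :=
    (hci i).comp (((measurable_pi_apply i).comp measurable_fst).prodMk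
      (measurable_hist_snd (i + 1) i.2))
  unfold totalCost
  rw [lintegral_finsetSum _ fun i _ => hci' i]
  exact Finset.sum_congr rfl fun i _ => hP i i.2 (fun z => c (i + 1) z.2 z.1)
    ((hci i).comp measurable_swap)

end Value

/-! ### Composition of one-step optimizers. -/

section OptimalFlow

variable {N : ℕ} {c : (t : ℕ) → ℝ → Path t → ℝ≥0∞} {κ : ℕ → Kernel ℝ ℝ}
  {θ : (n : ℕ) → Kernel (Path n) ℝ}

/-- The flow obtained by the successive use of the kernels `Q n`. -/
noncomputable def flowOf (Q : (n : ℕ) → Kernel ((Path n × ProbabilityMeasure ℝ) × Path (n + 1)) ℝ)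
    (hQ : ∀ n, IsMarkovKernel (Q n)) : (n : ℕ) → {k : Kernel (Path n) ℝ // IsMarkovKernel k}
  | 0 => ⟨Kernel.const _ (Measure.dirac 0), inferInstance⟩
  | n + 1 =>
    have := (flowOf Q hQ n).2
    have hh := measurable_hist n n.le_succ
    ⟨(Q n).comap (fun y => ((hist n n.le_succ y, kernelProb (flowOf Q hQ n).1 (hist n n.le_succ y)),
      y)) ((hh.prodMk ((measurable_kernelProb _).comp hh)).prodMk measurable_id), inferInstance⟩

/-- The current law `m n y` is fed into the optimal kernel of the next step; joint measurability of
that kernel in `(y, m)` makes the result a kernel again. The start is immaterial once `κ 0` is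
constant, as arranged in the application. -/
theorem exists_optimal_flow [∀ n, IsMarkovKernel (κ n)] [∀ n, IsMarkovKernel (θ n)]
    (hc : ∀ t, 1 ≤ t → t ≤ N → Measurable fun z : ℝ × Path t => c t z.1 z.2)
    (hV : ∀ t ≤ N, Measurable fun z : Path t × ProbabilityMeasure ℝ => valueFn N c κ θ t z.1 z.2)
    (hopt : ∀ n < N,
      HasOptimalKernel (κ n) (extendKernel (θ n)) (stageCost N c κ θ (n + 1))) :
    ∃ (m : (n : ℕ) → Kernel (Path n) ℝ) (_ : ∀ n, IsMarkovKernel (m n)),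
      (∀ y, m 0 y = Measure.dirac 0) ∧
      ∀ n < N, ∀ y, (extendKernel (θ n) y).bind (m (n + 1)) = (m n y).bind (κ n) ∧
        ∫⁻ z, stageCost N c κ θ (n + 1) z (m (n + 1) z) ∂(extendKernel (θ n) y) =
          valueFn N c κ θ n y (m n y) := by
  have hQ (n : ℕ) : ∃ Q : Kernel ((Path n × ProbabilityMeasure ℝ) × Path (n + 1)) ℝ,
      IsMarkovKernel Q ∧ (n < N → ∀ (y : Path n) (m : ProbabilityMeasure ℝ),
        (extendKernel (θ n) y).bind (Q.sectR (y, m)) = (m : Measure ℝ).bind (κ n) ∧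
        ∫⁻ y', stageCost N c κ θ (n + 1) y' (Q ((y, m), y')) ∂(extendKernel (θ n) y) =
          kernelTransport ((m : Measure ℝ).bind (κ n)) (extendKernel (θ n) y)
            (stageCost N c κ θ (n + 1))) := by
    by_cases h : n < N
    · obtain ⟨Q, hQ, hQ'⟩ := hopt n h
      exact ⟨Q, hQ, fun _ => hQ'⟩
    · exact ⟨Kernel.const _ (Measure.dirac 0), inferInstance, fun h' => absurd h' h⟩
  choose Q hQm hQ using hQ
  let m (n : ℕ) : Kernel (Path n) ℝ := (flowOf Q hQm n).1
  have hm (n : ℕ) : IsMarkovKernel (m n) := (flowOf Q hQm n).2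
  have hsucc (n : ℕ) (y : Path n) (b : ℝ) : m (n + 1) (snocPath y b) =
      (Q n).sectR (y, kernelProb (m n) y) (snocPath y b) := by
    have : m (n + 1) (snocPath y b) = Q n ((hist n n.le_succ (snocPath y b),
      kernelProb (m n) (hist n n.le_succ (snocPath y b))), snocPath y b) := rfl
    rw [this, hist_snocPath n le_rfl, Kernel.sectR_apply]
    rfl
  refine ⟨m, hm, fun y => rfl, fun n h y => ⟨?_, ?_⟩⟩
  · rw [← coe_kernelProb (m n) y, ← (hQ n h y _).1]
    refine Measure.ext_of_lintegral _ fun f hf => ?_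
    rw [Measure.lintegral_bind (Kernel.measurable _).aemeasurable hf.aemeasurable,
      Measure.lintegral_bind (Kernel.measurable _).aemeasurable hf.aemeasurable,
      lintegral_extendKernel _ _ hf.lintegral_kernel, lintegral_extendKernel _ _ hf.lintegral_kernel]
    simp only [hsucc]
  · have hC := measurable_stageCost (hc (n + 1) (Nat.le_add_left 1 n) h) (hV (n + 1) h)
    have h1 : Measurable fun z => stageCost N c κ θ (n + 1) z (m (n + 1) z) :=
      hC.comp (measurable_id.prodMk (measurable_kernelProb (m (n + 1))))
    have h2 : Measurable fun z =>
        stageCost N c κ θ (n + 1) z ((Q n).sectR (y, kernelProb (m n) y) z) :=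
      hC.comp (measurable_id.prodMk (measurable_kernelProb _))
    rw [valueFn_eq_kernelTransport h (hc (n + 1) (Nat.le_add_left 1 n) h) (hV (n + 1) h),
      ← coe_kernelProb (m n) y, ← (hQ n h y _).2, lintegral_extendKernel _ _ h1]
    refine Eq.trans ?_ (lintegral_extendKernel _ _ h2).symm
    simp only [hsucc]

end OptimalFlow

/-! ### The two inequalities between the value and the causal problem. -/

section DynamicProgramming

variable {N : ℕ} {μ ν : Measure (Path N)} [IsProbabilityMeasure μ] [IsProbabilityMeasure ν]
  {c : (t : ℕ) → ℝ → Path t → ℝ≥0∞} {κ : ℕ → Kernel ℝ ℝ} {θ : (n : ℕ) → Kernel (Path n) ℝ}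
  [∀ n, IsMarkovKernel (κ n)] [∀ n, IsMarkovKernel (θ n)]

theorem le_lintegral_totalCost_of_mem_causalPlans
    (hμ : ∀ (n : ℕ) (h : n < N),
      IsRegCond μ (hist n h.le) (fun x => x ⟨n, h⟩) (lastKernel (κ n) n))
    (hν : ∀ (n : ℕ) (h : n < N), IsRegCond ν (hist n h.le) (fun y => y ⟨n, h⟩) (θ n))
    (hc : ∀ t, 1 ≤ t → t ≤ N → Measurable fun z : ℝ × Path t => c t z.1 z.2)
    (hV : ∀ t ≤ N, Measurable fun z : Path t × ProbabilityMeasure ℝ => valueFn N c κ θ t z.1 z.2)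
    {v : ℝ≥0∞}
    (hv : ∀ p : Measure ℝ, IsProbabilityMeasure p → valueFn N c κ θ 0 Fin.elim0 p = v)
    {γ : ProbabilityMeasure (Path N × Path N)} (hγ : γ ∈ CausalPlans μ ν) :
    v ≤ ∫⁻ p, totalCost c p ∂(γ : Measure (Path N × Path N)) := by
  have hex (n : ℕ) : ∃ m : Kernel (Path n) ℝ, IsMarkovKernel m ∧ ∀ h : n ≤ N,
      IsRegCond (γ : Measure (Path N × Path N)) (fun p => hist n h p.2)
        (fun p => lastVar (hist n h p.1)) m := by
    by_cases h : n ≤ N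
    · exact ⟨condDistrib (fun p : Path N × Path N => lastVar (hist n h p.1))
        (fun p => hist n h p.2) (γ : Measure (Path N × Path N)), inferInstance,
        fun _ => isRegCond_condDistrib (measurable_lastVar.comp (measurable_hist_fst n h))⟩
    · exact ⟨Kernel.const _ (Measure.dirac 0), inferInstance, fun h' => absurd h' h⟩
  -- The flow of `γ`; beyond time `N` it is an arbitrary kernel.
  choose m hm hreg using hex
  have hcost : ∫⁻ p, totalCost c p ∂(γ : Measure (Path N × Path N)) =
      ∑ i : Fin N, costAlong N c ν m (i + 1) i.2 := by
    refine lintegral_totalCost hc fun n h f hf => ?_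
    refine ((hreg (n + 1) h).lintegral_eq (measurable_hist_snd (n + 1) h)
      (measurable_lastVar.comp (measurable_hist_fst (n + 1) h)) hf).trans ?_
    have hg : Measurable fun y => ∫⁻ a, f (y, a) ∂(m (n + 1) y) := hf.lintegral_kernel_prod_right'
    exact lintegral_snd_of_mem_couplings hγ.1 (hg.comp (measurable_hist (n + 1) h))
  rw [hcost, ← valueAlong_zero (ν := ν) (hm 0) hv]
  exact valueAlong_zero_le fun n h => valueAlong_le h (hν n h)
    (hc (n + 1) (Nat.le_add_left 1 n) h) (hV (n + 1) h)
    (ae_bind_eq_of_mem_causalPlans hγ h (hμ n h) (hν n h) (hreg n h.le) (hreg (n + 1) h))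

theorem exists_mem_causalPlans_lintegral_eq
    (hμ : ∀ (n : ℕ) (h : n < N),
      IsRegCond μ (hist n h.le) (fun x => x ⟨n, h⟩) (lastKernel (κ n) n))
    (hν : ∀ (n : ℕ) (h : n < N), IsRegCond ν (hist n h.le) (fun y => y ⟨n, h⟩) (θ n))
    (hc : ∀ t, 1 ≤ t → t ≤ N → Measurable fun z : ℝ × Path t => c t z.1 z.2)
    (hV : ∀ t ≤ N, Measurable fun z : Path t × ProbabilityMeasure ℝ => valueFn N c κ θ t z.1 z.2)
    (hopt : ∀ n < N, HasOptimalKernel (κ n) (extendKernel (θ n)) (stageCost N c κ θ (n + 1)))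
    {v : ℝ≥0∞}
    (hv : ∀ p : Measure ℝ, IsProbabilityMeasure p → valueFn N c κ θ 0 Fin.elim0 p = v) :
    ∃ γ ∈ CausalPlans μ ν, IsQuasiMarkov γ ∧
      ∫⁻ p, totalCost c p ∂(γ : Measure (Path N × Path N)) = v := by
  obtain ⟨m, hm, hm0, hflow⟩ := exists_optimal_flow hc hV hopt
  obtain ⟨G, hGp, hG⟩ := exists_measure_isRegCond (fun n => (nextKernel κ θ m n).comap
    (fun z : Path n × Path n => (lastVar z.1, z.2))
    ((measurable_lastVar.comp measurable_fst).prodMk measurable_snd)) N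
  replace hG : HasNextKernel κ θ m G := hG
  have hsnd {n : ℕ} (h : n ≤ N) {f : Path n × ℝ → ℝ≥0∞} (hf : Measurable f) :=
    hG.lintegral_hist_snd hν hm0 (fun n hn y => (hflow n hn y).1) h hf
  let γ : ProbabilityMeasure (Path N × Path N) := ⟨G, hGp⟩
  have hγ : γ ∈ Couplings μ ν := by
    constructor
    · refine Measure.ext_of_lintegral _ fun f hf => ?_
      rw [Measure.fst, lintegral_map hf measurable_fst]
      exact hG.lintegral_hist_fst hμ le_rfl hf
    · refine Measure.ext_of_lintegral _ fun f hf => ?_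
      rw [Measure.snd, lintegral_map hf measurable_snd]
      refine (hsnd le_rfl (f := fun z => f z.1) (hf.comp measurable_fst)).trans ?_
      simp [hist_self_apply]
  refine ⟨γ, mem_causalPlans_of_isRegCond hγ fun n h => hG.isRegCond_pastKernel n h,
    hG.isQuasiMarkov rfl, ?_⟩
  rw [← valueAlong_zero (ν := ν) (hm 0) hv]
  refine (lintegral_totalCost hc fun n h f hf => hsnd h hf).trans (valueAlong_zero_eq ?_).symm
  intro n h
  rw [← lintegral_stageCost_succ h (hν n h) (hc (n + 1) (Nat.le_add_left 1 n) h) (hV (n + 1) h)]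
  exact lintegral_congr fun y => ((hflow n h _).2).symm

end DynamicProgramming

/-! ### The first step written as an ordinary step from time zero. -/

section Start

variable {N : ℕ} {c : (t : ℕ) → ℝ → Path t → ℝ≥0∞} {κ κ' : ℕ → Kernel ℝ ℝ}
  {θ θ' : (n : ℕ) → Kernel (Path n) ℝ}

theorem valueFn_congr (hκ : ∀ t, 1 ≤ t → κ' t = κ t) (hθ : ∀ t, 1 ≤ t → θ' t = θ t) {t : ℕ}
    (ht : 1 ≤ t) : valueFn N c κ' θ' t = valueFn N c κ θ t := by
  induction k : N - t generalizing t with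
  | zero =>
    ext y m
    rw [valueFn, valueFn, dif_neg (by omega), dif_neg (by omega)]
  | succ k ih =>
    ext y m
    rw [valueFn, valueFn, dif_pos (by omega), dif_pos (by omega), hκ t ht, hθ t ht,
      @ih (t + 1) (by omega) (by omega)]

/-- Constant kernels at time zero forget the initial law `p`, so the initial problem is the step of
index `0` from any starting point. -/
theorem valueFn_zero_eq_valueZero (hN : 0 < N) (hκ : ∀ t, 1 ≤ t → κ' t = κ t)
    (hθ : ∀ t, 1 ≤ t → θ' t = θ t) {μ₁ ν₁ : Measure ℝ} (hκ0 : κ' 0 = Kernel.const ℝ μ₁)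
    (hθ0 : θ' 0 = Kernel.const _ ν₁) (p : Measure ℝ) [IsProbabilityMeasure p] :
    valueFn N c κ' θ' 0 Fin.elim0 p = valueZero N c κ θ μ₁ ν₁ := by
  rw [valueFn, dif_pos hN, valueZero, hκ0, hθ0, Kernel.const_apply, ← valueFn_congr hκ hθ le_rfl]
  have hb : p.bind (Kernel.const ℝ μ₁) = μ₁ := by simp
  rw [hb]

theorem isRegCond_hist_zero (hN : 0 < N) (μ : Measure (Path N)) [IsProbabilityMeasure μ] :
    IsRegCond μ (hist 0 hN.le) (fun x => x ⟨0, hN⟩)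
      (Kernel.const _ (μ.map fun x => x ⟨0, hN⟩)) := by
  have hx : Measurable fun x : Path N => x ⟨0, hN⟩ := measurable_pi_apply _
  have := Measure.isProbabilityMeasure_map (μ := μ) hx.aemeasurable
  refine isRegCond_of_lintegral (measurable_hist 0 hN.le) hx fun f hf => ?_
  have h0 (x : Path N) : hist 0 hN.le x = default := Subsingleton.elim _ _
  simp only [h0, Kernel.const_apply, lintegral_const, measure_univ, mul_one]
  exact (lintegral_map (hf.comp measurable_prodMk_left) hx).symm

theorem isRegCond_lastKernel_of_isMarkovMeasure {μ : Measure (Path N)} [IsProbabilityMeasure μ]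
    (hμ : IsMarkovMeasure μ) {s : ℕ} (h : s + 1 < N) {K : Kernel ℝ ℝ} [IsMarkovKernel K]
    (hK : IsRegCond μ (fun x => x ⟨s, Nat.lt_of_succ_lt h⟩) (fun x => x ⟨s + 1, h⟩) K) :
    IsRegCond μ (hist (s + 1) h.le) (fun x => x ⟨s + 1, h⟩) (lastKernel K (s + 1)) := by
  have hY : Measurable fun x : Path N => x ⟨s + 1, h⟩ := measurable_pi_apply _
  have hX : Measurable fun x : Path N => x ⟨s, Nat.lt_of_succ_lt h⟩ := measurable_pi_apply _
  have hh := measurable_hist (N := N) (s + 1) h.le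
  refine isRegCond_of_lintegral hh hY fun f hf => ?_
  rw [(isRegCond_condDistrib hY).lintegral_eq hh hY hf]
  refine lintegral_congr_ae ?_
  filter_upwards [hμ s h, ae_of_ae_map hX.aemeasurable ((isRegCond_condDistrib hY).ae_eq hK)]
    with x hx hx'
  rw [hx, hx']
  rfl

end Start

/-! ### Transition kernels send supports to supports. -/

section Support

/-- If `K x` charged this open complement, then by weak continuity so would `K x'` for all nearby
`x'` in the support of `ρ`. These form a set of positive `ρ`-measure, contradicting that `ρ.bind K`
does not charge the complement of its support. -/
theorem apply_compl_support_bind_eq_zero {ρ : Measure ℝ} {K : Kernel ℝ ℝ} [IsMarkovKernel K]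
    (hK : ContinuousOn (kernelProb K) ρ.support) {x : ℝ} (hx : x ∈ ρ.support) :
    K x (ρ.bind K).supportᶜ = 0 := by
  set U := (ρ.bind K).supportᶜ with hU
  have hUo : IsOpen U := Measure.isOpen_compl_support
  have hae : ∀ᵐ x ∂ρ, K x U = 0 := by
    have h0 : ρ.bind K U = 0 := Measure.measure_compl_support
    rw [Measure.bind_apply hUo.measurableSet (Kernel.measurable K).aemeasurable,
      lintegral_eq_zero_iff (Kernel.measurable_coe K hUo.measurableSet)] at h0
    exact h0
  by_contra hne
  have hpos : (0 : ℝ≥0∞) < (kernelProb K x : Measure ℝ) U := pos_iff_ne_zero.2 hne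
  have hev : ∀ᶠ x' in 𝓝[ρ.support] x, 0 < K x' U :=
    (hK x hx).eventually (lowerSemicontinuous_measure_of_isOpen hUo _ _ hpos)
  obtain ⟨V, hV, hVs⟩ := mem_nhdsWithin_iff_exists_mem_nhds_inter.1 hev
  have hV0 : ρ V = 0 := by
    have : ∀ᵐ x' ∂ρ, x' ∉ V := by
      filter_upwards [hae, Measure.support_mem_ae] with x' h1 h2 h3
      have h4 : 0 < K x' U := hVs ⟨h3, h2⟩
      exact h4.ne' h1
    simpa [ae_iff] using this
  exact ((Measure.mem_support_iff_forall x).1 hx V hV).ne' hV0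

end Support

end CausalDPP

open CausalDPP in
/-- Dynamic programming principle for causal optimal transport. `κ t` and `θ t` are arbitrary
versions of `μ^{x_t}(dx_{t+1})` and `ν^{y_1,…,y_t}(dy_{t+1})`. -/
theorem mainTheorem2 {N : ℕ} (hN : 0 < N)
    (μ ν : Measure (Path N)) [IsProbabilityMeasure μ] [IsProbabilityMeasure ν]
    (hμ : IsMarkovMeasure μ)
    (c : (t : ℕ) → ℝ → Path t → ℝ≥0∞)
    (hc : ∀ t, 1 ≤ t → t ≤ N → LowerSemicontinuous (fun p : ℝ × Path t => c t p.1 p.2))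
    (κ : ℕ → Kernel ℝ ℝ) [∀ t, IsMarkovKernel (κ t)]
    (hκ : ∀ (s : ℕ) (h : s + 1 < N),
      IsRegCond μ (fun x => x ⟨s, by omega⟩) (fun x => x ⟨s + 1, h⟩) (κ (s + 1)))
    (θ : (t : ℕ) → Kernel (Path t) ℝ) [∀ t, IsMarkovKernel (θ t)]
    (hθ : ∀ (t : ℕ) (_ : 1 ≤ t) (h : t < N),
      IsRegCond ν (hist t h.le) (fun y => y ⟨t, h⟩) (θ t)) :
    -- the integrals in the recursion are well defined
    ((∀ t, 1 ≤ t → t < N → ∀ (y : Path t) (m : Measure ℝ), IsProbabilityMeasure m →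
        ∀ γ ∈ Couplings (m.bind (κ t)) (θ t y),
          AEMeasurable (stepIntegrand (c (t + 1)) (valueFn N c κ θ (t + 1)) y γ)
            (γ : Measure (ℝ × ℝ))) ∧
      (∀ γ ∈ Couplings (μ.map (fun x => x ⟨0, hN⟩)) (ν.map (fun y => y ⟨0, hN⟩)),
          AEMeasurable (stepIntegrand (c 1) (valueFn N c κ θ 1) Fin.elim0 γ)
            (γ : Measure (ℝ × ℝ)))) ∧
    -- the recursion determines the value of the causal problem
    valueZero N c κ θ (μ.map (fun x => x ⟨0, hN⟩)) (ν.map (fun y => y ⟨0, hN⟩)) =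
      causalValue μ ν c ∧
    -- there is a causal quasi-Markov optimizer
    (SuccessivelyWeaklyContinuous μ →
      ∃ γ ∈ CausalPlans μ ν, IsQuasiMarkov γ ∧
        ∫⁻ p, totalCost c p ∂(γ : Measure (Path N × Path N)) = causalValue μ ν c) ∧
    -- every one-step problem is a general transport problem
    ((∀ t, 1 ≤ t → t < N → ∀ (y : Path t) (m : Measure ℝ), IsProbabilityMeasure m →
        (∀ q : Kernel ℝ ℝ, IsMarkovKernel q → (θ t y).bind q = m.bind (κ t) →
          AEMeasurable (fun y' => stepCost N c κ θ t y y' (q y')) (θ t y)) ∧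
        valueFn N c κ θ t y m =
          generalTransport (m.bind (κ t)) (θ t y) (stepCost N c κ θ t y)) ∧
      (∀ q : Kernel ℝ ℝ, IsMarkovKernel q →
        (ν.map (fun y => y ⟨0, hN⟩)).bind q = μ.map (fun x => x ⟨0, hN⟩) →
          AEMeasurable (fun y' => stepCost N c κ θ 0 Fin.elim0 y' (q y'))
            (ν.map (fun y => y ⟨0, hN⟩))) ∧
      valueZero N c κ θ (μ.map (fun x => x ⟨0, hN⟩)) (ν.map (fun y => y ⟨0, hN⟩)) =
        generalTransport (μ.map (fun x => x ⟨0, hN⟩)) (ν.map (fun y => y ⟨0, hN⟩))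
          (stepCost N c κ θ 0 Fin.elim0)) ∧
    -- whose cost is convex in the kernel
    (∀ t, t < N → ∀ (y : Path t) (y' : ℝ),
      ConvexOn ℝ≥0 {p : Measure ℝ | IsProbabilityMeasure p} (stepCost N c κ θ t y y')) ∧
    -- and lower semicontinuous in the kernel if the transition kernels are weakly continuous
    ((∀ (s : ℕ) (h : s + 1 < N),
        WeaklyContinuousOn (κ (s + 1)) (μ.map (fun x => x ⟨s, by omega⟩)).support) →
      ∀ (t : ℕ) (h : t < N) (y : Path t) (y' : ℝ),
        LowerSemicontinuousOn
          (fun p : ProbabilityMeasure ℝ => stepCost N c κ θ t y y' (p : Measure ℝ))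
          {p | (p : Measure ℝ) (μ.map (fun x => x ⟨t, h⟩)).supportᶜ = 0}) := by
  have hx1 : Measurable fun x : Path N => x ⟨0, hN⟩ := measurable_pi_apply _
  have hμ₁ := Measure.isProbabilityMeasure_map (μ := μ) hx1.aemeasurable
  have hν₁ := Measure.isProbabilityMeasure_map (μ := ν) hx1.aemeasurable
  have hcm (t : ℕ) (h1 : 1 ≤ t) (h2 : t ≤ N) : Measurable fun z : ℝ × Path t => c t z.1 z.2 :=
    (hc t h1 h2).measurable
  -- With empty sets the continuity conditions are vacuous and every topology may be refined freely.
  -- This suffices for measurability, convexity and optimal kernels.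
  have hreg {t : ℕ} (h : t ≤ N) := regular_valueFn (κ := κ) (θ := θ) hc (S := fun _ => ∅)
    (fun _ => isClosed_empty) (fun _ _ => continuousOn_empty _)
    (fun _ _ x hx => absurd hx (Set.notMem_empty x)) h
  have hV {t : ℕ} (h : t ≤ N) := (hreg h).1.measurable
  -- the kernels at time `0` are replaced by the laws of the first variables
  let κ' : ℕ → Kernel ℝ ℝ
    | 0 => Kernel.const ℝ (μ.map fun x => x ⟨0, hN⟩)
    | s + 1 => κ (s + 1)
  let θ' : (t : ℕ) → Kernel (Path t) ℝ
    | 0 => Kernel.const _ (ν.map fun y => y ⟨0, hN⟩)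
    | s + 1 => θ (s + 1)
  have hκ'm (t : ℕ) : IsMarkovKernel (κ' t) := by
    cases t <;> simp only [κ'] <;> infer_instance
  have hθ'm (t : ℕ) : IsMarkovKernel (θ' t) := by
    cases t <;> simp only [θ'] <;> infer_instance
  have hκ' (t : ℕ) (ht : 1 ≤ t) : κ' t = κ t := by
    obtain ⟨s, rfl⟩ := Nat.exists_eq_add_of_le' ht
    rfl
  have hθ' (t : ℕ) (ht : 1 ≤ t) : θ' t = θ t := by
    obtain ⟨s, rfl⟩ := Nat.exists_eq_add_of_le' ht
    rfl
  have hreg' {t : ℕ} (h : t ≤ N) := regular_valueFn (κ := κ') (θ := θ') hc (S := fun _ => ∅)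
    (fun _ => isClosed_empty) (fun _ _ => continuousOn_empty _)
    (fun _ _ x hx => absurd hx (Set.notMem_empty x)) h
  have hμ' (n : ℕ) (h : n < N) :
      IsRegCond μ (hist n h.le) (fun x => x ⟨n, h⟩) (lastKernel (κ' n) n) := by
    cases n with
    | zero => exact isRegCond_hist_zero hN μ
    | succ s => exact isRegCond_lastKernel_of_isMarkovMeasure hμ h (hκ s h)
  have hν' (n : ℕ) (h : n < N) : IsRegCond ν (hist n h.le) (fun y => y ⟨n, h⟩) (θ' n) := by
    cases n with
    | zero => exact isRegCond_hist_zero hN ν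
    | succ s => exact hθ (s + 1) (Nat.le_add_left 1 s) h
  have hv (p : Measure ℝ) (_ : IsProbabilityMeasure p) : valueFn N c κ' θ' 0 Fin.elim0 p =
      valueZero N c κ θ (μ.map fun x => x ⟨0, hN⟩) (ν.map fun y => y ⟨0, hN⟩) :=
    valueFn_zero_eq_valueZero hN hκ' hθ' rfl rfl p
  obtain ⟨γ, hγ, hγQ, hγv⟩ := exists_mem_causalPlans_lintegral_eq hμ' hν' hcm
    (fun t ht => (hreg' ht).1.measurable) (fun n hn => (hreg' hn.le).2.2 hn) hv
  have hvalue : valueZero N c κ θ (μ.map fun x => x ⟨0, hN⟩) (ν.map fun y => y ⟨0, hN⟩) =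
      causalValue μ ν c := by
    -- The plan `γ` has cost `V_0`, which gives one inequality and, with the other, attainment.
    refine le_antisymm (le_iInf₂ fun γ' hγ' => ?_) (hγv ▸ iInf₂_le γ hγ)
    exact le_lintegral_totalCost_of_mem_causalPlans hμ' hν' hcm
      (fun t ht => (hreg' ht).1.measurable) hv hγ'
  refine ⟨⟨fun t _ ht y m _ γ' _ => ?_, fun γ' _ => ?_⟩, hvalue,
    fun _ => ⟨γ, hγ, hγQ, hγv.trans hvalue⟩, ⟨fun t _ ht y m _ => ⟨fun q hq _ => ?_, ?_⟩,
    fun q hq _ => ?_, ?_⟩, fun t ht y y' => ?_, fun hcont t ht y y' => ?_⟩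
  · exact (measurable_stepIntegrand (hcm (t + 1) (Nat.le_add_left 1 t) ht) (hV ht) y γ').aemeasurable
  · exact (measurable_stepIntegrand (hcm 1 le_rfl hN) (hV hN) Fin.elim0 γ').aemeasurable
  · exact (measurable_lintegral_add_kernel (hcm (t + 1) (Nat.le_add_left 1 t) ht) (hV ht) y
      q).aemeasurable
  · exact valueFn_eq_generalTransport ht (hcm (t + 1) (Nat.le_add_left 1 t) ht) (hV ht) y m
  · exact (measurable_lintegral_add_kernel (hcm 1 le_rfl hN) (hV hN) Fin.elim0 q).aemeasurable
  · exact iInf_stepIntegrand_eq_generalTransport (f := c 1) (W := valueFn N c κ θ 1)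
      (hcm 1 le_rfl hN) (hV hN) Fin.elim0 _ _
  · exact convexOn_stageCost ((hreg ht).2.1 _)
  -- The set of index `s + 1` is the support of the law of the coordinate with index `s`. At time
  -- zero, where `κ 0` is arbitrary, and beyond `N` the empty set imposes no condition.
  · let S : ℕ → Set ℝ
      | 0 => ∅
      | s + 1 => if h : s < N then (μ.map fun x => x ⟨s, h⟩).support else ∅
    have hSs {s : ℕ} (h : s < N) : S (s + 1) = (μ.map fun x => x ⟨s, h⟩).support := dif_pos h
    have hS (t : ℕ) : IsClosed (S t) := by
      rcases t with _ | s
      · exact isClosed_empty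
      · by_cases h : s < N
        · rw [hSs h]
          exact Measure.isClosed_support
        · simp only [S, dif_neg h, isClosed_empty]
    have hSc (t : ℕ) (h : t < N) : ContinuousOn (kernelProb (κ t)) (S t) := by
      rcases t with _ | s
      · exact continuousOn_empty _
      · rw [hSs (Nat.lt_of_succ_lt h)]
        exact hcont s h
    have hSκ (t : ℕ) (h : t < N) (x : ℝ) (hx : x ∈ S t) : κ t x (S (t + 1))ᶜ = 0 := by
      rcases t with _ | s
      · exact absurd hx (Set.notMem_empty x)
      · have hbind : (μ.map fun x => x ⟨s, Nat.lt_of_succ_lt h⟩).bind (κ (s + 1)) =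
            μ.map fun x => x ⟨s + 1, h⟩ := by
          have hpair : Measurable fun x : Path N =>
              (x ⟨s, Nat.lt_of_succ_lt h⟩, x ⟨s + 1, h⟩) :=
            (measurable_pi_apply _).prodMk (measurable_pi_apply _)
          rw [← Measure.snd_compProd, hκ s h, Measure.snd]
          exact Measure.map_map measurable_snd hpair
        rw [hSs (Nat.lt_of_succ_lt h)] at hx
        rw [hSs h, ← hbind]
        exact apply_compl_support_bind_eq_zero (hcont s h) hx
    have hregS := (regular_valueFn (κ := κ) (θ := θ) (t := t + 1) hc hS hSc hSκ ht).1
    have hlsc := (hregS.lintegral_add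
      (hc (t + 1) (Nat.le_add_left 1 t) ht)).lowerSemicontinuousOn (hS (t + 1)).measurableSet
      (snocPath y y')
    rw [hSs ht] at hlsc
    exact hlsc
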